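/- **Setting.** Let $X=\begin{bmatrix}0&1\\1&0\end{bmatrix}$, $Z=\begin{bmatrix}1&0\\0&-1\end{bmatrix}$, $H=\tfrac1{\sqrt2}\begin{bmatrix}1&1\\1&-1\end{bmatrix}$, $CZ=\mathrm{diag}(1,1,1,-1)$. For $n\ge 0$ the real Pauli group $\mathcal P_n$ consists of all $\pm P_1\otimes\cdots\otimes P_n$ with $P_i\in\{I,X,Z,XZ\}$, and the real stabilizer (or real Clifford) group $\mathcal C_n$ is the normalizer of $\mathcal P_n$ in the orthogonal group $O(2^n)$. A real Clifford circuit on $n$ wires, numbered $0,\dots,n-1$ from top to bottom, is a word, read from left to right (the leftmost gate is applied first), in the gates $-1$ (a scalar), $H_i$ and $Z_i$ ($0\le i<n$, acting on wire $i$) and $K_i$ ($0\le i<n-1$, the gate $CZ$ acting on wires $i$ and $i+1$). Every circuit denotes an operator, namely the product of its gates. As usual for circuit diagrams, gates with no wire in common may be slid past each other, and the scalar $-1$ past every gate. **Reduced relations** ($\varepsilon$ denotes the empty circuit). - R1: $(-1)(-1)=\varepsilon$. - On one wire: R2: $Z_0Z_0=\varepsilon$. R3: $H_0H_0=\varepsilon$.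 R4: $Z_0H_0Z_0H_0Z_0H_0Z_0H_0=(-1)$. - On two wires: R5: $K_0K_0=\varepsilon$. R6: $Z_0K_0=K_0Z_0$. R7: $Z_1K_0=K_0Z_1$. R8: $H_0Z_0H_0K_0=K_0H_0Z_0Z_1H_0$. R9: $H_1Z_1H_1K_0=K_0H_1Z_0Z_1H_1$. R10: $H_0K_0H_0K_0=K_0H_0K_0H_0Z_1$. R11: $H_1K_0H_1K_0=K_0H_1K_0Z_0H_1$. R12: $H_1K_0H_0H_1K_0H_0H_1K_0=K_0H_0H_1K_0H_0H_1K_0H_0$. - On three wires: R13: $K_0K_1=K_1K_0$. R14: $H_2K_1H_1H_2K_1H_1K_0H_1K_1H_1H_2K_1H_2=H_0K_0H_0H_1K_0H_1K_1H_1K_0H_0H_1K_0H_0$. R15: $K_0H_0H_1K_0H_0H_1K_1K_0H_0H_1K_0H_0H_1K_1=K_1H_0H_1K_0H_0H_1K_0$. R16: $K_1H_1H_2K_1H_1H_2K_0K_1H_1H_2K_1H_1H_2K_0=K_0H_1H_2K_1H_1H_2K_1$. Each relation may be applied, in either direction, to any subcircuit and on any block of adjacent wires. **Normal circuits.** The following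 derived gates are used; wires carry a type, single or double, and all wires are single except where stated. - Kind $A$ (one wire): $A_1=\varepsilon$, $A_2=H_0$ (both with single output), $A_3=\varepsilon$ (with double output). - Kind $B$ (two wires): $B_1=B_5=H_1K_0H_0H_1K_0H_0H_1K_0$, $B_2=B_6=K_0H_0H_1K_0$, $B_3=B_7=H_0K_0H_0H_1K_0$, $B_4=B_8=H_1K_0H_1K_0H_0H_1K_0$. From the type of the bottom input to the type of the top output, $B_1,B_2,B_3$ go from single to single, $B_4$ from single to double, $B_5,B_6,B_7$ from double to double, $B_8$ from double to single. - Kind $C$ (one wire): $C_1=\varepsilon$, $C_2=H_0Z_0H_0$. - Kind $D$ (two wires): $D_1=K_0H_0H_1K_0H_0H_1K_0H_1$, $D_2=H_0K_0H_0H_1K_0H_1$, $D_3=H_0H_1K_0H_0H_1K_0H_1$, $D_4=H_0K_0H_0H_1K_0H_1K_0$. - Kind $E$ (one wire): $E_1=\varepsilon$, $E_2=Z_0$. A $Z$-circuit on $n\ge1$ wires consists of a gate of kind $A$ on some wire $k$, then gates of kind $B$ on wires $(k-1,k),(k-2,k-1),\dots,(0,1)$, then a gate of kind $C$ on wire $0$,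 such that the types of connected wires agree (so the wire entering the gate of kind $C$ is single). An $X$-circuit on $n\ge1$ wires consists of gates of kind $D$ on wires $(0,1),(1,2),\dots,(n-2,n-1)$, then a gate of kind $E$ on wire $n-1$. A normal circuit on $n$ wires is a circuit $L_nM_nL_{n-1}M_{n-1}\cdots L_1M_1\cdot(\pm1)$, where $L_i$ is a $Z$-circuit and $M_i$ an $X$-circuit on the top $i$ wires. **Proposition.** For every $n\ge0$: 1. For every real Clifford circuit $C$ on $n$ wires there is a unique normal circuit $N$ (as a typed circuit) that denotes the same operator as $C$, the normal form of $C$; and $C$ can be rewritten into $N$ by finitely many applications of the reduced relations R1–R16. 2. Consequently, the finitely many gates $-1$, $H_i$, $Z_i$, $K_i$ on $n$ wires together with the (finitely many) instances on $n$ wires of R1–R16 and of the sliding rule are a presentation of $\mathcal C_n$: sending a circuit to its operator induces an isomorphism from the monoid with these generators and relations onto $\mathcal C_n$ (with the order of multiplication reversed, since circuits are read from left to right). -/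

import Mathlib

namespace RealStabilizer

/-! ### Circuits over `-1`, `H`, `Z`, `CZ` -/

/-- The elementary gates on `n` wires; wire `0` is the top wire. `neg` is the scalar `-1`,
`H i` and `Z i` act on wire `i`, and `CZ i` acts on the adjacent wires `i` and `i + 1`. -/
inductive Gate (n : ℕ) : Type
  | neg : Gate n
  | H (i : Fin n) : Gate n
  | Z (i : Fin n) : Gate n
  | CZ (i : ℕ) (hi : i + 1 < n := by decide) : Gate n

/-- The wires on which a gate acts. -/
def Gate.wires {n : ℕ} : Gate n → Set ℕ
  | .neg => ∅
  | .H i => {(i : ℕ)}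
  | .Z i => {(i : ℕ)}
  | .CZ i _ => {i, i + 1}

/-- A circuit on `n` wires: a word in the gates, read from left to right as in a circuit diagram,
so that the leftmost gate is applied first. -/
abbrev Circuit (n : ℕ) : Type := FreeMonoid (Gate n)

/-- Write a circuit as a list of gates, the first one leftmost in the diagram. -/
abbrev circ {n : ℕ} (l : List (Gate n)) : Circuit n := FreeMonoid.ofList l

/-- Place a gate on `m` wires on the wires `k, …, k + m - 1` out of `n`. -/
def Gate.place {m n : ℕ} (k : ℕ) (h : k + m ≤ n) : Gate m → Gate n
  | .neg => .neg
  | .H i => .H ⟨k + i, by omega⟩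
  | .Z i => .Z ⟨k + i, by omega⟩
  | .CZ i _ => .CZ (k + i) (by omega)

/-- Place a circuit on `m` wires on the wires `k, …, k + m - 1` out of `n`, that is, tensor it with
`k` identity wires above and `n - k - m` identity wires below. -/
def Circuit.place {m n : ℕ} (k : ℕ) (h : k + m ≤ n) : Circuit m →* Circuit n :=
  FreeMonoid.map (Gate.place k h)

/-! ### The reduced relations -/

open Gate in
/-- The sixteen reduced relations; `ReducedRel m u v` is a relation `u = v` on `m` wires. -/
inductive ReducedRel : (m : ℕ) → Circuit m → Circuit m → Prop
  | R1 : ReducedRel 0 (circ [neg, neg]) (circ [])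
  | R2 : ReducedRel 1 (circ [Z 0, Z 0]) (circ [])
  | R3 : ReducedRel 1 (circ [H 0, H 0]) (circ [])
  | R4 : ReducedRel 1 (circ [Z 0, H 0, Z 0, H 0, Z 0, H 0, Z 0, H 0]) (circ [neg])
  | R5 : ReducedRel 2 (circ [CZ 0, CZ 0]) (circ [])
  | R6 : ReducedRel 2 (circ [Z 0, CZ 0]) (circ [CZ 0, Z 0])
  | R7 : ReducedRel 2 (circ [Z 1, CZ 0]) (circ [CZ 0, Z 1])
  | R8 : ReducedRel 2 (circ [H 0, Z 0, H 0, CZ 0]) (circ [CZ 0, H 0, Z 0, Z 1, H 0])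
  | R9 : ReducedRel 2 (circ [H 1, Z 1, H 1, CZ 0]) (circ [CZ 0, H 1, Z 0, Z 1, H 1])
  | R10 : ReducedRel 2 (circ [H 0, CZ 0, H 0, CZ 0]) (circ [CZ 0, H 0, CZ 0, H 0, Z 1])
  | R11 : ReducedRel 2 (circ [H 1, CZ 0, H 1, CZ 0]) (circ [CZ 0, H 1, CZ 0, Z 0, H 1])
  | R12 : ReducedRel 2
      (circ [H 1, CZ 0, H 0, H 1, CZ 0, H 0, H 1, CZ 0])
      (circ [CZ 0, H 0, H 1, CZ 0, H 0, H 1, CZ 0, H 0])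
  | R13 : ReducedRel 3 (circ [CZ 0, CZ 1]) (circ [CZ 1, CZ 0])
  | R14 : ReducedRel 3
      (circ [H 2, CZ 1, H 1, H 2, CZ 1, H 1, CZ 0, H 1, CZ 1, H 1, H 2, CZ 1, H 2])
      (circ [H 0, CZ 0, H 0, H 1, CZ 0, H 1, CZ 1, H 1, CZ 0, H 0, H 1, CZ 0, H 0])
  | R15 : ReducedRel 3
      (circ [CZ 0, H 0, H 1, CZ 0, H 0, H 1, CZ 1, CZ 0, H 0, H 1, CZ 0, H 0, H 1, CZ 1])
      (circ [CZ 1, H 0, H 1, CZ 0, H 0, H 1, CZ 0])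
  | R16 : ReducedRel 3
      (circ [CZ 1, H 1, H 2, CZ 1, H 1, H 2, CZ 0, CZ 1, H 1, H 2, CZ 1, H 1, H 2, CZ 0])
      (circ [CZ 0, H 1, H 2, CZ 1, H 1, H 2, CZ 1])

/-- The relations on `n`-wire circuits: each reduced relation placed on adjacent wires, and the
structural rule of circuit diagrams by which gates without a common wire slide past each other
(in particular, scalars move freely). -/
inductive CircuitRel (n : ℕ) : Circuit n → Circuit n → Prop
  | reduced {m : ℕ} {u v : Circuit m} (huv : ReducedRel m u v) (k : ℕ) (h : k + m ≤ n) :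
      CircuitRel n (Circuit.place k h u) (Circuit.place k h v)
  | slide (g g' : Gate n) (hd : Disjoint g.wires g'.wires) :
      CircuitRel n (circ [g, g']) (circ [g', g])

/-- `Rewrites C C'`: the circuit `C` can be turned into `C'` by finitely many applications of the
relations (in either direction) to subcircuits. -/
def Rewrites {n : ℕ} (C C' : Circuit n) : Prop := conGen (CircuitRel n) C C'

/-! ### Derived generators and normal circuits -/

/-- The type of a wire in a typed circuit. -/
inductive WireType : Type
  | single
  | double

/-- Derived generators of kind `A`, indexed by the type of the output wire. -/
inductive AGate : WireType → Type
  | A1 : AGate .single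
  | A2 : AGate .single
  | A3 : AGate .double

/-- Derived generators of kind `B`, indexed by the type of the bottom input wire and the type of
the top output wire (the other two wires are of single type). -/
inductive BGate : WireType → WireType → Type
  | B1 : BGate .single .single
  | B2 : BGate .single .single
  | B3 : BGate .single .single
  | B4 : BGate .single .double
  | B5 : BGate .double .double
  | B6 : BGate .double .double
  | B7 : BGate .double .double
  | B8 : BGate .double .single

/-- Derived generators of kind `C`; all wires are of single type. -/
inductive CGate : Type
  | C1
  | C2

/-- Derived generators of kind `D`; all wires are of single type. -/
inductive DGate : Type
  | D1
  | D2
  | D3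
  | D4

/-- Derived generators of kind `E`; all wires are of single type. -/
inductive EGate : Type
  | E1
  | E2

open Gate in
/-- The circuit of a derived generator of kind `A`. -/
def AGate.circuit {t : WireType} : AGate t → Circuit 1
  | .A1 => circ []
  | .A2 => circ [H 0]
  | .A3 => circ []

open Gate in
/-- The circuit of a derived generator of kind `B`. -/
def BGate.circuit {s t : WireType} : BGate s t → Circuit 2
  | .B1 | .B5 => circ [H 1, CZ 0, H 0, H 1, CZ 0, H 0, H 1, CZ 0]
  | .B2 | .B6 => circ [CZ 0, H 0, H 1, CZ 0]
  | .B3 | .B7 => circ [H 0, CZ 0, H 0, H 1, CZ 0]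
  | .B4 | .B8 => circ [H 1, CZ 0, H 1, CZ 0, H 0, H 1, CZ 0]

open Gate in
/-- The circuit of a derived generator of kind `C`; the second one is the gate `X = HZH`. -/
def CGate.circuit : CGate → Circuit 1
  | .C1 => circ []
  | .C2 => circ [H 0, Z 0, H 0]

open Gate in
/-- The circuit of a derived generator of kind `D`. -/
def DGate.circuit : DGate → Circuit 2
  | .D1 => circ [CZ 0, H 0, H 1, CZ 0, H 0, H 1, CZ 0, H 1]
  | .D2 => circ [H 0, CZ 0, H 0, H 1, CZ 0, H 1]
  | .D3 => circ [H 0, H 1, CZ 0, H 0, H 1, CZ 0, H 1]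
  | .D4 => circ [H 0, CZ 0, H 0, H 1, CZ 0, H 1, CZ 0]

open Gate in
/-- The circuit of a derived generator of kind `E`. -/
def EGate.circuit : EGate → Circuit 1
  | .E1 => circ []
  | .E2 => circ [Z 0]

/-- A well-typed ladder of `k` gates of kind `B`, on the wires `(k-1, k)`, then `(k-2, k-1)`, …,
finally `(0, 1)`. It starts on wire `k` with type `t` and ends on wire `0` with single type. -/
inductive BLadder : ℕ → WireType → Type
  | nil : BLadder 0 .single
  | cons {k : ℕ} {s t : WireType} (b : BGate s t) (r : BLadder k t) : BLadder (k + 1) s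

/-- The circuit of a ladder of gates of kind `B`. -/
def BLadder.circuit {n : ℕ} : {k : ℕ} → {t : WireType} → BLadder k t → k < n → Circuit n
  | _, _, .nil, _ => 1
  | k + 1, _, .cons b r, h =>
      Circuit.place k (show k + 2 ≤ n from h) b.circuit * r.circuit (by omega)

/-- A `Z`-circuit on `n` wires: a gate of kind `A` on some wire `k`, a ladder of gates of kind `B`
up to the top wire, and a gate of kind `C` on the top wire, such that the types match. -/
structure ZCircuit (n : ℕ) : Type where
  k : Fin n
  t : WireType
  a : AGate t
  b : BLadder k t
  c : CGate

/-- The underlying circuit of a `Z`-circuit. -/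
def ZCircuit.circuit {n : ℕ} (L : ZCircuit n) : Circuit n :=
  Circuit.place (L.k : ℕ) (show (L.k : ℕ) + 1 ≤ n from L.k.isLt) L.a.circuit *
    L.b.circuit L.k.isLt *
    Circuit.place 0 (show 0 + 1 ≤ n by have := L.k.isLt; omega) L.c.circuit

/-- An `X`-circuit on `n + 1` wires: gates of kind `D` on the wires `(0, 1)`, `(1, 2)`, …,
`(n-1, n)`, followed by a gate of kind `E` on the bottom wire `n`. -/
structure XCircuit (n : ℕ) : Type where
  d : Fin n → DGate
  e : EGate

/-- The underlying circuit of an `X`-circuit. -/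
def XCircuit.circuit {n : ℕ} (M : XCircuit n) : Circuit (n + 1) :=
  (List.ofFn fun i : Fin n =>
      Circuit.place (i : ℕ) (show (i : ℕ) + 2 ≤ n + 1 by omega) (M.d i).circuit).prod *
    Circuit.place n (le_refl (n + 1)) M.e.circuit

/-- Normal circuits: `L_n M_n L_{n-1} M_{n-1} ⋯ L_1 M_1 · (±1)`, where `L_i` is a `Z`-circuit and
`M_i` an `X`-circuit on the top `i` wires. The sign is `-1` if the Boolean is `true`. -/
inductive NormalCircuit : ℕ → Type
  | scalar (neg : Bool) : NormalCircuit 0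
  | cons {n : ℕ} (L : ZCircuit (n + 1)) (M : XCircuit n) (N : NormalCircuit n) :
      NormalCircuit (n + 1)

/-- The underlying circuit of a normal circuit. -/
def NormalCircuit.circuit : {n : ℕ} → NormalCircuit n → Circuit n
  | _, .scalar false => circ []
  | _, .scalar true => circ [Gate.neg]
  | n + 1, .cons L M N =>
      L.circuit * M.circuit * Circuit.place 0 (show 0 + n ≤ n + 1 by omega) N.circuit

/-! ### Operators -/

/-- Operators on `n` qubits: real `2 ^ n × 2 ^ n` matrices, with rows and columns indexed by the
computational basis states. -/
abbrev Operator (n : ℕ) : Type := Matrix (Fin n → Fin 2) (Fin n → Fin 2) ℝ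

/-- The Pauli matrix `X`. -/
def pauliX : Matrix (Fin 2) (Fin 2) ℝ := !![0, 1; 1, 0]

/-- The Pauli matrix `Z`. -/
def pauliZ : Matrix (Fin 2) (Fin 2) ℝ := !![1, 0; 0, -1]

/-- The Hadamard matrix. -/
noncomputable def hadamard : Matrix (Fin 2) (Fin 2) ℝ := (1 / √2) • !![1, 1; 1, -1]

/-- The tensor product `P 0 ⊗ ⋯ ⊗ P (n - 1)`. -/
def tensor {n : ℕ} (P : Fin n → Matrix (Fin 2) (Fin 2) ℝ) : Operator n :=
  Matrix.of fun x y => ∏ i, P i (x i) (y i)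

/-- The one-qubit operator `M` acting on qubit `i`. -/
def onQubit {n : ℕ} (i : Fin n) (M : Matrix (Fin 2) (Fin 2) ℝ) : Operator n :=
  tensor (Function.update (fun _ => 1) i M)

/-- The operator of a gate. -/
noncomputable def Gate.operator {n : ℕ} : Gate n → Operator n
  | .neg => -1
  | .H i => onQubit i hadamard
  | .Z i => onQubit i pauliZ
  | .CZ i hi => Matrix.diagonal fun x =>
      if x ⟨i, by omega⟩ = 1 ∧ x ⟨i + 1, hi⟩ = 1 then -1 else 1

/-- The operator of a circuit. Circuits are read from left to right, so the operator of
`g₁ g₂ ⋯ g_r` is the matrix product of the operators of `g_r, …, g₂, g₁` in this order. -/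
noncomputable def Circuit.operator {n : ℕ} (C : Circuit n) : Operator n :=
  (FreeMonoid.lift (fun g : Gate n => MulOpposite.op g.operator) C).unop

/-- The real Pauli group on `n` qubits, as a set of orthogonal matrices: all
`± P_1 ⊗ ⋯ ⊗ P_n` with each `P_i` one of `I`, `X`, `Z`, `XZ`. -/
def pauliGroup (n : ℕ) : Set (Matrix.orthogonalGroup (Fin n → Fin 2) ℝ) :=
  {U | ∃ P : Fin n → Matrix (Fin 2) (Fin 2) ℝ,
    (∀ i, P i ∈ ({1, pauliX, pauliZ, pauliX * pauliZ} : Set (Matrix (Fin 2) (Fin 2) ℝ))) ∧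
    ((U : Operator n) = tensor P ∨ (U : Operator n) = -tensor P)}

/-- The real Clifford group (real stabilizer group) on `n` qubits: the normalizer of the real Pauli
group in the orthogonal group. -/
def cliffordGroup (n : ℕ) : Subgroup (Matrix.orthogonalGroup (Fin n → Fin 2) ℝ) :=
  Subgroup.normalizer (pauliGroup n)

end RealStabilizer

/-!
All generators are involutions, so circuits modulo the relations form a group `Gₙ`, and the
relations are sound; hence `Gₙ` acts by conjugation on signed Pauli strings. Two facts combine.

*The only elements of `Gₙ` that act trivially are `±1`* (induction on `n`). Let `S` be the
submonoid of `Gₙ₊₁` generated by `Z₀`, `CZ₀` and the circuits below the top wire. Conjugating `CZ₀`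
by such circuits yields Pauli strings controlled by the top wire, so every element of `S` is a
controlled Pauli string times a circuit below the top wire. With this factorization the double
cosets of `S` of `1`, `X₀`, `H₀` and the swap of the top two wires are seen to be stable under
multiplication by `H₀`; so they exhaust `Gₙ₊₁`. `S` fixes the string `Z₀` while `X₀`, `H₀` and the
swap move it, hence `S` is the whole stabilizer of `Z₀`. If an element of `S` acts trivially, then
its action on `X₀` shows that the controlled string is trivial, and the remaining circuit acts
trivially on `n` wires. As the operator `-1` is not `1`, circuits with equal operators are equal in
`Gₙ`.

*A Clifford operator is determined, up to a unique normal circuit on fewer wires, by what it does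
to the last wire.* A Pauli string that anticommutes with another one and squares to `1` is mapped
to `Z₀` by exactly one `Z`-circuit `L`; a string that squares to `1` and anticommutes with `Z₀` is
mapped to `X` on the last wire by exactly one `X`-circuit `M`, which also takes `Z₀` to `Z` on the
last wire. Choosing the strings that a Clifford operator `U` maps to `Z` and `X` on the last wire,
`U (L M)⁻¹` commutes with both, so it is a Clifford operator on the remaining wires.
-/

namespace RealStabilizer

/-! ### The relations on two and three wires -/

section Words

variable {M : Type*} [Monoid M]

theorem mul_self_cancel_left {a : M} (h : a * a = 1) (x : M) : a * (a * x) = x := by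
  rw [← mul_assoc, h, one_mul]

theorem mul_left_extend {a b c d : M} (h : a * b = c * d) (x : M) :
    a * (b * x) = c * (d * x) := by
  rw [← mul_assoc, h, mul_assoc]

end Words

/-- The relations R2, R3 and R5-R12 and the sliding rule on two adjacent wires, in an arbitrary
monoid; `k` is the controlled `Z` gate, and the indices are the wires. -/
structure TwoWire {M : Type*} [Monoid M] (h₀ h₁ z₀ z₁ k : M) : Prop where
  h₀_mul_self : h₀ * h₀ = 1
  h₁_mul_self : h₁ * h₁ = 1
  z₀_mul_self : z₀ * z₀ = 1
  z₁_mul_self : z₁ * z₁ = 1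
  k_mul_self : k * k = 1
  hh : h₁ * h₀ = h₀ * h₁
  hz : z₁ * h₀ = h₀ * z₁
  zh : z₀ * h₁ = h₁ * z₀
  zz : z₁ * z₀ = z₀ * z₁
  z₀k : z₀ * k = k * z₀
  z₁k : z₁ * k = k * z₁
  x₀k : h₀ * z₀ * h₀ * k = k * h₀ * z₀ * z₁ * h₀
  x₁k : h₁ * z₁ * h₁ * k = k * h₁ * z₀ * z₁ * h₁
  hk₀ : h₀ * k * h₀ * k = k * h₀ * k * h₀ * z₁
  hk₁ : h₁ * k * h₁ * k = k * h₁ * k * z₀ * h₁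
  braid : h₁ * k * h₀ * h₁ * k * h₀ * h₁ * k = k * h₀ * h₁ * k * h₀ * h₁ * k * h₀

/-- The swap of two adjacent wires, as a word in the Hadamard gates `h₀`, `h₁` and the controlled
`Z` gate `k`. -/
def swapWord {M : Type*} [Monoid M] (h₀ h₁ k : M) : M :=
  k * h₀ * h₁ * k * h₀ * h₁ * k * h₀ * h₁

namespace TwoWire

variable {M : Type*} [Monoid M] {h₀ h₁ z₀ z₁ k : M}

theorem palindrome_mul_self (T : TwoWire h₀ h₁ z₀ z₁ k) :
    (k * h₀ * h₁ * k * h₀ * h₁ * k) * (k * h₀ * h₁ * k * h₀ * h₁ * k) = 1 := by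
  simp only [mul_assoc, mul_left_extend T.hh, mul_self_cancel_left T.h₀_mul_self,
    mul_self_cancel_left T.h₁_mul_self, mul_self_cancel_left T.k_mul_self, T.k_mul_self]

theorem h₁_palindrome (T : TwoWire h₀ h₁ z₀ z₁ k) :
    h₁ * (k * h₀ * h₁ * k * h₀ * h₁ * k) = k * h₀ * h₁ * k * h₀ * h₁ * k * h₀ := by
  simpa only [mul_assoc] using T.braid

theorem h₀_palindrome (T : TwoWire h₀ h₁ z₀ z₁ k) :
    h₀ * (k * h₀ * h₁ * k * h₀ * h₁ * k) = k * h₀ * h₁ * k * h₀ * h₁ * k * h₁ := by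
  have h := T.h₁_palindrome
  have w := T.palindrome_mul_self
  generalize k * h₀ * h₁ * k * h₀ * h₁ * k = W at h w ⊢
  calc h₀ * W = W * (W * h₀) * W := by rw [mul_self_cancel_left w]
    _ = W * h₁ := by rw [← h, mul_assoc, mul_assoc, w, mul_one]

theorem symm (T : TwoWire h₀ h₁ z₀ z₁ k) : TwoWire h₁ h₀ z₁ z₀ k where
  h₀_mul_self := T.h₁_mul_self
  h₁_mul_self := T.h₀_mul_self
  z₀_mul_self := T.z₁_mul_self
  z₁_mul_self := T.z₀_mul_self
  k_mul_self := T.k_mul_self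
  hh := T.hh.symm
  hz := T.zh
  zh := T.hz
  zz := T.zz.symm
  z₀k := T.z₁k
  z₁k := T.z₀k
  x₀k := by rw [T.x₁k, mul_assoc (k * h₁), ← T.zz, ← mul_assoc]
  x₁k := by rw [T.x₀k, mul_assoc (k * h₀), ← T.zz, ← mul_assoc]
  hk₀ := by rw [T.hk₁, mul_assoc _ z₀, T.zh, ← mul_assoc]
  hk₁ := by rw [T.hk₀, mul_assoc _ h₀, ← T.hz, ← mul_assoc]
  braid := by
    have h := T.h₀_palindrome
    simp only [mul_assoc] at h
    simp only [mul_assoc, mul_left_extend T.hh, h]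

theorem swapWord_symm (T : TwoWire h₀ h₁ z₀ z₁ k) : swapWord h₁ h₀ k = swapWord h₀ h₁ k := by
  simp only [swapWord, mul_assoc, T.hh]

theorem swap_mul_h₀ (T : TwoWire h₀ h₁ z₀ z₁ k) :
    swapWord h₀ h₁ k * h₀ = h₁ * swapWord h₀ h₁ k := by
  rw [swapWord, ← mul_assoc h₁]
  simp only [← mul_assoc]
  rw [T.braid]
  simp only [mul_assoc, T.hh]

theorem swap_mul_h₁ (T : TwoWire h₀ h₁ z₀ z₁ k) :
    swapWord h₀ h₁ k * h₁ = h₀ * swapWord h₀ h₁ k :=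
  T.swapWord_symm ▸ T.symm.swap_mul_h₀

theorem swap_mul_self (T : TwoWire h₀ h₁ z₀ z₁ k) :
    swapWord h₀ h₁ k * swapWord h₀ h₁ k = 1 := by
  have h := T.h₁_palindrome
  have w := T.palindrome_mul_self
  rw [swapWord]
  generalize k * h₀ * h₁ * k * h₀ * h₁ * k = W at h w ⊢
  calc W * h₀ * h₁ * (W * h₀ * h₁) = h₁ * W * h₁ * (h₁ * W * h₁) := by rw [← h]
    _ = 1 := by
      simp only [mul_assoc, mul_self_cancel_left T.h₁_mul_self, mul_self_cancel_left w,
        T.h₁_mul_self]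

theorem swap_mul_k (T : TwoWire h₀ h₁ z₀ z₁ k) :
    swapWord h₀ h₁ k * k = k * swapWord h₀ h₁ k := by
  have inverse_eq : h₀ * h₁ * k * h₀ * h₁ * k * h₀ * h₁ * k = swapWord h₀ h₁ k := by
    refine left_inv_eq_right_inv ?_ T.swap_mul_self
    simp only [swapWord, mul_assoc, mul_left_extend T.hh, mul_self_cancel_left T.h₀_mul_self,
      mul_self_cancel_left T.h₁_mul_self, mul_self_cancel_left T.k_mul_self, T.h₁_mul_self]
  calc swapWord h₀ h₁ k * k = k * (h₀ * h₁ * k * h₀ * h₁ * k * h₀ * h₁ * k) := by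
        simp only [swapWord, mul_assoc]
    _ = k * swapWord h₀ h₁ k := by rw [inverse_eq]

theorem cx_mul_self (T : TwoWire h₀ h₁ z₀ z₁ k) : h₁ * k * h₁ * (h₁ * k * h₁) = 1 := by
  simp only [mul_assoc, mul_self_cancel_left T.h₁_mul_self, mul_self_cancel_left T.k_mul_self,
    T.h₁_mul_self]

theorem swap_eq_cx_mul_xc_mul_cx (T : TwoWire h₀ h₁ z₀ z₁ k) :
    swapWord h₀ h₁ k = h₁ * k * h₁ * (h₀ * k * h₀) * (h₁ * k * h₁) := by
  rw [swapWord, ← T.h₁_palindrome]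
  simp only [mul_assoc, mul_left_extend T.hh]

theorem swap_mul_mul_swap (T : TwoWire h₀ h₁ z₀ z₁ k) {c : M} (hh : Commute c h₁)
    (hk : Commute c k) :
    swapWord h₀ h₁ k * c * swapWord h₀ h₁ k =
      h₁ * k * h₁ * (h₀ * k * h₀) * c * (h₀ * k * h₀ * (h₁ * k * h₁)) := by
  have ha : c * (h₁ * k * h₁) = h₁ * k * h₁ * c := ((hh.mul_right hk).mul_right hh).eq
  rw [T.swap_eq_cx_mul_xc_mul_cx]
  have aa := T.cx_mul_self
  generalize h₁ * k * h₁ = a at ha aa ⊢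
  simp only [mul_assoc, mul_left_extend ha, mul_self_cancel_left aa]

theorem z₁_mul_cx (T : TwoWire h₀ h₁ z₀ z₁ k) :
    z₁ * (h₁ * k * h₁) = h₁ * k * h₁ * (z₀ * z₁) := by
  have := congrArg (fun x => h₁ * x * h₁) T.x₁k
  simpa only [mul_assoc, mul_self_cancel_left T.h₁_mul_self, T.h₁_mul_self, mul_one,
    mul_left_extend T.zh, ← T.zz] using this

theorem z₀_mul_cx (T : TwoWire h₀ h₁ z₀ z₁ k) :
    z₀ * (h₁ * k * h₁) = h₁ * k * h₁ * z₀ := by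
  simp only [mul_assoc, mul_left_extend T.zh, mul_left_extend T.z₀k, T.zh]

theorem swap_mul_z₁ (T : TwoWire h₀ h₁ z₀ z₁ k) :
    swapWord h₀ h₁ k * z₁ = z₀ * swapWord h₀ h₁ k := by
  have e0 := T.z₀_mul_cx
  have e1 := T.z₁_mul_cx
  have f0 := T.symm.z₁_mul_cx.trans (by rw [T.zz])
  rw [T.swap_eq_cx_mul_xc_mul_cx]
  generalize h₁ * k * h₁ = a at e0 e1 ⊢
  generalize h₀ * k * h₀ = b at f0 ⊢
  simp only [mul_assoc, mul_left_extend e0, mul_left_extend f0, e1,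
    mul_self_cancel_left T.z₀_mul_self]

theorem swap_mul_z₀ (T : TwoWire h₀ h₁ z₀ z₁ k) :
    swapWord h₀ h₁ k * z₀ = z₁ * swapWord h₀ h₁ k :=
  T.swapWord_symm ▸ T.symm.swap_mul_z₁

theorem cx_mul_k (T : TwoWire h₀ h₁ z₀ z₁ k) :
    h₁ * k * h₁ * k = k * (h₁ * k * h₁) * z₀ := by
  rw [T.hk₁]
  simp only [mul_assoc, T.zh]

theorem conj_h₀_cx_mul_cx (T : TwoWire h₀ h₁ z₀ z₁ k) :
    h₀ * (h₁ * k * h₁) * h₀ * (h₁ * k * h₁) =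
      h₁ * k * h₁ * (h₀ * (h₁ * k * h₁) * h₀) * (h₁ * z₁ * h₁) := by
  have := congrArg (fun x => h₁ * x * h₁) T.hk₀
  simpa only [mul_assoc, mul_self_cancel_left T.h₁_mul_self, T.hh, mul_left_extend T.hh] using this

theorem conj_k_conj_h₀_cx (T : TwoWire h₀ h₁ z₀ z₁ k) :
    k * (h₀ * (h₁ * k * h₁) * h₀) * k = swapWord h₀ h₁ k * h₁ * h₀ := by
  simp only [swapWord, mul_assoc, mul_left_extend T.hh, mul_self_cancel_left T.h₁_mul_self,
    T.h₀_mul_self, mul_one]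

theorem k_mul_cx_mul_z₀_mul_swap_mul_k (T : TwoWire h₀ h₁ z₀ z₁ k) :
    k * (h₁ * k * h₁) * z₀ * swapWord h₀ h₁ k * k = h₀ * k * h₀ * (h₁ * k * h₁) := by
  have za := T.z₁_mul_cx
  have ak := T.cx_mul_k
  have bk := T.symm.cx_mul_k
  have aa := T.cx_mul_self
  have sw := T.swap_eq_cx_mul_xc_mul_cx
  have zs := T.swap_mul_z₁
  generalize swapWord h₀ h₁ k = s at sw zs ⊢
  generalize h₁ * k * h₁ = a at za ak aa sw ⊢
  generalize h₀ * k * h₀ = b at bk sw ⊢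
  calc k * a * z₀ * s * k = k * a * (z₀ * s) * k := by simp only [mul_assoc]
    _ = k * (a * a) * b * a * (z₁ * k) := by
        rw [← zs, sw]
        simp only [mul_assoc]
    _ = k * b * (a * k) * z₁ := by simp only [aa, mul_one, T.z₁k, mul_assoc]
    _ = k * (b * k) * (z₁ * a) := by simp only [ak, za, mul_assoc]
    _ = b * a := by
        simp only [bk, mul_assoc, mul_self_cancel_left T.k_mul_self,
          mul_self_cancel_left T.z₁_mul_self]

theorem conj_h₀_cy (T : TwoWire h₀ h₁ z₀ z₁ k) :
    h₀ * (k * (h₁ * k * h₁)) * h₀ =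
      k * (h₁ * k * h₁) * z₀ * h₀ * (h₁ * k * (h₁ * z₁ * h₁) * (h₁ * k * h₁)) := by
  have h₀_eq : swapWord h₀ h₁ k * (k * (h₀ * (h₁ * k * h₁) * h₀) * k) = h₀ * h₁ := by
    rw [T.conj_k_conj_h₀_cx, ← mul_assoc, ← mul_assoc, T.swap_mul_self, one_mul, T.hh]
  have xc_eq : h₀ * (k * (h₁ * k * h₁)) * h₀ = h₀ * k * h₀ * (h₀ * (h₁ * k * h₁) * h₀) := by
    simp only [mul_assoc, mul_self_cancel_left T.h₀_mul_self]
  have da := T.conj_h₀_cx_mul_cx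
  have aa := T.cx_mul_self
  have kazsk := T.k_mul_cx_mul_z₀_mul_swap_mul_k
  rw [xc_eq]
  generalize swapWord h₀ h₁ k = s at h₀_eq kazsk
  generalize h₀ * (h₁ * k * h₁) * h₀ = d at h₀_eq da ⊢
  generalize h₁ * z₁ * h₁ = x at da ⊢
  generalize h₁ * k * h₁ = a at da aa kazsk ⊢
  generalize h₀ * k * h₀ = b at kazsk ⊢
  have adxa : a * d * x * a = d := by rw [← da, mul_assoc, aa, mul_one]
  calc b * d = b * a * d * x * a := by
        nth_rewrite 1 [← adxa]
        simp only [mul_assoc]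
    _ = k * a * z₀ * (s * (k * d * k)) * k * x * a := by
        rw [← kazsk]
        simp only [mul_assoc, mul_self_cancel_left T.k_mul_self]
    _ = k * a * z₀ * h₀ * (h₁ * k * x * a) := by
        rw [h₀_eq]
        simp only [mul_assoc]

theorem x₀_mul_cy_mul_h₀ (T : TwoWire h₀ h₁ z₀ z₁ k) :
    h₀ * z₀ * h₀ * (k * (h₁ * k * h₁)) * h₀ = k * z₁ * h₁ * k * h₀ * (z₀ * z₁ * h₁) := by
  calc _ = (h₀ * z₀ * h₀ * k) * (h₁ * k * h₁) * h₀ := by simp only [mul_assoc]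
    _ = k * z₁ * h₁ * (h₀ * z₀ * h₀ * k) * h₁ * h₀ := by
      nth_rewrite 1 [T.x₀k]
      simp only [mul_assoc, mul_left_extend T.hh.symm, T.hh, mul_left_extend T.zh,
        mul_left_extend T.hz.symm, mul_left_extend T.zz.symm]
    _ = k * z₁ * h₁ * k * h₀ * (z₀ * z₁ * h₁) := by
      rw [T.x₀k]
      simp only [mul_assoc, T.hh, mul_self_cancel_left T.h₀_mul_self]

end TwoWire

/-- The relations of two pairs of adjacent wires and R13-R15 on three adjacent wires, in an
arbitrary monoid; `k₀` and `k₁` are the controlled `Z` gates. -/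
structure ThreeWire {M : Type*} [Monoid M] (h₀ h₁ h₂ z₀ z₁ z₂ k₀ k₁ : M) : Prop where
  top : TwoWire h₀ h₁ z₀ z₁ k₀
  bot : TwoWire h₁ h₂ z₁ z₂ k₁
  h₂k₀ : h₂ * k₀ = k₀ * h₂
  h₀k₁ : h₀ * k₁ = k₁ * h₀
  kk : k₁ * k₀ = k₀ * k₁
  far : h₂ * k₁ * h₁ * h₂ * k₁ * h₁ * k₀ * h₁ * k₁ * h₁ * h₂ * k₁ * h₂ =
    h₀ * k₀ * h₀ * h₁ * k₀ * h₁ * k₁ * h₁ * k₀ * h₀ * h₁ * k₀ * h₀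
  cxk : k₀ * h₀ * h₁ * k₀ * h₀ * h₁ * k₁ * k₀ * h₀ * h₁ * k₀ * h₀ * h₁ * k₁ =
    k₁ * h₀ * h₁ * k₀ * h₀ * h₁ * k₀

namespace ThreeWire

variable {M : Type*} [Monoid M] {h₀ h₁ h₂ z₀ z₁ z₂ k₀ k₁ : M}

theorem conj_swap_k₀_eq_conj_swap_k₁ (T : ThreeWire h₀ h₁ h₂ z₀ z₁ z₂ k₀ k₁) :
    swapWord h₁ h₂ k₁ * k₀ * swapWord h₁ h₂ k₁ = swapWord h₀ h₁ k₀ * k₁ * swapWord h₀ h₁ k₀ := by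
  rw [T.bot.swap_mul_mul_swap T.h₂k₀.symm T.kk.symm, ← T.top.swapWord_symm,
    T.top.symm.swap_mul_mul_swap T.h₀k₁.symm T.kk]
  simpa only [mul_assoc, mul_left_extend T.top.hh, mul_left_extend T.bot.hh] using T.far

theorem commute_h₁_conj_swap_k₁ (T : ThreeWire h₀ h₁ h₂ z₀ z₁ z₂ k₀ k₁) :
    Commute h₁ (swapWord h₀ h₁ k₀ * k₁ * swapWord h₀ h₁ k₀) := by
  simp only [commute_iff_eq, mul_assoc, T.top.swap_mul_h₁, mul_left_extend T.h₀k₁.symm,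
    mul_left_extend T.top.swap_mul_h₀]

theorem k₁_mul_cx (T : ThreeWire h₀ h₁ h₂ z₀ z₁ z₂ k₀ k₁) :
    k₁ * (h₁ * k₀ * h₁) =
      (h₁ * k₀ * h₁) * (swapWord h₀ h₁ k₀ * k₁ * swapWord h₀ h₁ k₀) * k₁ := by
  have su : k₀ * h₀ * h₁ * k₀ * h₀ * h₁ = swapWord h₀ h₁ k₀ * (h₀ * h₁ * k₀) := by
    simp only [swapWord, mul_assoc, mul_left_extend T.top.hh,
      mul_self_cancel_left T.top.h₁_mul_self,
      mul_self_cancel_left T.top.h₀_mul_self, T.top.k_mul_self, mul_one]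
  have us : h₀ * h₁ * k₀ * swapWord h₀ h₁ k₀ = swapWord h₀ h₁ k₀ * (h₀ * h₁ * k₀) := by
    simp only [mul_assoc, mul_left_extend T.top.swap_mul_h₀, mul_left_extend T.top.swap_mul_h₁,
      T.top.swap_mul_k, mul_left_extend T.top.hh]
  have hf := T.commute_h₁_conj_swap_k₁.eq
  have r15 : h₀ * h₁ * k₀ * (swapWord h₀ h₁ k₀ * k₁ * swapWord h₀ h₁ k₀) * (h₀ * h₁ * k₀) * k₁ =
      k₁ * (h₀ * h₁ * k₀) * (h₀ * h₁ * k₀) := by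
    calc _ = h₀ * h₁ * k₀ * swapWord h₀ h₁ k₀ * k₁ * (swapWord h₀ h₁ k₀ * (h₀ * h₁ * k₀)) * k₁ := by
          simp only [mul_assoc]
      _ = k₀ * h₀ * h₁ * k₀ * h₀ * h₁ * k₁ * (k₀ * h₀ * h₁ * k₀ * h₀ * h₁) * k₁ := by
          rw [us, ← su]
      _ = k₁ * (h₀ * h₁ * k₀) * (h₀ * h₁ * k₀) := by simpa only [mul_assoc] using T.cxk
  generalize swapWord h₀ h₁ k₀ * k₁ * swapWord h₀ h₁ k₀ = f at hf r15 ⊢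
  have := congrArg (fun x => h₀ * x * (k₀ * h₀)) r15
  simpa only [mul_assoc, T.top.hh, mul_left_extend T.top.hh, mul_self_cancel_left T.top.h₀_mul_self,
    mul_self_cancel_left T.top.k_mul_self, mul_left_extend T.h₀k₁.symm, T.h₀k₁.symm,
    mul_left_extend T.kk.symm, T.top.h₀_mul_self, mul_one, mul_left_extend hf.symm] using this.symm

end ThreeWire

/-! ### The group presented by the circuit relations -/

/-- The monoid of circuits modulo the circuit relations; every generator has order two, so it is a
group. -/
abbrev CircuitGroup (n : ℕ) : Type := PresentedMonoid (CircuitRel n)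

/-- The class of a circuit. -/
abbrev cls {n : ℕ} (C : Circuit n) : CircuitGroup n := PresentedMonoid.mk (CircuitRel n) C

theorem cls_eq_iff {n : ℕ} {C D : Circuit n} : cls C = cls D ↔ Rewrites C D :=
  Con.eq _

theorem cls_eq_of_rel {n : ℕ} {C D : Circuit n} (h : CircuitRel n C D) : cls C = cls D :=
  cls_eq_iff.2 (ConGen.Rel.of _ _ h)

theorem cls_mul {n : ℕ} (C D : Circuit n) : cls (C * D) = cls C * cls D := map_mul _ C D

theorem cls_one {n : ℕ} : cls (1 : Circuit n) = 1 := map_one _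

theorem cls_circ {n : ℕ} (l : List (Gate n)) :
    cls (circ l) = (l.map fun g => cls (FreeMonoid.of g)).prod := by
  induction l with
  | nil => exact map_one _
  | cons g l ih =>
    rw [List.map_cons, List.prod_cons, ← ih, ← map_mul]
    rfl

theorem place_circ {m n : ℕ} (k : ℕ) (h : k + m ≤ n) (l : List (Gate m)) :
    Circuit.place k h (circ l) = circ (l.map (Gate.place k h)) := rfl

theorem cls_place_circ {m n : ℕ} (k : ℕ) (h : k + m ≤ n) (l : List (Gate m)) :
    cls (Circuit.place k h (circ l)) =
      (l.map fun g => cls (FreeMonoid.of (g.place k h))).prod := by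
  rw [place_circ, cls_circ, List.map_map]
  rfl

/-- The class of `H i`; it is `1` if there is no wire `i`. -/
def genH (n i : ℕ) : CircuitGroup n := if h : i < n then cls (FreeMonoid.of (.H ⟨i, h⟩)) else 1

/-- The class of `Z i`; it is `1` if there is no wire `i`. -/
def genZ (n i : ℕ) : CircuitGroup n := if h : i < n then cls (FreeMonoid.of (.Z ⟨i, h⟩)) else 1

/-- The class of `CZ i`; it is `1` if there is no wire `i + 1`. -/
def genCZ (n i : ℕ) : CircuitGroup n := if h : i + 1 < n then cls (FreeMonoid.of (.CZ i h)) else 1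

/-- The class of the scalar `-1`. -/
def genNeg (n : ℕ) : CircuitGroup n := cls (FreeMonoid.of .neg)

theorem cls_of_H {n : ℕ} (i : Fin n) : cls (FreeMonoid.of (.H i)) = genH n i := by simp [genH]

theorem cls_of_Z {n : ℕ} (i : Fin n) : cls (FreeMonoid.of (.Z i)) = genZ n i := by simp [genZ]

theorem cls_of_CZ {n i : ℕ} (h : i + 1 < n) : cls (FreeMonoid.of (.CZ i h)) = genCZ n i := by
  simp [genCZ, h]

theorem cls_of_neg {n : ℕ} : cls (FreeMonoid.of (.neg : Gate n)) = genNeg n := rfl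

section Relations

variable {n : ℕ}

theorem cls_reduced {m : ℕ} {l l' : List (Gate m)} (h : ReducedRel m (circ l) (circ l')) (k : ℕ)
    (hk : k + m ≤ n) :
    (l.map fun g => cls (FreeMonoid.of (g.place k hk))).prod =
      (l'.map fun g => cls (FreeMonoid.of (g.place k hk))).prod := by
  rw [← cls_place_circ, ← cls_place_circ]
  exact cls_eq_of_rel (.reduced h k hk)

theorem genNeg_mul_self : genNeg n * genNeg n = 1 := by
  simpa [Gate.place, cls_of_neg] using cls_reduced .R1 0 (show 0 + 0 ≤ n by omega)

theorem genZ_mul_self (i : ℕ) : genZ n i * genZ n i = 1 := by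
  by_cases hi : i < n
  · simpa [Gate.place, cls_of_Z] using cls_reduced .R2 i (show i + 1 ≤ n from hi)
  · simp [genZ, hi]

theorem genH_mul_self (i : ℕ) : genH n i * genH n i = 1 := by
  by_cases hi : i < n
  · simpa [Gate.place, cls_of_H] using cls_reduced .R3 i (show i + 1 ≤ n from hi)
  · simp [genH, hi]

theorem genCZ_mul_self (i : ℕ) : genCZ n i * genCZ n i = 1 := by
  by_cases hi : i + 1 < n
  · simpa [Gate.place, cls_of_CZ] using cls_reduced .R5 i (show i + 2 ≤ n from hi)
  · simp [genCZ, hi]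

theorem cls_of_mul_self (g : Gate n) : cls (FreeMonoid.of g) * cls (FreeMonoid.of g) = 1 := by
  cases g with
  | neg => exact genNeg_mul_self
  | H i => rw [cls_of_H]; exact genH_mul_self _
  | Z i => rw [cls_of_Z]; exact genZ_mul_self _
  | CZ i h => rw [cls_of_CZ]; exact genCZ_mul_self _

end Relations

theorem CircuitGroup.isUnit {n : ℕ} (x : CircuitGroup n) : IsUnit x := by
  induction x using PresentedMonoid.inductionOn with
  | h C =>
    induction C using FreeMonoid.inductionOn' with
    | one => exact isUnit_one
    | of_mul g C ih =>
      rw [map_mul]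
      exact IsUnit.mul ⟨⟨_, _, cls_of_mul_self g, cls_of_mul_self g⟩, rfl⟩ ih

noncomputable instance (n : ℕ) : Group (CircuitGroup n) := groupOfIsUnit CircuitGroup.isUnit

section Relations

variable {n : ℕ}

theorem commute_of_disjoint {g g' : Gate n} (h : Disjoint g.wires g'.wires) :
    Commute (cls (FreeMonoid.of g)) (cls (FreeMonoid.of g')) :=
  cls_eq_of_rel (.slide g g' h)

theorem commute_genNeg (x : CircuitGroup n) : Commute (genNeg n) x := by
  induction x using PresentedMonoid.inductionOn with
  | h C =>
    induction C using FreeMonoid.inductionOn' with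
    | one => exact Commute.one_right _
    | of_mul g C ih =>
      rw [map_mul]
      refine Commute.mul_right (commute_of_disjoint ?_) ih
      simp [Gate.wires]

theorem commute_genH_genH {i j : ℕ} (h : i ≠ j) : Commute (genH n i) (genH n j) := by
  unfold genH
  split_ifs
  · exact commute_of_disjoint (by simpa [Gate.wires] using h)
  all_goals simp only [Commute.one_left, Commute.one_right]

theorem commute_genZ_genH {i j : ℕ} (h : i ≠ j) : Commute (genZ n i) (genH n j) := by
  unfold genH genZ
  split_ifs
  · exact commute_of_disjoint (by simpa [Gate.wires] using h)
  all_goals simp only [Commute.one_left, Commute.one_right]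

theorem commute_genZ_genZ (i j : ℕ) : Commute (genZ n i) (genZ n j) := by
  rcases eq_or_ne i j with rfl | h
  · exact Commute.refl _
  unfold genZ
  split_ifs
  · exact commute_of_disjoint (by simpa [Gate.wires] using h)
  all_goals simp only [Commute.one_left, Commute.one_right]

theorem commute_genCZ_genH {i j : ℕ} (h : i ≠ j) (h' : i + 1 ≠ j) :
    Commute (genCZ n i) (genH n j) := by
  unfold genCZ genH
  split_ifs
  · exact commute_of_disjoint (by simp [Gate.wires]; omega)
  all_goals simp only [Commute.one_left, Commute.one_right]

theorem commute_genCZ_genZ (i j : ℕ) : Commute (genCZ n i) (genZ n j) := by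
  by_cases hi : i + 1 < n
  · by_cases h : i = j
    · subst h
      have := cls_reduced .R6 i (show i + 2 ≤ n from hi)
      simpa [Gate.place, cls_of_Z, cls_of_CZ, commute_iff_eq] using this.symm
    by_cases h' : i + 1 = j
    · subst h'
      have := cls_reduced .R7 i (show i + 2 ≤ n from hi)
      simpa [Gate.place, cls_of_Z, cls_of_CZ, commute_iff_eq] using this.symm
    unfold genCZ genZ
    split_ifs
    · exact commute_of_disjoint (by simp [Gate.wires]; omega)
    all_goals simp only [Commute.one_right]
  · simp [genCZ, hi]

theorem commute_genCZ_genCZ (i j : ℕ) : Commute (genCZ n i) (genCZ n j) := by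
  wlog hij : i ≤ j generalizing i j
  · exact (this j i (by omega)).symm
  by_cases hj : j + 1 < n
  · rcases hij.eq_or_lt with rfl | h
    · exact Commute.refl _
    by_cases h' : i + 1 = j
    · subst h'
      have := cls_reduced .R13 i (show i + 3 ≤ n by omega)
      simpa [Gate.place, cls_of_CZ, commute_iff_eq] using this
    unfold genCZ
    split_ifs
    · exact commute_of_disjoint (by simp [Gate.wires]; omega)
    all_goals simp only [Commute.one_left]
  · simp [genCZ, hj]

theorem genZ_mul_conj_genZ {i : ℕ} (h : i < n) :
    genZ n i * (genH n i * genZ n i * genH n i) = genNeg n *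
      ((genH n i * genZ n i * genH n i) * genZ n i) := by
  have := cls_reduced .R4 i (show i + 1 ≤ n by omega)
  simp only [Gate.place, cls_of_Z, cls_of_H, cls_of_neg, List.map_cons, List.map_nil,
    List.prod_cons, List.prod_nil, mul_one, Fin.val_zero, add_zero] at this
  rw [← this]
  simp only [mul_assoc, mul_self_cancel_left (genH_mul_self i),
    mul_self_cancel_left (genZ_mul_self i), genZ_mul_self,
    mul_one]

theorem twoWire {i : ℕ} (h : i + 1 < n) :
    TwoWire (genH n i) (genH n (i + 1)) (genZ n i) (genZ n (i + 1)) (genCZ n i) where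
  h₀_mul_self := genH_mul_self _
  h₁_mul_self := genH_mul_self _
  z₀_mul_self := genZ_mul_self _
  z₁_mul_self := genZ_mul_self _
  k_mul_self := genCZ_mul_self _
  hh := commute_genH_genH (by omega)
  hz := commute_genZ_genH (by omega)
  zh := commute_genZ_genH (by omega)
  zz := commute_genZ_genZ _ _
  z₀k := (commute_genCZ_genZ _ _).symm
  z₁k := (commute_genCZ_genZ _ _).symm
  x₀k := by
    have := cls_reduced .R8 i (show i + 2 ≤ n by omega)
    simpa [Gate.place, cls_of_Z, cls_of_H, cls_of_CZ, mul_assoc] using this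
  x₁k := by
    have := cls_reduced .R9 i (show i + 2 ≤ n by omega)
    simpa [Gate.place, cls_of_Z, cls_of_H, cls_of_CZ, mul_assoc] using this
  hk₀ := by
    have := cls_reduced .R10 i (show i + 2 ≤ n by omega)
    simpa [Gate.place, cls_of_Z, cls_of_H, cls_of_CZ, mul_assoc] using this
  hk₁ := by
    have := cls_reduced .R11 i (show i + 2 ≤ n by omega)
    simpa [Gate.place, cls_of_Z, cls_of_H, cls_of_CZ, mul_assoc] using this
  braid := by
    have := cls_reduced .R12 i (show i + 2 ≤ n by omega)
    simpa [Gate.place, cls_of_Z, cls_of_H, cls_of_CZ, mul_assoc] using this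

theorem threeWire {i : ℕ} (h : i + 2 < n) :
    ThreeWire (genH n i) (genH n (i + 1)) (genH n (i + 2)) (genZ n i) (genZ n (i + 1))
      (genZ n (i + 2))
      (genCZ n i) (genCZ n (i + 1)) where
  top := twoWire (by omega)
  bot := twoWire h
  h₂k₀ := (commute_genCZ_genH (by omega) (by omega)).symm
  h₀k₁ := (commute_genCZ_genH (by omega) (by omega)).symm
  kk := commute_genCZ_genCZ _ _
  far := by
    have := cls_reduced .R14 i (show i + 3 ≤ n by omega)
    simpa [Gate.place, cls_of_Z, cls_of_H, cls_of_CZ, mul_assoc] using this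
  cxk := by
    have := cls_reduced .R15 i (show i + 3 ≤ n by omega)
    simpa [Gate.place, cls_of_Z, cls_of_H, cls_of_CZ, mul_assoc] using this

end Relations

/-! ### Controlled `Z` gates on distant wires -/

/-- The swap of the wires `i` and `i + 1`. -/
noncomputable def swapGate (n i : ℕ) : CircuitGroup n :=
  swapWord (genH n i) (genH n (i + 1)) (genCZ n i)

/-- The controlled `Z` gate on the wires `i` and `i + j + 1`. -/
noncomputable def farCZ (n : ℕ) : ℕ → ℕ → CircuitGroup n
  | i, 0 => genCZ n i
  | i, j + 1 => swapGate n i * farCZ n (i + 1) j * swapGate n i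

section Distant

variable {n : ℕ}

theorem conj_eq_of_semiconjBy {G : Type*} [Group G] {s x y : G} (h : SemiconjBy s x y) :
    MulAut.conj s x = y := by
  rw [MulAut.conj_apply, h.eq, mul_inv_cancel_right]

theorem commute_of_conj {G : Type*} [Group G] {s x y x' y' : G} (hx : MulAut.conj s x = x')
    (hy : MulAut.conj s y = y') (h : Commute x y) : Commute x' y' := by
  rw [← hx, ← hy]
  exact h.map _

theorem commute_swapWord {G : Type*} [Group G] {x h₀ h₁ k : G} (a : Commute x h₀)
    (b : Commute x h₁) (c : Commute x k) : Commute x (swapWord h₀ h₁ k) := by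
  have t : Commute x (k * h₀ * h₁) := (c.mul_right a).mul_right b
  have : swapWord h₀ h₁ k = k * h₀ * h₁ * (k * h₀ * h₁) * (k * h₀ * h₁) := by
    simp only [swapWord, mul_assoc]
  exact this ▸ (t.mul_right t).mul_right t

theorem swapGate_mul_self {i : ℕ} (h : i + 1 < n) : swapGate n i * swapGate n i = 1 :=
  (twoWire h).swap_mul_self

theorem swapGate_inv {i : ℕ} (h : i + 1 < n) : (swapGate n i)⁻¹ = swapGate n i :=
  inv_eq_of_mul_eq_one_left (swapGate_mul_self h)

theorem conj_swapGate_genH {i : ℕ} (h : i + 1 < n) :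
    MulAut.conj (swapGate n i) (genH n i) = genH n (i + 1) :=
  conj_eq_of_semiconjBy (twoWire h).swap_mul_h₀

theorem conj_swapGate_genZ {i : ℕ} (h : i + 1 < n) :
    MulAut.conj (swapGate n i) (genZ n i) = genZ n (i + 1) :=
  conj_eq_of_semiconjBy (twoWire h).swap_mul_z₀

theorem conj_swapGate_genZ_succ {i : ℕ} (h : i + 1 < n) :
    MulAut.conj (swapGate n i) (genZ n (i + 1)) = genZ n i :=
  conj_eq_of_semiconjBy (twoWire h).swap_mul_z₁

theorem conj_swapGate_genCZ {i : ℕ} (h : i + 1 < n) :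
    MulAut.conj (swapGate n i) (genCZ n i) = genCZ n i :=
  conj_eq_of_semiconjBy (twoWire h).swap_mul_k

theorem conj_swapGate_genH_of_ne {i l : ℕ} (h : l ≠ i) (h' : l ≠ i + 1) :
    MulAut.conj (swapGate n i) (genH n l) = genH n l :=
  conj_eq_of_semiconjBy (commute_swapWord (commute_genH_genH h) (commute_genH_genH h')
    (commute_genCZ_genH h.symm h'.symm).symm).symm

theorem conj_swapGate_genZ_of_ne {i l : ℕ} (h : l ≠ i) (h' : l ≠ i + 1) :
    MulAut.conj (swapGate n i) (genZ n l) = genZ n l :=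
  conj_eq_of_semiconjBy (commute_swapWord (commute_genZ_genH h) (commute_genZ_genH h')
    (commute_genCZ_genZ _ _).symm).symm

theorem commute_genCZ_swapGate {i l : ℕ} (h : l + 1 < i ∨ i + 1 < l) :
    Commute (genCZ n l) (swapGate n i) :=
  commute_swapWord (commute_genCZ_genH (by omega) (by omega))
    (commute_genCZ_genH (by omega) (by omega)) (commute_genCZ_genCZ _ _)

theorem conj_swapGate_genCZ_of_disjoint {i l : ℕ} (h : l + 1 < i ∨ i + 1 < l) :
    MulAut.conj (swapGate n i) (genCZ n l) = genCZ n l :=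
  conj_eq_of_semiconjBy (commute_genCZ_swapGate h).symm

theorem commute_swapGate_swapGate {i l : ℕ} (h : l + 1 < i ∨ i + 1 < l) :
    Commute (swapGate n l) (swapGate n i) :=
  commute_swapWord
    (commute_swapWord (commute_genH_genH (by omega)) (commute_genH_genH (by omega))
      (commute_genCZ_genH (by omega) (by omega)).symm).symm
    (commute_swapWord (commute_genH_genH (by omega)) (commute_genH_genH (by omega))
      (commute_genCZ_genH (by omega) (by omega)).symm).symm
    (commute_genCZ_swapGate (by omega)).symm

theorem conj_swapGate_farCZ {i : ℕ} (h : i + 1 < n) (j : ℕ) :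
    MulAut.conj (swapGate n i) (farCZ n (i + 1) j) = farCZ n i (j + 1) := by
  rw [MulAut.conj_apply, swapGate_inv h, farCZ]

theorem farCZ_mul_self {i j : ℕ} (h : i + j + 1 < n) : farCZ n i j * farCZ n i j = 1 := by
  induction j generalizing i with
  | zero => exact genCZ_mul_self _
  | succ j ih =>
    have := congrArg (MulAut.conj (swapGate n i)) (ih (i := i + 1) (by omega))
    simpa only [map_mul, map_one, conj_swapGate_farCZ (show i + 1 < n by omega)] using this

theorem commute_farCZ_genH {i j l : ℕ} (h : i + j + 1 < n) (hl : l ≠ i) (hl' : l ≠ i + j + 1) :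
    Commute (farCZ n i j) (genH n l) := by
  induction j generalizing i l with
  | zero => exact commute_genCZ_genH (by omega) (by omega)
  | succ j ih =>
    have hi : i + 1 < n := by omega
    by_cases e : l = i + 1
    · subst e
      exact commute_of_conj (conj_swapGate_farCZ hi j) (conj_swapGate_genH hi)
        (ih (by omega) (by omega) (by omega))
    · exact commute_of_conj (conj_swapGate_farCZ hi j) (conj_swapGate_genH_of_ne hl e)
        (ih (by omega) e (by omega))

theorem commute_farCZ_genZ {i j : ℕ} (h : i + j + 1 < n) (l : ℕ) :
    Commute (farCZ n i j) (genZ n l) := by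
  induction j generalizing i l with
  | zero => exact commute_genCZ_genZ _ _
  | succ j ih =>
    have hi : i + 1 < n := by omega
    by_cases e : l = i + 1
    · subst e
      exact commute_of_conj (conj_swapGate_farCZ hi j) (conj_swapGate_genZ hi) (ih (by omega) _)
    by_cases e' : l = i
    · subst e'
      exact commute_of_conj (conj_swapGate_farCZ hi j) (conj_swapGate_genZ_succ hi)
        (ih (by omega) _)
    · exact commute_of_conj (conj_swapGate_farCZ hi j) (conj_swapGate_genZ_of_ne e' e)
        (ih (by omega) _)

theorem conj_swapGate_succ_genCZ {i : ℕ} (h : i + 2 < n) :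
    MulAut.conj (swapGate n (i + 1)) (genCZ n i) = farCZ n i 1 := by
  rw [MulAut.conj_apply, swapGate_inv (by omega)]
  exact (threeWire h).conj_swap_k₀_eq_conj_swap_k₁

theorem commute_farCZ_genCZ {i j l : ℕ} (h : i + j + 1 < n) (hl : i < l ∨ l + 1 < i) :
    Commute (farCZ n i j) (genCZ n l) := by
  induction j using Nat.strong_induction_on generalizing i l with
  | h j ih =>
  match j with
  | 0 => exact commute_genCZ_genCZ _ _
  | j + 1 =>
    have hi : i + 1 < n := by omega
    by_cases e : l = i + 1
    · subst e
      match j with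
      | 0 =>
        exact commute_of_conj (conj_swapGate_succ_genCZ (by omega)) (conj_swapGate_genCZ (by omega))
          (commute_genCZ_genCZ _ _)
      | j + 1 =>
        have e1 :
            MulAut.conj (swapGate n i * swapGate n (i + 1)) (genCZ n i) = genCZ n (i + 1) := by
          rw [map_mul, MulAut.mul_apply, conj_swapGate_succ_genCZ (by omega),
            ← conj_swapGate_farCZ hi, farCZ,
            ← MulAut.mul_apply, ← map_mul, swapGate_mul_self hi, map_one, MulAut.one_apply]
        have e2 :
            MulAut.conj (swapGate n i * swapGate n (i + 1)) (farCZ n (i + 2) j) =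
              farCZ n i (j + 2) := by
          rw [map_mul, MulAut.mul_apply, conj_swapGate_farCZ (i := i + 1) (by omega),
            conj_swapGate_farCZ hi]
        exact commute_of_conj e2 e1 (ih j (by omega) (by omega) (by omega))
    · exact commute_of_conj (conj_swapGate_farCZ hi j) (conj_swapGate_genCZ_of_disjoint (by omega))
        (ih j (by omega) (by omega) (by omega))

theorem conj_swapGate_bot_farCZ {i j : ℕ} (h : i + j + 2 < n) :
    MulAut.conj (swapGate n (i + j + 1)) (farCZ n i j) = farCZ n i (j + 1) := by
  induction j generalizing i with
  | zero => exact conj_swapGate_succ_genCZ (by omega)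
  | succ j ih =>
    have hi : i + 1 < n := by omega
    rw [← conj_swapGate_farCZ hi, ← MulAut.mul_apply, ← map_mul,
      (commute_swapGate_swapGate (by omega)).eq, map_mul,
      MulAut.mul_apply, show i + (j + 1) + 1 = i + 1 + j + 1 by ring, ih (by omega),
      conj_swapGate_farCZ hi]

theorem conj_swapGate_bot_farCZ_succ {i j : ℕ} (h : i + j + 2 < n) :
    MulAut.conj (swapGate n (i + j + 1)) (farCZ n i (j + 1)) = farCZ n i j := by
  rw [← conj_swapGate_bot_farCZ h, ← MulAut.mul_apply, ← map_mul, swapGate_mul_self (by omega),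
    map_one,
    MulAut.one_apply]

theorem commute_farCZ_swapGate {i j l : ℕ} (h : i + j + 1 < n) (hl : i + j + 1 < l) :
    Commute (farCZ n i j) (swapGate n l) :=
  commute_swapWord (commute_farCZ_genH h (by omega) (by omega))
    (commute_farCZ_genH h (by omega) (by omega))
    (commute_farCZ_genCZ h (by omega))

theorem commute_farCZ_farCZ_succ {i j : ℕ} (h : i + j + 2 < n) :
    Commute (farCZ n i j) (farCZ n i (j + 1)) := by
  induction j generalizing i with
  | zero =>
    exact commute_of_conj (conj_swapGate_genCZ (by omega)) (conj_swapGate_farCZ (by omega) 0)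
      (commute_genCZ_genCZ _ _)
  | succ j ih =>
    exact commute_of_conj (conj_swapGate_farCZ (by omega) _) (conj_swapGate_farCZ (by omega) _)
      (ih (by omega))

theorem commute_farCZ_farCZ {i j l : ℕ} (h : i + j + 1 < n) (hl : i + l + 1 < n) :
    Commute (farCZ n i j) (farCZ n i l) := by
  wlog hjl : j ≤ l generalizing j l
  · exact (this hl h (by omega)).symm
  induction l, hjl using Nat.le_induction with
  | base => exact Commute.refl _
  | succ l hjl ih =>
    rcases hjl.eq_or_lt with rfl | hlt
    · exact commute_farCZ_farCZ_succ (by omega)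
    · exact commute_of_conj (conj_eq_of_semiconjBy (commute_farCZ_swapGate h (by omega)).symm)
        (conj_swapGate_bot_farCZ (by omega)) (ih (by omega))

/-- The controlled `X` gate with control `i` and target `i + j + 1`. -/
noncomputable def farCX (n i j : ℕ) : CircuitGroup n :=
  genH n (i + j + 1) * farCZ n i j * genH n (i + j + 1)

theorem conj_swapGate_farCX {i j : ℕ} (h : i + j + 2 < n) :
    MulAut.conj (swapGate n i) (farCX n (i + 1) j) = farCX n i (j + 1) := by
  rw [farCX, map_mul, map_mul, conj_swapGate_farCZ (by omega),
    conj_swapGate_genH_of_ne (by omega) (by omega),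
    show i + 1 + j + 1 = i + (j + 1) + 1 by ring, farCX]

theorem genZ_mul_farCX {i j : ℕ} (h : i + j + 1 < n) :
    genZ n (i + j + 1) * farCX n i j = farCX n i j * (genZ n i * genZ n (i + j + 1)) := by
  induction j generalizing i with
  | zero => exact (twoWire h).z₁_mul_cx
  | succ j ih =>
    have := congrArg (MulAut.conj (swapGate n i)) (ih (i := i + 1) (by omega))
    simp only [map_mul, conj_swapGate_farCX (show i + j + 2 < n by omega),
      conj_swapGate_genZ_succ (show i + 1 < n by omega),
      conj_swapGate_genZ_of_ne (n := n) (show i + 1 + j + 1 ≠ i by omega)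
        (show i + 1 + j + 1 ≠ i + 1 by omega)] at this
    rw [show i + 1 + j + 1 = i + (j + 1) + 1 by ring] at this
    exact this

theorem farCX_mul_farCZ {i j : ℕ} (h : i + j + 1 < n) :
    farCX n i j * farCZ n i j = farCZ n i j * farCX n i j * genZ n i := by
  induction j generalizing i with
  | zero => exact (twoWire h).cx_mul_k
  | succ j ih =>
    have := congrArg (MulAut.conj (swapGate n i)) (ih (i := i + 1) (by omega))
    simpa only [map_mul, conj_swapGate_farCX (show i + j + 2 < n by omega),
      conj_swapGate_farCZ (show i + 1 < n by omega),
        conj_swapGate_genZ_succ (show i + 1 < n by omega)] using this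

theorem genCZ_mul_farCX {i j : ℕ} (h : i + j + 2 < n) :
    genCZ n (i + j + 1) * farCX n i j = farCX n i j * farCZ n i (j + 1) * genCZ n (i + j + 1) := by
  induction j generalizing i with
  | zero => exact (threeWire h).k₁_mul_cx
  | succ j ih =>
    have := congrArg (MulAut.conj (swapGate n i)) (ih (i := i + 1) (by omega))
    simp only [map_mul, conj_swapGate_farCX (show i + j + 2 < n by omega),
      conj_swapGate_farCZ (show i + 1 < n by omega),
      conj_swapGate_genCZ_of_disjoint (n := n)
        (show i + 1 + j + 1 + 1 < i ∨ i + 1 < i + 1 + j + 1 by omega)] at this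
    rw [show i + 1 + j + 1 = i + (j + 1) + 1 by ring] at this
    exact this

theorem genCZ_mul_farCX_succ {i j : ℕ} (h : i + j + 2 < n) :
    genCZ n (i + j + 1) * farCX n i (j + 1) =
      farCX n i (j + 1) * farCZ n i j * genCZ n (i + j + 1) := by
  have := congrArg (MulAut.conj (swapGate n (i + j + 1))) (genCZ_mul_farCX h)
  simp only [farCX, map_mul, conj_swapGate_bot_farCZ h, conj_swapGate_bot_farCZ_succ h,
    conj_swapGate_genCZ (show i + j + 1 + 1 < n by omega),
    conj_swapGate_genH (show i + j + 1 + 1 < n by omega)] at this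
  exact this

theorem farCX_mul_self {i j : ℕ} (h : i + j + 1 < n) : farCX n i j * farCX n i j = 1 := by
  simp only [farCX, mul_assoc, mul_self_cancel_left (genH_mul_self _),
    mul_self_cancel_left (farCZ_mul_self h),
    genH_mul_self]

end Distant

/-! ### Signed Pauli strings -/

/-- A signed Pauli string: a sign (`true` is `-1`), and for each wire the exponents `(x, z)` of the
matrix `X ^ x * Z ^ z`. Only the wires that are present matter. -/
abbrev PauliString : Type := Bool × (ℕ → Bool × Bool)

/-- The action of a gate on signed Pauli strings by conjugation. -/
def Gate.act {n : ℕ} : Gate n → PauliString → PauliString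
  | .neg, p => p
  | .H i, p =>
      (xor p.1 ((p.2 i).1 && (p.2 i).2), Function.update p.2 i ((p.2 i).2, (p.2 i).1))
  | .Z i, p => (xor p.1 (p.2 i).1, p.2)
  | .CZ i _, p =>
      (xor p.1 ((p.2 i).1 && (p.2 (i + 1)).1),
        Function.update (Function.update p.2 i ((p.2 i).1, xor (p.2 i).2 (p.2 (i + 1)).1))
          (i + 1) ((p.2 (i + 1)).1, xor (p.2 (i + 1)).2 (p.2 i).1))

/-- The action of a circuit on signed Pauli strings by conjugation. -/
def Circuit.act {n : ℕ} (C : Circuit n) (p : PauliString) : PauliString :=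
  C.toList.foldl (fun p g => g.act p) p

theorem act_one {n : ℕ} (p : PauliString) : (1 : Circuit n).act p = p := rfl

theorem act_of {n : ℕ} (g : Gate n) (p : PauliString) :
    Circuit.act (FreeMonoid.of g) p = g.act p := rfl

theorem act_mul {n : ℕ} (C D : Circuit n) (p : PauliString) :
    (C * D).act p = D.act (C.act p) := by
  simp [Circuit.act]

/-! ### Controlled Pauli operators -/

section BooleanPower

variable {M : Type*} [Monoid M] {g x y z : M}

/-- The power `x ^ b` of an element of a monoid with a Boolean exponent. -/
def bpow (x : M) (b : Bool) : M := bif b then x else 1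

@[simp] theorem bpow_true (x : M) : bpow x true = x := rfl

@[simp] theorem bpow_false (x : M) : bpow x false = 1 := rfl

theorem bpow_mul_eq_mul_bpow (h : x * g = g * y) (b : Bool) : bpow x b * g = g * bpow y b := by
  cases b
  · exact (one_mul g).trans (mul_one g).symm
  · exact h

theorem commute_bpow (h : Commute x y) (b : Bool) : Commute (bpow x b) y :=
  commute_iff_eq _ _ |>.2 <| by
    cases b
    · exact (one_mul y).trans (mul_one y).symm
    · exact h

theorem mul_bpow (x y : M) (b : Bool) : bpow (x * y) b = bpow x b * bpow y b := by
  cases b <;> simp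

theorem bpow_mul_bpow (h : x * x = 1) (a b : Bool) :
    bpow x a * bpow x b = bpow x (xor a b) := by
  cases a <;> cases b <;> simp [h]

theorem bpow_mul_bpow_of_mul_eq (h : x * y = z * (y * x)) (a b : Bool) :
    bpow x a * bpow y b = bpow z (a && b) * (bpow y b * bpow x a) := by
  cases a <;> cases b <;> simp [h]

end BooleanPower

section SiteProduct

variable {M : Type*} [Monoid M]

/-- The ordered product of the factors `blk j (f j)` that belong to the first `m` letters of the
string `f`. -/
def siteProd (blk : ℕ → Bool × Bool → M) : ℕ → (ℕ → Bool × Bool) → M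
  | 0, _ => 1
  | m + 1, f => siteProd blk m f * blk m (f m)

theorem siteProd_congr {blk : ℕ → Bool × Bool → M} {m : ℕ} {f f' : ℕ → Bool × Bool}
    (h : ∀ j < m, f j = f' j) : siteProd blk m f = siteProd blk m f' := by
  induction m with
  | zero => rfl
  | succ m ih => rw [siteProd, siteProd, ih fun j hj => h j (by omega), h m (by omega)]

theorem commute_siteProd {blk : ℕ → Bool × Bool → M} {m : ℕ} {f : ℕ → Bool × Bool} {g : M}
    (h : ∀ j < m, Commute (blk j (f j)) g) : Commute (siteProd blk m f) g := by
  induction m with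
  | zero => exact Commute.one_left _
  | succ m ih => exact (ih fun j hj => h j (by omega)).mul_left (h m (by omega))

theorem siteProd_mul_of_one {blk : ℕ → Bool × Bool → M} {m i : ℕ} (hi : i < m)
    {f : ℕ → Bool × Bool} {g z : M} {a' : Bool × Bool}
    (hz : ∀ j < m, ∀ a, Commute (blk j a) z)
    (h : ∀ j < m, j ≠ i → ∀ a, Commute (blk j a) g)
    (hg : blk i (f i) * g = g * (z * blk i a')) :
    siteProd blk m f * g = g * (z * siteProd blk m (Function.update f i a')) := by
  induction m with
  | zero => omega
  | succ m ih =>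
    rw [siteProd, siteProd]
    by_cases e : i = m
    · subst e
      rw [Function.update_self, mul_assoc, hg,
        siteProd_congr (f := Function.update f i a') (f' := f)
          fun j hj => Function.update_of_ne (ne_of_lt hj) _ _]
      have c1 : Commute (siteProd blk i f) g :=
        commute_siteProd fun j hj => h j (by omega) (by omega) _
      have c2 : Commute (siteProd blk i f) z := commute_siteProd fun j hj => hz j (by omega) _
      rw [← mul_assoc, c1.eq, mul_assoc, ← mul_assoc _ z, c2.eq, mul_assoc]
    · rw [Function.update_of_ne (by omega), mul_assoc, (h m (by omega) (by omega) _).eq,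
        ← mul_assoc, ih (by omega) (fun j hj => hz j (by omega)) (fun j hj => h j (by omega))]
      simp only [mul_assoc]

theorem siteProd_mul_of_two {blk : ℕ → Bool × Bool → M} {m i : ℕ} (hi : i + 1 < m)
    {f : ℕ → Bool × Bool} {g z : M} {a' b' : Bool × Bool}
    (hz : ∀ j < m, ∀ a, Commute (blk j a) z)
    (h : ∀ j < m, j ≠ i → j ≠ i + 1 → ∀ a, Commute (blk j a) g)
    (hg : blk i (f i) * blk (i + 1) (f (i + 1)) * g = g * (z * (blk i a' * blk (i + 1) b'))) :
    siteProd blk m f * g =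
      g * (z * siteProd blk m (Function.update (Function.update f i a') (i + 1) b')) := by
  induction m with
  | zero => omega
  | succ m ih =>
    by_cases e : i + 1 = m
    · subst e
      rw [siteProd, siteProd, siteProd, siteProd, Function.update_self,
        Function.update_of_ne (by omega), Function.update_self,
        mul_assoc, mul_assoc, ← mul_assoc (blk i (f i)), hg,
        siteProd_congr (f := Function.update (Function.update f i a') (i + 1) b') (f' := f)
          fun j hj => by
            rw [Function.update_of_ne (by omega), Function.update_of_ne (by omega)]]
      have c1 : Commute (siteProd blk i f) g :=
        commute_siteProd fun j hj => h j (by omega) (by omega) (by omega) _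
      have c2 : Commute (siteProd blk i f) z := commute_siteProd fun j hj => hz j (by omega) _
      rw [← mul_assoc, c1.eq, mul_assoc, ← mul_assoc _ z, c2.eq]
      simp only [mul_assoc]
    · rw [siteProd, siteProd, Function.update_of_ne (by omega), Function.update_of_ne (by omega),
        mul_assoc, (h m (by omega) (by omega) (by omega) _).eq,
        ← mul_assoc, ih (by omega) (fun j hj => hz j (by omega)) (fun j hj => h j (by omega))]
      simp only [mul_assoc]

end SiteProduct

section Controlled

variable {n : ℕ}

theorem commute_genZ_farCX {i j : ℕ} (h : i + j + 1 < n) : Commute (genZ n i) (farCX n i j) :=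
  ((commute_genZ_genH (by omega)).mul_right (commute_farCZ_genZ h i).symm).mul_right
    (commute_genZ_genH (by omega))

theorem commute_farCZ_farCX {i j l : ℕ} (hj : i + j + 1 < n) (hl : i + l + 1 < n) (hjl : j ≠ l) :
    Commute (farCZ n i j) (farCX n i l) :=
  have h : Commute (farCZ n i j) (genH n (i + l + 1)) :=
    commute_farCZ_genH hj (by omega) (by omega)
  (h.mul_right (commute_farCZ_farCZ hj hl)).mul_right h

/-- The Pauli matrix with exponents `a` on wire `i + j + 1`, controlled by wire `i`. -/
noncomputable def ctlLetter (n i j : ℕ) (a : Bool × Bool) : CircuitGroup n :=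
  bpow (farCZ n i j) a.2 * bpow (farCX n i j) a.1

/-- The Pauli string `p` on the wires `1, …, m`, controlled by wire `0`; a controlled sign is the
gate `Z` on the control. -/
noncomputable def ctlPauli (n m : ℕ) (p : PauliString) : CircuitGroup n :=
  bpow (genZ n 0) p.1 * siteProd (ctlLetter n 0) m p.2

theorem commute_ctlLetter {i j : ℕ} {g : CircuitGroup n} (h : Commute (farCZ n i j) g)
    (h' : Commute (genH n (i + j + 1)) g) (a : Bool × Bool) : Commute (ctlLetter n i j a) g :=
  (commute_bpow h _).mul_left (commute_bpow ((h'.mul_left h).mul_left h') _)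

theorem commute_ctlLetter_genZ {i j l : ℕ} (h : i + j + 1 < n) (hl : l ≠ i + j + 1)
    (a : Bool × Bool) :
    Commute (ctlLetter n i j a) (genZ n l) :=
  commute_ctlLetter (commute_farCZ_genZ h l) (commute_genZ_genH hl).symm a

theorem commute_ctlLetter_genH {i j l : ℕ} (h : i + j + 1 < n) (hl : l ≠ i) (hl' : l ≠ i + j + 1)
    (a : Bool × Bool) : Commute (ctlLetter n i j a) (genH n l) :=
  commute_ctlLetter (commute_farCZ_genH h hl hl') (commute_genH_genH hl'.symm) a

theorem commute_ctlLetter_genCZ {i j l : ℕ} (h : i + j + 1 < n) (hl : i < l) (h1 : l ≠ i + j + 1)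
    (h2 : l ≠ i + j) (a : Bool × Bool) : Commute (ctlLetter n i j a) (genCZ n l) :=
  commute_ctlLetter (commute_farCZ_genCZ h (.inl hl)) (commute_genCZ_genH h1 (by omega)).symm a

theorem farCX_bpow_mul_farCZ_bpow {i j : ℕ} (h : i + j + 1 < n) (a b : Bool) :
    bpow (farCX n i j) a * bpow (farCZ n i j) b =
      bpow (genZ n i) (a && b) * (bpow (farCZ n i j) b * bpow (farCX n i j) a) := by
  refine bpow_mul_bpow_of_mul_eq ?_ a b
  rw [farCX_mul_farCZ h]
  exact ((commute_farCZ_genZ h i).symm.mul_right (commute_genZ_farCX h)).eq.symm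

theorem ctlLetter_mul_genH {i j : ℕ} (h : i + j + 1 < n) (a : Bool × Bool) :
    ctlLetter n i j a * genH n (i + j + 1) =
      genH n (i + j + 1) * (bpow (genZ n i) (a.1 && a.2) * ctlLetter n i j (a.2, a.1)) := by
  have cx_mul_h : farCX n i j * genH n (i + j + 1) = genH n (i + j + 1) * farCZ n i j := by
    simp only [farCX, mul_assoc, genH_mul_self, mul_one]
  have cz_mul_h : farCZ n i j * genH n (i + j + 1) = genH n (i + j + 1) * farCX n i j := by
    simp only [farCX, mul_assoc, mul_self_cancel_left (genH_mul_self _)]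
  rw [ctlLetter, mul_assoc, bpow_mul_eq_mul_bpow cx_mul_h,
    mul_left_extend (bpow_mul_eq_mul_bpow cz_mul_h _), farCX_bpow_mul_farCZ_bpow h, ctlLetter,
    Bool.and_comm]

theorem ctlLetter_mul_genZ {i j : ℕ} (h : i + j + 1 < n) (a : Bool × Bool) :
    ctlLetter n i j a * genZ n (i + j + 1) =
      genZ n (i + j + 1) * (bpow (genZ n i) a.1 * ctlLetter n i j a) := by
  have cx_mul_z : farCX n i j * genZ n (i + j + 1) =
      genZ n (i + j + 1) * (genZ n i * farCX n i j) := by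
    rw [(commute_genZ_farCX h).eq, ← mul_assoc, genZ_mul_farCX h, mul_assoc, mul_assoc,
      (commute_genZ_genZ (i + j + 1) i).eq, mul_self_cancel_left (genZ_mul_self i)]
  have cz_comm := (commute_bpow (commute_farCZ_genZ h i).symm a.1).symm
  rw [ctlLetter, mul_assoc, bpow_mul_eq_mul_bpow cx_mul_z,
    mul_left_extend (commute_bpow (commute_farCZ_genZ h (i + j + 1)) a.2).eq, mul_bpow,
    mul_left_extend (commute_bpow cz_comm a.2).eq]

theorem farCX_mul_genCZ {i j : ℕ} (h : i + j + 2 < n) :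
    farCX n i j * genCZ n (i + j + 1) =
      genCZ n (i + j + 1) * (farCX n i j * farCZ n i (j + 1)) := by
  have cz'_mul_self : farCZ n i (j + 1) * farCZ n i (j + 1) = 1 := farCZ_mul_self h
  have cz'_k : Commute (farCZ n i (j + 1)) (genCZ n (i + j + 1)) :=
    commute_farCZ_genCZ h (by omega)
  rw [← mul_assoc, genCZ_mul_farCX h, mul_assoc, mul_assoc, ← cz'_k.eq,
    mul_self_cancel_left cz'_mul_self]

theorem farCX_succ_mul_genCZ {i j : ℕ} (h : i + j + 2 < n) :
    farCX n i (j + 1) * genCZ n (i + j + 1) =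
      genCZ n (i + j + 1) * (farCX n i (j + 1) * farCZ n i j) := by
  have hj : i + j + 1 < n := by omega
  have cz_k : Commute (farCZ n i j) (genCZ n (i + j + 1)) := commute_farCZ_genCZ hj (by omega)
  rw [← mul_assoc, genCZ_mul_farCX_succ h, mul_assoc, mul_assoc, ← cz_k.eq,
    mul_self_cancel_left (farCZ_mul_self hj)]

theorem ctlLetter_mul_genCZ {i j : ℕ} (h : i + j + 2 < n) (a b : Bool × Bool) :
    ctlLetter n i j a * ctlLetter n i (j + 1) b * genCZ n (i + j + 1) =
      genCZ n (i + j + 1) * (bpow (genZ n i) (a.1 && b.1) *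
        (ctlLetter n i j (a.1, xor a.2 b.1) * ctlLetter n i (j + 1) (b.1, xor b.2 a.1))) := by
  have hj : i + j + 1 < n := by omega
  have cz'_mul_self : farCZ n i (j + 1) * farCZ n i (j + 1) = 1 := farCZ_mul_self h
  have cz_cz' : Commute (farCZ n i j) (farCZ n i (j + 1)) := commute_farCZ_farCZ hj h
  have cz_cx' : Commute (farCZ n i j) (farCX n i (j + 1)) := commute_farCZ_farCX hj h (by omega)
  have z_cz : Commute (genZ n i) (farCZ n i j) := (commute_farCZ_genZ hj i).symm
  have cz_k : Commute (farCZ n i j) (genCZ n (i + j + 1)) := commute_farCZ_genCZ hj (by omega)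
  have cz'_k : Commute (farCZ n i (j + 1)) (genCZ n (i + j + 1)) :=
    commute_farCZ_genCZ h (by omega)
  have cz'_pow_cz_pow (c : Bool) : Commute (bpow (farCZ n i (j + 1)) c) (bpow (farCZ n i j) b.1) :=
    commute_bpow (commute_bpow cz_cz' b.1).symm c
  have cx'_pow_cz_pow : Commute (bpow (farCX n i (j + 1)) b.1) (bpow (farCZ n i j) b.1) :=
    commute_bpow (commute_bpow cz_cx' b.1).symm b.1
  have cz_pow_z_pow (c : Bool) : Commute (bpow (farCZ n i j) a.2) (bpow (genZ n i) c) :=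
    commute_bpow (commute_bpow z_cz c).symm a.2
  simp only [ctlLetter]
  rw [← bpow_mul_bpow (farCZ_mul_self hj), Bool.xor_comm b.2, ← bpow_mul_bpow cz'_mul_self]
  calc _ = genCZ n (i + j + 1) * (bpow (farCZ n i j) a.2 *
          (bpow (farCX n i j) a.1 * bpow (farCZ n i (j + 1)) a.1) *
            (bpow (farCZ n i (j + 1)) b.2 *
              (bpow (farCX n i (j + 1)) b.1 * bpow (farCZ n i j) b.1))) := by
        simp only [mul_assoc, bpow_mul_eq_mul_bpow (farCX_succ_mul_genCZ h), mul_bpow,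
          mul_left_extend (commute_bpow cz'_k _).eq,
          mul_left_extend (bpow_mul_eq_mul_bpow (farCX_mul_genCZ h) _),
          mul_left_extend (commute_bpow cz_k _).eq]
    _ = genCZ n (i + j + 1) * (bpow (farCZ n i j) a.2 *
          (bpow (farCX n i j) a.1 * bpow (farCZ n i j) b.1) *
            (bpow (farCZ n i (j + 1)) a.1 *
              (bpow (farCZ n i (j + 1)) b.2 * bpow (farCX n i (j + 1)) b.1))) := by
        simp only [mul_assoc, cx'_pow_cz_pow.eq, mul_left_extend (cz'_pow_cz_pow _).eq]
    _ = _ := by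
        rw [farCX_bpow_mul_farCZ_bpow hj]
        simp only [mul_assoc, mul_left_extend (cz_pow_z_pow _).eq]

theorem ctlPauli_mul_of_siteProd_mul {m : ℕ} {p : PauliString} {g : CircuitGroup n} {b : Bool}
    {f : ℕ → Bool × Bool} (hg : Commute (genZ n 0) g)
    (h : siteProd (ctlLetter n 0) m p.2 * g =
      g * (bpow (genZ n 0) b * siteProd (ctlLetter n 0) m f)) :
    ctlPauli n m p * g = g * ctlPauli n m (xor p.1 b, f) := by
  rw [ctlPauli, mul_assoc, h, mul_left_extend (commute_bpow hg p.1).eq, ← mul_assoc (bpow _ _),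
    bpow_mul_bpow (genZ_mul_self 0), ctlPauli]

theorem ctlPauli_mul_gate (g : Gate n) (p : PauliString) :
    ctlPauli (n + 1) n p * cls (FreeMonoid.of (g.place 1 (by omega))) =
      cls (FreeMonoid.of (g.place 1 (by omega))) * ctlPauli (n + 1) n (g.act p) := by
  have commute_sign (b : Bool) :
      ∀ j < n, ∀ a, Commute (ctlLetter (n + 1) 0 j a) (bpow (genZ (n + 1) 0) b) :=
    fun j hj a => (commute_bpow (commute_ctlLetter_genZ (by omega) (by omega) a).symm b).symm
  cases g with
  | neg => exact (commute_genNeg _).symm.eq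
  | H i =>
    simp only [Gate.place, cls_of_H, Gate.act]
    refine ctlPauli_mul_of_siteProd_mul (commute_genZ_genH (by omega))
      (siteProd_mul_of_one i.isLt (commute_sign _)
        (fun j hj hji a => commute_ctlLetter_genH (by omega) (by omega) (by omega) a) ?_)
    simpa only [zero_add, add_comm 1] using
      ctlLetter_mul_genH (n := n + 1) (i := 0) (j := i) (by omega) (p.2 i)
  | Z i =>
    simp only [Gate.place, cls_of_Z, Gate.act]
    refine ctlPauli_mul_of_siteProd_mul (commute_genZ_genZ _ _) ?_
    have := siteProd_mul_of_one (a' := p.2 i) i.isLt (commute_sign (p.2 i).1)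
      (fun j hj hji a => commute_ctlLetter_genZ (l := 1 + i) (by omega) (by omega) a)
      (by simpa only [zero_add, add_comm 1] using
        ctlLetter_mul_genZ (n := n + 1) (i := 0) (j := i) (by omega) (p.2 i))
    rwa [Function.update_eq_self] at this
  | CZ i hi =>
    simp only [Gate.place, cls_of_CZ, Gate.act]
    refine ctlPauli_mul_of_siteProd_mul (commute_genCZ_genZ _ _).symm
      (siteProd_mul_of_two hi (commute_sign _)
        (fun j hj hji hji' a =>
          commute_ctlLetter_genCZ (by omega) (by omega) (by omega) (by omega) a) ?_)
    simpa only [zero_add, add_comm 1] using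
      ctlLetter_mul_genCZ (n := n + 1) (i := 0) (j := i) (by omega) (p.2 i) (p.2 (i + 1))

theorem ctlPauli_mul_place (C : Circuit n) (p : PauliString) :
    ctlPauli (n + 1) n p * cls (C.place 1 (by omega)) =
      cls (C.place 1 (by omega)) * ctlPauli (n + 1) n (C.act p) := by
  induction C using FreeMonoid.inductionOn' generalizing p with
  | one => rw [map_one, cls_one, act_one, mul_one, one_mul]
  | of_mul g C ih =>
    rw [map_mul, cls_mul, act_mul, act_of, ← mul_assoc]
    have := ctlPauli_mul_gate g p
    rw [show Circuit.place 1 (by omega) (FreeMonoid.of g) =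
      FreeMonoid.of (g.place 1 (show 1 + n ≤ n + 1 by omega)) from rfl, this, mul_assoc, ih,
      mul_assoc]

end Controlled

/-! ### Tensor products -/

section Tensor

variable {n : ℕ}

theorem tensor_apply (P : Fin n → Matrix (Fin 2) (Fin 2) ℝ) (x y : Fin n → Fin 2) :
    tensor P x y = ∏ i, P i (x i) (y i) := rfl

theorem tensor_mul (P Q : Fin n → Matrix (Fin 2) (Fin 2) ℝ) :
    tensor P * tensor Q = tensor fun i => P i * Q i := by
  ext x y
  simp only [Matrix.mul_apply, tensor_apply, Finset.prod_univ_sum, Finset.prod_mul_distrib,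
    Fintype.piFinset_univ]

theorem tensor_one : tensor (fun _ : Fin n => 1) = 1 := by
  ext x y
  rw [tensor_apply, Matrix.one_apply]
  split_ifs with h
  · exact Finset.prod_eq_one fun i _ => by rw [h, Matrix.one_apply_eq]
  · obtain ⟨i, hi⟩ := Function.ne_iff.1 h
    exact Finset.prod_eq_zero (Finset.mem_univ i) (Matrix.one_apply_ne hi)

theorem tensor_eq_smul {P Q : Fin n → Matrix (Fin 2) (Fin 2) ℝ} {i : Fin n} {c : ℝ}
    (h : ∀ l, l ≠ i → P l = Q l) (hi : P i = c • Q i) : tensor P = c • tensor Q := by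
  ext x y
  rw [Matrix.smul_apply, tensor_apply, tensor_apply,
    ← Finset.mul_prod_erase _ _ (Finset.mem_univ i),
    ← Finset.mul_prod_erase _ (fun i => Q i (x i) (y i)) (Finset.mem_univ i), hi,
    Matrix.smul_apply, smul_eq_mul, smul_eq_mul, mul_assoc]
  congr 2
  exact Finset.prod_congr rfl fun l hl => by rw [h l (Finset.ne_of_mem_erase hl)]

theorem onQubit_mul_onQubit (i : Fin n) (M N : Matrix (Fin 2) (Fin 2) ℝ) :
    onQubit i M * onQubit i N = onQubit i (M * N) := by
  rw [onQubit, onQubit, tensor_mul, onQubit]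
  congr 1
  funext l
  by_cases h : l = i
  · subst h; simp
  · simp [h]

theorem onQubit_one (i : Fin n) : onQubit i 1 = 1 := by
  rw [onQubit, Function.update_eq_self_iff.2 rfl, tensor_one]

theorem onQubit_apply (i : Fin n) (M : Matrix (Fin 2) (Fin 2) ℝ) (x y : Fin n → Fin 2) :
    onQubit i M x y = if ∀ l, l ≠ i → x l = y l then M (x i) (y i) else 0 := by
  rw [onQubit, tensor_apply]
  split_ifs with h
  · rw [← Finset.mul_prod_erase _ _ (Finset.mem_univ i), Function.update_self]
    rw [Finset.prod_eq_one, mul_one]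
    intro l hl
    have := Finset.ne_of_mem_erase hl
    rw [Function.update_of_ne this, h l this, Matrix.one_apply_eq]
  · push Not at h
    obtain ⟨l, hl, hxy⟩ := h
    refine Finset.prod_eq_zero (Finset.mem_univ l) ?_
    rw [Function.update_of_ne hl, Matrix.one_apply_ne hxy]

theorem tensor_transpose (P : Fin n → Matrix (Fin 2) (Fin 2) ℝ) :
    (tensor P).transpose = tensor fun i => (P i).transpose := rfl

theorem onQubit_transpose (i : Fin n) (M : Matrix (Fin 2) (Fin 2) ℝ) :
    (onQubit i M).transpose = onQubit i M.transpose := by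
  rw [onQubit, tensor_transpose, onQubit]
  congr 1
  funext l
  by_cases h : l = i
  · subst h; simp
  · simp [h]

end Tensor

theorem hadamard_mul_self : hadamard * hadamard = 1 := by
  have h : (√2)⁻¹ * (√2)⁻¹ = (1 / 2 : ℝ) := by
    rw [← mul_inv, Real.mul_self_sqrt (by norm_num)]; norm_num
  ext i j
  fin_cases i <;> fin_cases j <;> simp [hadamard, Matrix.mul_apply, Fin.sum_univ_two, h] <;>
    norm_num

theorem pauliZ_mul_self : pauliZ * pauliZ = 1 := by
  ext i j
  fin_cases i <;> fin_cases j <;> simp [pauliZ, Matrix.mul_apply, Fin.sum_univ_two]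

theorem pauliX_mul_self : pauliX * pauliX = 1 := by
  ext i j
  fin_cases i <;> fin_cases j <;> simp [pauliX, Matrix.mul_apply, Fin.sum_univ_two]

theorem hadamard_transpose : hadamard.transpose = hadamard := by
  ext i j
  fin_cases i <;> fin_cases j <;> simp [hadamard]

theorem pauliZ_transpose : pauliZ.transpose = pauliZ := by
  ext i j
  fin_cases i <;> fin_cases j <;> simp [pauliZ]

/-! ### Operators of circuits -/

section Operators

variable {n : ℕ}

theorem operator_one : (1 : Circuit n).operator = 1 := by
  simp [Circuit.operator]

theorem operator_mul (C D : Circuit n) : (C * D).operator = D.operator * C.operator := by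
  simp [Circuit.operator]

theorem operator_of (g : Gate n) : Circuit.operator (FreeMonoid.of g) = g.operator := by
  simp [Circuit.operator]

theorem Gate.operator_mul_self (g : Gate n) : g.operator * g.operator = 1 := by
  cases g with
  | neg => simp [Gate.operator]
  | H i => rw [Gate.operator, onQubit_mul_onQubit, hadamard_mul_self, onQubit_one]
  | Z i => rw [Gate.operator, onQubit_mul_onQubit, pauliZ_mul_self, onQubit_one]
  | CZ i h =>
    rw [Gate.operator, Matrix.diagonal_mul_diagonal, ← Matrix.diagonal_one]
    congr 1
    funext x
    split_ifs <;> norm_num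

theorem Gate.operator_transpose (g : Gate n) : g.operator.transpose = g.operator := by
  cases g with
  | neg => simp [Gate.operator]
  | H i => rw [Gate.operator, onQubit_transpose, hadamard_transpose]
  | Z i => rw [Gate.operator, onQubit_transpose, pauliZ_transpose]
  | CZ i h => rw [Gate.operator, Matrix.diagonal_transpose]

theorem operator_mul_transpose (C : Circuit n) : C.operator * C.operator.transpose = 1 := by
  induction C using FreeMonoid.inductionOn' with
  | one => simp [operator_one]
  | of_mul g C ih =>
    rw [operator_mul, operator_of, Matrix.transpose_mul, Gate.operator_transpose, mul_assoc,
      ← mul_assoc g.operator, Gate.operator_mul_self, one_mul, ih]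

theorem transpose_mul_operator (C : Circuit n) : C.operator.transpose * C.operator = 1 :=
  mul_eq_one_comm.1 (operator_mul_transpose C)

/-! ### Pauli operators -/

/-- The integer entries of `X ^ x * Z ^ z`. -/
def pauliEntry (a : Bool × Bool) (u v : Fin 2) : ℤ :=
  if u = v + (bif a.1 then 1 else 0) then (if a.2 ∧ v = 1 then -1 else 1) else 0

/-- The matrix `X ^ x * Z ^ z`. -/
def pauliLetter (a : Bool × Bool) : Matrix (Fin 2) (Fin 2) ℝ :=
  Matrix.of fun u v => (pauliEntry a u v : ℝ)

/-- The sign denoted by a Boolean. -/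
def boolSign (b : Bool) : ℤ := bif b then -1 else 1

theorem boolSign_mul_boolSign (a b : Bool) : boolSign a * boolSign b = boolSign (xor a b) := by
  revert a b; decide

theorem boolSign_false : boolSign false = 1 := rfl

theorem boolSign_ne_zero (a : Bool) : boolSign a ≠ 0 := by
  revert a; decide

theorem boolSign_injective : Function.Injective boolSign := by decide

/-- The operator of a signed Pauli string. -/
def pauliOp (n : ℕ) (p : PauliString) : Operator n :=
  (boolSign p.1 : ℝ) • tensor fun i : Fin n => pauliLetter (p.2 i)

theorem pauliLetter_one : pauliLetter (false, false) = 1 := by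
  ext i j
  fin_cases i <;> fin_cases j <;> simp [pauliLetter, pauliEntry]

theorem pauliLetter_X : pauliLetter (true, false) = pauliX := by
  ext i j
  fin_cases i <;> fin_cases j <;> simp [pauliLetter, pauliEntry, pauliX]

theorem pauliLetter_Z : pauliLetter (false, true) = pauliZ := by
  ext i j
  fin_cases i <;> fin_cases j <;> simp [pauliLetter, pauliEntry, pauliZ]

theorem pauliLetter_Y : pauliLetter (true, true) = pauliX * pauliZ := by
  ext i j
  fin_cases i <;> fin_cases j <;>
    simp [pauliLetter, pauliEntry, pauliX, pauliZ, Matrix.mul_apply, Fin.sum_univ_two]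

theorem hadamard_mul_pauliLetter (a : Bool × Bool) :
    hadamard * pauliLetter a = (boolSign (a.1 && a.2) : ℝ) •
      (pauliLetter (a.2, a.1) * hadamard) := by
  obtain ⟨a, b⟩ := a
  ext i j
  cases a <;> cases b <;> fin_cases i <;> fin_cases j <;>
    simp [hadamard, pauliLetter, pauliEntry, Matrix.mul_apply, Fin.sum_univ_two, boolSign]

theorem pauliZ_mul_pauliLetter (a : Bool × Bool) :
    pauliZ * pauliLetter a = (boolSign a.1 : ℝ) • (pauliLetter a * pauliZ) := by
  obtain ⟨a, b⟩ := a
  ext i j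
  cases a <;> cases b <;> fin_cases i <;> fin_cases j <;>
    simp [pauliZ, pauliLetter, pauliEntry, Matrix.mul_apply, Fin.sum_univ_two, boolSign]

theorem cz_pauliEntry (a b : Bool × Bool) (u v u' v' : Fin 2) :
    (if u = 1 ∧ v = 1 then -1 else 1) * (pauliEntry a u u' * pauliEntry b v v') =
      boolSign (a.1 && b.1) * (pauliEntry (a.1, xor a.2 b.1) u u' *
        pauliEntry (b.1, xor b.2 a.1) v v') * (if u' = 1 ∧ v' = 1 then -1 else 1) := by
  revert a b u v u' v'
  decide

theorem pauliOp_apply (p : PauliString) (x y : Fin n → Fin 2) :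
    pauliOp n p x y = boolSign p.1 * ∏ i : Fin n, (pauliEntry (p.2 i) (x i) (y i) : ℝ) := by
  simp [pauliOp, tensor_apply, pauliLetter]

theorem onQubit_mul_pauliOp {i : Fin n} {M : Matrix (Fin 2) (Fin 2) ℝ} {p : PauliString}
    {s : Bool} {a : Bool × Bool} (h : M * pauliLetter (p.2 i) =
      (boolSign s : ℝ) • (pauliLetter a * M)) :
    onQubit i M * pauliOp n p =
      pauliOp n (xor p.1 s, Function.update p.2 i a) * onQubit i M := by
  rw [pauliOp, pauliOp, onQubit, Matrix.mul_smul, Matrix.smul_mul, tensor_mul, tensor_mul,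
    ← boolSign_mul_boolSign, Int.cast_mul, mul_smul]
  congr 1
  refine tensor_eq_smul (i := i) (fun l hl => ?_) ?_
  · have hl' : (l : ℕ) ≠ i := by simpa [Fin.ext_iff] using hl
    simp [hl, hl']
  · simpa using h

theorem prod_mul_eq_mul_prod_of_pair {ι M : Type*} [Fintype ι] [CommMonoid M]
    {f g : ι → M} {i j : ι} {c d : M} (hij : i ≠ j) (hc : f i * f j * c = d * (g i * g j))
    (hfg : ∀ l, l ≠ i → l ≠ j → f l = g l) : (∏ l, f l) * c = d * ∏ l, g l := by
  classical
  have hj : j ∈ Finset.univ.erase i := Finset.mem_erase.2 ⟨hij.symm, Finset.mem_univ j⟩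
  have split_pair (f : ι → M) :
      ∏ l, f l = f i * f j * ∏ l ∈ (Finset.univ.erase i).erase j, f l := by
    rw [mul_assoc, Finset.mul_prod_erase _ f hj, Finset.mul_prod_erase _ f (Finset.mem_univ i)]
  have rest : ∏ l ∈ (Finset.univ.erase i).erase j, f l =
      ∏ l ∈ (Finset.univ.erase i).erase j, g l :=
    Finset.prod_congr rfl fun l hl =>
      hfg l (Finset.ne_of_mem_erase (Finset.mem_of_mem_erase hl)) (Finset.ne_of_mem_erase hl)
  rw [split_pair f, split_pair g, rest, mul_right_comm, hc, mul_assoc]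

theorem cz_mul_pauliOp {i : ℕ} (hi : i + 1 < n) (p : PauliString) :
    (Gate.CZ i hi).operator * pauliOp n p =
      pauliOp n ((Gate.CZ i hi).act p) * (Gate.CZ i hi).operator := by
  ext x y
  let i₀ : Fin n := ⟨i, by omega⟩
  let i₁ : Fin n := ⟨i + 1, hi⟩
  have sign : (boolSign ((Gate.CZ i hi).act p).1 : ℝ) =
      boolSign p.1 * boolSign ((p.2 i).1 && (p.2 (i + 1)).1) := by
    rw [← Int.cast_mul, boolSign_mul_boolSign]; rfl
  have pair := congrArg (Int.cast : ℤ → ℝ)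
    (cz_pauliEntry (p.2 i) (p.2 (i + 1)) (x i₀) (x i₁) (y i₀) (y i₁))
  have entries := prod_mul_eq_mul_prod_of_pair
    (f := fun l : Fin n => (pauliEntry (p.2 l) (x l) (y l) : ℝ))
    (g := fun l : Fin n => (pauliEntry (((Gate.CZ i hi).act p).2 l) (x l) (y l) : ℝ))
    (i := i₀) (j := i₁) (c := if x i₀ = 1 ∧ x i₁ = 1 then -1 else 1)
    (d := boolSign ((p.2 i).1 && (p.2 (i + 1)).1) * if y i₀ = 1 ∧ y i₁ = 1 then -1 else 1)
    (by simp [i₀, i₁])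
    (by
      push_cast at pair
      simp only [Gate.act, i₀, i₁, Function.update_self,
        Function.update_of_ne (show i ≠ i + 1 by omega)]
      linear_combination pair)
    (fun l hl hl' => by
      have hl : (l : ℕ) ≠ i := fun h => hl (Fin.ext h)
      have hl' : (l : ℕ) ≠ i + 1 := fun h => hl' (Fin.ext h)
      simp only [Gate.act, Function.update_of_ne hl, Function.update_of_ne hl'])
  rw [Gate.operator, Matrix.diagonal_mul, Matrix.mul_diagonal, pauliOp_apply, pauliOp_apply, sign]
  linear_combination (boolSign p.1 : ℝ) * entries

theorem Gate.operator_mul_pauliOp (g : Gate n) (p : PauliString) :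
    g.operator * pauliOp n p = pauliOp n (g.act p) * g.operator := by
  cases g with
  | neg => simp [Gate.operator, Gate.act]
  | H i => exact onQubit_mul_pauliOp (hadamard_mul_pauliLetter _)
  | Z i =>
    have := onQubit_mul_pauliOp (i := i) (p := p) (pauliZ_mul_pauliLetter (p.2 i))
    rwa [Function.update_eq_self] at this
  | CZ i hi => exact cz_mul_pauliOp hi p

theorem operator_mul_pauliOp (C : Circuit n) (p : PauliString) :
    C.operator * pauliOp n p = pauliOp n (C.act p) * C.operator := by
  induction C using FreeMonoid.inductionOn' generalizing p with
  | one => simp [operator_one, act_one]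
  | of_mul g C ih =>
    rw [operator_mul, operator_of, act_mul, act_of, mul_assoc, Gate.operator_mul_pauliOp,
      ← mul_assoc, ih,
      mul_assoc]

theorem pauliEntry_ne_zero_iff (a : Bool × Bool) (u v : Fin 2) :
    pauliEntry a u v ≠ 0 ↔ u = v + bif a.1 then 1 else 0 := by
  revert a u v
  decide

theorem pauliEntry_shift (a : Bool × Bool) (v : Fin 2) :
    pauliEntry a (v + bif a.1 then 1 else 0) v = boolSign (a.2 && v == 1) := by
  revert a v
  decide

theorem pauliOp_apply_shift (p : PauliString) (y : Fin n → Fin 2) :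
    pauliOp n p (fun i => y i + bif (p.2 i).1 then 1 else 0) y =
      boolSign p.1 * ∏ i : Fin n, (boolSign ((p.2 i).2 && y i == 1) : ℝ) := by
  simp only [pauliOp_apply, pauliEntry_shift]

theorem pauliOp_apply_ne_zero_iff (p : PauliString) (x y : Fin n → Fin 2) :
    pauliOp n p x y ≠ 0 ↔ x = fun i : Fin n => y i + bif (p.2 i).1 then 1 else 0 := by
  rw [pauliOp_apply, mul_ne_zero_iff, Finset.prod_ne_zero_iff, funext_iff]
  simp [boolSign_ne_zero, pauliEntry_ne_zero_iff]

theorem pauliOp_injective {p q : PauliString} (h : pauliOp n p = pauliOp n q) :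
    p.1 = q.1 ∧ ∀ i < n, p.2 i = q.2 i := by
  have shift : (fun i : Fin n => (0 : Fin 2) + bif (p.2 i).1 then 1 else 0) =
      fun i : Fin n => 0 + bif (q.2 i).1 then 1 else 0 :=
    (pauliOp_apply_ne_zero_iff q _ _).1 (h ▸ (pauliOp_apply_ne_zero_iff p _ 0).2 rfl)
  have hx (i : Fin n) : (p.2 i).1 = (q.2 i).1 := by
    have := congrFun shift i
    revert this
    generalize (p.2 i).1 = a, (q.2 i).1 = b
    revert a b
    decide
  have values (y : Fin n → Fin 2) :
      boolSign p.1 * ∏ i : Fin n, (boolSign ((p.2 i).2 && y i == 1) : ℝ) =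
        boolSign q.1 * ∏ i : Fin n, (boolSign ((q.2 i).2 && y i == 1) : ℝ) := by
    rw [← pauliOp_apply_shift p, h]
    simp only [hx]
    exact pauliOp_apply_shift q y
  have sign : p.1 = q.1 := boolSign_injective <| by
    simpa [boolSign_false] using values 0
  refine ⟨sign, fun i hi => Prod.ext (hx ⟨i, hi⟩) (boolSign_injective ?_)⟩
  have at_single := values (Pi.single ⟨i, hi⟩ 1)
  rw [sign, mul_right_inj' (Int.cast_ne_zero.2 (boolSign_ne_zero _)),
    Fintype.prod_eq_single ⟨i, hi⟩, Fintype.prod_eq_single ⟨i, hi⟩] at at_single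
  · simpa using at_single
  all_goals exact fun j hj => by simp [Pi.single_eq_of_ne hj, boolSign_false]

end Operators

/-! ### Soundness of the reduced relations -/

section Integral

variable {n : ℕ}

theorem onQubit_mulVec (i : Fin n) (M : Matrix (Fin 2) (Fin 2) ℝ) (ψ : (Fin n → Fin 2) → ℝ)
    (x : Fin n → Fin 2) :
    (onQubit i M).mulVec ψ x = M (x i) 0 * ψ (Function.update x i 0) +
      M (x i) 1 * ψ (Function.update x i 1) := by
  have inj : Function.Injective fun b : Fin 2 => Function.update x i b :=
    Function.update_injective x i
  rw [Matrix.mulVec, dotProduct, ← Finset.sum_subset (Finset.subset_univ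
    (Finset.univ.image fun b : Fin 2 => Function.update x i b)), Finset.sum_image inj.injOn,
    Fin.sum_univ_two]
  · have h : ∀ b, ∀ l, l ≠ i → x l = Function.update x i b l :=
      fun b l hl => (Function.update_of_ne hl _ _).symm
    simp only [onQubit_apply, if_pos (h _), Function.update_self]
  · intro y _ hy
    rw [onQubit_apply, if_neg, zero_mul]
    intro h
    refine hy (Finset.mem_image.2 ⟨y i, Finset.mem_univ _, ?_⟩)
    funext l
    by_cases hl : l = i
    · subst hl; simp
    · rw [Function.update_of_ne hl, h l hl]

/-- The gates as integral operators, with the Hadamard gate multiplied by `√2`, so that equations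
between circuits can be decided by computation. -/
def Gate.intAct : Gate n → ((Fin n → Fin 2) → ℤ) → (Fin n → Fin 2) → ℤ
  | .neg, ψ => fun x => -ψ x
  | .H i, ψ => fun x => ψ (Function.update x i 0) +
      (if x i = 1 then -1 else 1) * ψ (Function.update x i 1)
  | .Z i, ψ => fun x => (if x i = 1 then -1 else 1) * ψ x
  | .CZ i hi, ψ => fun x => (if x ⟨i, by omega⟩ = 1 ∧ x ⟨i + 1, hi⟩ = 1 then -1 else 1) * ψ x

/-- The number of Hadamard gates, which is the exponent of `1 / √2` split off in `Gate.intAct`. -/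
def Gate.hadamardCount : Gate n → ℕ
  | .H _ => 1
  | _ => 0

theorem Gate.operator_mulVec_intCast (g : Gate n) (ψ : (Fin n → Fin 2) → ℤ) :
    g.operator.mulVec (fun x => (ψ x : ℝ)) = fun x => (1 / √2) ^ g.hadamardCount *
      (g.intAct ψ x : ℝ) := by
  funext x
  cases g with
  | neg => simp [Gate.operator, Gate.hadamardCount, Gate.intAct, Matrix.neg_mulVec]
  | H i =>
    rw [Gate.operator, onQubit_mulVec, Gate.hadamardCount, Gate.intAct, hadamard]
    obtain h | h : x i = 0 ∨ x i = 1 := by omega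
    all_goals simp [h]
    all_goals ring
  | Z i =>
    rw [Gate.operator, onQubit_mulVec, pauliZ]
    have restore {b : Fin 2} (h : x i = b) : Function.update x i b = x :=
      h ▸ Function.update_eq_self i x
    rcases (by omega : x i = 0 ∨ x i = 1) with h | h
    · simp [Gate.hadamardCount, Gate.intAct, h, restore h]
    · simp [Gate.hadamardCount, Gate.intAct, h, restore h]
  | CZ i hi =>
    simp only [Gate.operator, Gate.hadamardCount, Gate.intAct, Matrix.mulVec_diagonal, pow_zero,
      one_mul]
    push_cast
    rfl

/-- The composite of the integral operators of the gates of a circuit. -/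
def intAct (l : List (Gate n)) (ψ : (Fin n → Fin 2) → ℤ) : (Fin n → Fin 2) → ℤ :=
  l.foldl (fun ψ g => g.intAct ψ) ψ

theorem operator_mulVec (l : List (Gate n)) (ψ : (Fin n → Fin 2) → ℤ) :
    (circ l).operator.mulVec (fun x => (ψ x : ℝ)) =
      fun x => (1 / √2) ^ (l.map Gate.hadamardCount).sum * (intAct l ψ x : ℝ) := by
  induction l generalizing ψ with
  | nil => simpa [intAct] using congrArg (fun A : Operator n => A.mulVec _) operator_one
  | cons g l ih =>
    have e : (circ (g :: l)).operator = (circ l).operator * g.operator := by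
      rw [← operator_of, ← operator_mul]; rfl
    rw [e, ← Matrix.mulVec_mulVec, Gate.operator_mulVec_intCast]
    rw [show (fun x => (1 / √2 : ℝ) ^ g.hadamardCount * (g.intAct ψ x : ℝ)) =
      ((1 / √2 : ℝ) ^ g.hadamardCount) • fun x => (g.intAct ψ x : ℝ) from rfl, Matrix.mulVec_smul,
        ih]
    funext x
    simp only [Pi.smul_apply, smul_eq_mul, List.map_cons, List.sum_cons, pow_add, mul_assoc]
    rfl

theorem operator_eq_of_intAct {l l' : List (Gate n)} (d : ℕ)
    (hd : (l.map Gate.hadamardCount).sum = (l'.map Gate.hadamardCount).sum + 2 * d)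
    (h : ∀ x y, intAct l (fun z => if z = y then 1 else 0) x =
      2 ^ d * intAct l' (fun z => if z = y then 1 else 0) x) :
    (circ l).operator = (circ l').operator := by
  ext x y
  have key : ∀ A : Operator n, A x y =
      A.mulVec (fun z => ((if z = y then 1 else 0 : ℤ) : ℝ)) x := by
    intro A
    simp [Matrix.mulVec, dotProduct]
  have h2 : (1 / √2 : ℝ) ^ (2 * d) * 2 ^ d = 1 := by
    rw [pow_mul, ← mul_pow, div_pow, Real.sq_sqrt (by norm_num)]
    norm_num
  rw [key (circ l).operator, key (circ l').operator, operator_mulVec, operator_mulVec]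
  dsimp only
  rw [h, hd, pow_add]
  push_cast
  linear_combination ((1 / √2 : ℝ) ^ (l'.map Gate.hadamardCount).sum *
    (intAct l' (fun z => if z = y then 1 else 0) x : ℝ)) * h2

/-- The integral three-qubit state whose amplitudes, in the order of the binary numbers
`000, …, 111`, are `a, …, h`. -/
def vecThree (a b c d e f g h : ℤ) (x : Fin 3 → Fin 2) : ℤ :=
  if x 0 = 0 then
    if x 1 = 0 then if x 2 = 0 then a else b else if x 2 = 0 then c else d
  else if x 1 = 0 then if x 2 = 0 then e else f else if x 2 = 0 then g else h

theorem eq_vecThree (ψ : (Fin 3 → Fin 2) → ℤ) :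
    ψ = vecThree (ψ ![0, 0, 0]) (ψ ![0, 0, 1]) (ψ ![0, 1, 0]) (ψ ![0, 1, 1])
      (ψ ![1, 0, 0]) (ψ ![1, 0, 1]) (ψ ![1, 1, 0]) (ψ ![1, 1, 1]) := by
  funext x
  have hx : x = ![x 0, x 1, x 2] := by funext i; fin_cases i <;> rfl
  rw [hx]
  generalize x 0 = x₀, x 1 = x₁, x 2 = x₂
  fin_cases x₀ <;> fin_cases x₁ <;> fin_cases x₂ <;> rfl

theorem mul_vecThree (r a b c d e f g h : ℤ) (x : Fin 3 → Fin 2) :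
    r * vecThree a b c d e f g h x =
      vecThree (r * a) (r * b) (r * c) (r * d) (r * e) (r * f) (r * g) (r * h) x := by
  simp only [vecThree, mul_ite]

theorem intAct_H₀ (a b c d e f g h : ℤ) :
    Gate.intAct (n := 3) (.H 0) (vecThree a b c d e f g h) =
      vecThree (a + e) (b + f) (c + g) (d + h) (a - e) (b - f) (c - g) (d - h) :=
  (eq_vecThree _).trans <| by simp [Gate.intAct, vecThree, Function.update, sub_eq_add_neg]

theorem intAct_H₁ (a b c d e f g h : ℤ) :
    Gate.intAct (n := 3) (.H 1) (vecThree a b c d e f g h) =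
      vecThree (a + c) (b + d) (a - c) (b - d) (e + g) (f + h) (e - g) (f - h) :=
  (eq_vecThree _).trans <| by simp [Gate.intAct, vecThree, Function.update, sub_eq_add_neg]

theorem intAct_H₂ (a b c d e f g h : ℤ) :
    Gate.intAct (n := 3) (.H 2) (vecThree a b c d e f g h) =
      vecThree (a + b) (a - b) (c + d) (c - d) (e + f) (e - f) (g + h) (g - h) :=
  (eq_vecThree _).trans <| by simp [Gate.intAct, vecThree, Function.update, sub_eq_add_neg]

theorem intAct_CZ₀ (a b c d e f g h : ℤ) :
    Gate.intAct (n := 3) (.CZ 0) (vecThree a b c d e f g h) =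
      vecThree a b c d e f (-g) (-h) :=
  (eq_vecThree _).trans <| by simp [Gate.intAct, vecThree]

theorem intAct_CZ₁ (a b c d e f g h : ℤ) :
    Gate.intAct (n := 3) (.CZ 1) (vecThree a b c d e f g h) =
      vecThree a b c (-d) e f g (-h) :=
  (eq_vecThree _).trans <| by simp [Gate.intAct, vecThree]

theorem operator_eq_of_intAct_vecThree {l l' : List (Gate 3)} (m : ℕ)
    (hm : (l.map Gate.hadamardCount).sum = (l'.map Gate.hadamardCount).sum + 2 * m)
    (h : ∀ a b c d e f g h x, intAct l (vecThree a b c d e f g h) x =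
      2 ^ m * intAct l' (vecThree a b c d e f g h) x) :
    (circ l).operator = (circ l').operator :=
  operator_eq_of_intAct m hm fun x y => by
    rw [eq_vecThree fun z => if z = y then 1 else 0, h]

theorem ReducedRel.operator_eq {m : ℕ} {u v : Circuit m} (h : ReducedRel m u v) :
    u.operator = v.operator := by
  cases h with
  | R1 | R2 | R5 | R6 | R7 | R8 | R9 | R10 | R11 | R12 =>
    exact operator_eq_of_intAct 0 rfl (by decide +kernel)
  | R3 => exact operator_eq_of_intAct 1 rfl (by decide +kernel)
  | R4 => exact operator_eq_of_intAct 2 rfl (by decide +kernel)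
  | R13 | R14 =>
    refine operator_eq_of_intAct_vecThree 0 rfl fun a b c d e f g h x => ?_
    simp only [intAct, List.foldl, intAct_H₀, intAct_H₁, intAct_H₂, intAct_CZ₀, intAct_CZ₁,
      mul_vecThree]
    congr 1 <;> ring
  | R15 | R16 =>
    refine operator_eq_of_intAct_vecThree 2 rfl fun a b c d e f g h x => ?_
    simp only [intAct, List.foldl, intAct_H₀, intAct_H₁, intAct_H₂, intAct_CZ₀, intAct_CZ₁,
      mul_vecThree]
    congr 1 <;> ring

end Integral

/-! ### Operators on a block of wires -/

section Embed

variable {m n : ℕ}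

/-- Split a basis state into its part on the wires `k, …, k + m - 1` and the rest. -/
def splitState (k : ℕ) (h : k + m ≤ n) : (Fin n → Fin 2) ≃
    (Fin m → Fin 2) × ({i : Fin n // ¬ (k ≤ (i : ℕ) ∧ (i : ℕ) < k + m)} → Fin 2) where
  toFun x := (fun i => x ⟨k + i, by omega⟩, fun j => x j)
  invFun u := fun i => if hi : k ≤ (i : ℕ) ∧ (i : ℕ) < k + m then u.1 ⟨i - k, by omega⟩
    else u.2 ⟨i, hi⟩
  left_inv x := by
    funext i
    dsimp only
    split_ifs with hi
    · congr 1
      ext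
      simp only
      omega
    · rfl
  right_inv u := by
    refine Prod.ext (funext fun i => ?_) (funext fun j => ?_)
    · dsimp only
      rw [dif_pos ⟨by omega, by omega⟩]
      simp
    · dsimp only
      rw [dif_neg j.2]

/-- The operator `A` on the wires `k, …, k + m - 1`. -/
def embed (k : ℕ) (h : k + m ≤ n) (A : Operator m) : Operator n :=
  (Matrix.kroneckerMap (· * ·) A 1).submatrix (splitState k h) (splitState k h)

theorem embed_apply (k : ℕ) (h : k + m ≤ n) (A : Operator m) (x y : Fin n → Fin 2) :
    embed k h A x y = if ∀ i : Fin n, ¬ (k ≤ (i : ℕ) ∧ (i : ℕ) < k + m) → x i = y i then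
      A (fun i => x ⟨k + i, by omega⟩) (fun i => y ⟨k + i, by omega⟩) else 0 := by
  change A (splitState k h x).1 (splitState k h y).1 *
    (1 : Matrix _ _ ℝ) (splitState k h x).2 (splitState k h y).2 = _
  rw [Matrix.one_apply]
  have : (splitState k h x).2 = (splitState k h y).2 ↔
      ∀ i : Fin n, ¬ (k ≤ (i : ℕ) ∧ (i : ℕ) < k + m) → x i = y i := by
    rw [funext_iff]
    exact ⟨fun H i hi => H ⟨i, hi⟩, fun H j => H j j.2⟩
  simp only [this, mul_ite, mul_one, mul_zero]
  rfl

theorem embed_mul (k : ℕ) (h : k + m ≤ n) (A B : Operator m) :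
    embed k h (A * B) = embed k h A * embed k h B := by
  rw [embed, embed, embed, Matrix.submatrix_mul_equiv]
  congr 1
  rw [← Matrix.mul_kronecker_mul, one_mul]

theorem embed_one (k : ℕ) (h : k + m ≤ n) : embed k h (1 : Operator m) = 1 := by
  rw [embed, Matrix.kroneckerMap_one_one _ (by simp) (by simp) (by simp),
    Matrix.submatrix_one_equiv]

theorem embed_injective (k : ℕ) (h : k + m ≤ n) :
    Function.Injective (embed k h : Operator m → Operator n) := by
  intro A B hAB
  ext u v
  have := congrFun (congrFun hAB ((splitState k h).symm (u, fun _ => 0)))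
    ((splitState k h).symm (v, fun _ => 0))
  simpa [embed, Matrix.submatrix_apply, Matrix.kronecker_apply] using this

theorem embed_transpose (k : ℕ) (h : k + m ≤ n) (A : Operator m) :
    (embed k h A).transpose = embed k h A.transpose := by
  ext x y
  simp only [Matrix.transpose_apply, embed_apply, eq_comm]

theorem embed_onQubit (k : ℕ) (h : k + m ≤ n) (i : Fin m) (M : Matrix (Fin 2) (Fin 2) ℝ) :
    embed k h (onQubit i M) = onQubit ⟨k + i, by omega⟩ M := by
  ext x y
  rw [embed_apply, onQubit_apply, onQubit_apply, ← ite_and]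
  refine if_congr ⟨fun H l hl => ?_, fun H => ⟨fun l hl => H l ?_, fun l hl => H _ ?_⟩⟩ rfl rfl
  · by_cases hb : k ≤ (l : ℕ) ∧ (l : ℕ) < k + m
    · have := H.2 ⟨l - k, by omega⟩ (by
        intro e
        apply hl
        rw [← e]
        ext
        simp only
        omega)
      have e : (⟨k + (l - k), by omega⟩ : Fin n) = l := by
        ext
        simp only
        omega
      simpa only [e] using this
    · exact H.1 l hb
  · rintro rfl
    exact hl ⟨by simp, by simp⟩
  · intro e
    apply hl
    ext
    simpa using congrArg Fin.val e

theorem Gate.operator_place (k : ℕ) (h : k + m ≤ n) (g : Gate m) :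
    (g.place k h).operator = embed k h g.operator := by
  cases g with
  | neg =>
    rw [Gate.place, Gate.operator, Gate.operator, ← embed_one k h]
    ext x y
    simp only [Matrix.neg_apply, embed_apply]
    split_ifs <;> simp
  | H i => exact (embed_onQubit k h i _).symm
  | Z i => exact (embed_onQubit k h i _).symm
  | CZ i hi =>
    ext x y
    rw [embed_apply]
    simp only [Gate.place, Gate.operator, Matrix.diagonal_apply]
    by_cases hxy : x = y
    · subst hxy
      simp [add_assoc]
    · rw [if_neg hxy]
      split_ifs with h_off h_on
      any_goals rfl
      all_goals exact absurd ((splitState k h).injective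
        (Prod.ext h_on (funext fun j => h_off j j.2))) hxy

theorem operator_place (k : ℕ) (h : k + m ≤ n) (C : Circuit m) :
    (C.place k h).operator = embed k h C.operator := by
  induction C using FreeMonoid.inductionOn' with
  | one => rw [map_one, operator_one, operator_one, embed_one]
  | of_mul g C ih =>
    rw [map_mul, operator_mul, operator_mul, embed_mul, ih, operator_of,
      ← Gate.operator_place k h, ← operator_of]
    rfl

end Embed

/-! ### Soundness -/

section Soundness

variable {n : ℕ}

theorem commute_onQubit {i j : Fin n} (hij : i ≠ j) (M N : Matrix (Fin 2) (Fin 2) ℝ) :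
    Commute (onQubit i M) (onQubit j N) := by
  rw [commute_iff_eq, onQubit, onQubit, tensor_mul, tensor_mul]
  congr 1
  funext l
  by_cases h : l = i
  · subst h; simp [hij]
  · simp [h]

theorem commute_onQubit_cz {i : Fin n} {j : ℕ} (hj : j + 1 < n) (h : (i : ℕ) ≠ j)
    (h' : (i : ℕ) ≠ j + 1) (M : Matrix (Fin 2) (Fin 2) ℝ) :
    Commute (onQubit i M) (Gate.CZ j hj).operator := by
  rw [commute_iff_eq]
  ext x y
  rw [Gate.operator, Matrix.diagonal_mul, Matrix.mul_diagonal, onQubit_apply]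
  by_cases hxy : ∀ l, l ≠ i → x l = y l
  · rw [hxy ⟨j, _⟩ fun e => h (congrArg Fin.val e).symm,
      hxy ⟨j + 1, hj⟩ fun e => h' (congrArg Fin.val e).symm, mul_comm]
  · rw [if_neg hxy, zero_mul, mul_zero]

theorem commute_operator_of_disjoint {g g' : Gate n} (h : Disjoint g.wires g'.wires) :
    Commute g.operator g'.operator := by
  cases g with
  | neg => exact Commute.neg_one_left _
  | H i | Z i =>
    cases g' with
    | neg => exact Commute.neg_one_right _
    | H j | Z j => exact commute_onQubit (by simpa [Gate.wires, Fin.ext_iff] using h) _ _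
    | CZ j hj =>
      simp only [Gate.wires, Set.disjoint_singleton_left, Set.mem_insert_iff,
        Set.mem_singleton_iff, not_or] at h
      exact commute_onQubit_cz hj h.1 h.2 _
  | CZ i hi =>
    cases g' with
    | neg => exact Commute.neg_one_right _
    | H j | Z j =>
      simp only [Gate.wires, Set.disjoint_singleton_right, Set.mem_insert_iff,
        Set.mem_singleton_iff, not_or] at h
      exact (commute_onQubit_cz hi h.1 h.2 _).symm
    | CZ j hj =>
      rw [commute_iff_eq, Gate.operator, Gate.operator, Matrix.diagonal_mul_diagonal,
        Matrix.diagonal_mul_diagonal]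
      simp only [mul_comm]

theorem CircuitRel.operator_eq {C D : Circuit n} (h : CircuitRel n C D) :
    C.operator = D.operator := by
  cases h with
  | reduced huv k h => rw [operator_place, operator_place, ReducedRel.operator_eq huv]
  | slide g g' hd =>
    have : ∀ a b : Gate n, (circ [a, b]).operator = b.operator * a.operator := by
      intro a b
      rw [← operator_of, ← operator_of, ← operator_mul]
      rfl
    rw [this, this, (commute_operator_of_disjoint hd).eq]

theorem operator_eq_of_cls_eq {C D : Circuit n} (h : cls C = cls D) :
    C.operator = D.operator := by
  have hle : conGen (CircuitRel n) ≤
      Con.ker (FreeMonoid.lift fun g : Gate n => MulOpposite.op g.operator) :=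
    Con.conGen_le.2 fun C D h => MulOpposite.unop_injective (CircuitRel.operator_eq h)
  have := hle (cls_eq_iff.1 h)
  exact congrArg MulOpposite.unop this

theorem Gate.act_of_le (g : Gate n) (p : PauliString) {i : ℕ} (hi : n ≤ i) :
    (g.act p).2 i = p.2 i := by
  cases g with
  | neg => rfl
  | H j => exact Function.update_of_ne (by omega) _ _
  | Z j => rfl
  | CZ j hj =>
    exact (Function.update_of_ne (by omega) _ _).trans (Function.update_of_ne (by omega) _ _)

theorem act_of_le (C : Circuit n) (p : PauliString) {i : ℕ} (hi : n ≤ i) :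
    (C.act p).2 i = p.2 i := by
  induction C using FreeMonoid.inductionOn' generalizing p with
  | one => rfl
  | of_mul g C ih => rw [act_mul, ih, act_of, Gate.act_of_le g p hi]

theorem isUnit_operator (C : Circuit n) : IsUnit C.operator :=
  .of_mul_eq_one _ (operator_mul_transpose C)

theorem act_eq_of_operator_eq {C D : Circuit n} (h : C.operator = D.operator)
    (p : PauliString) : C.act p = D.act p := by
  have e : pauliOp n (C.act p) = pauliOp n (D.act p) := by
    refine (isUnit_operator C).mul_right_cancel ?_
    rw [← operator_mul_pauliOp, h, operator_mul_pauliOp]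
  obtain ⟨h1, h2⟩ := pauliOp_injective e
  refine Prod.ext h1 (funext fun i => ?_)
  by_cases hi : i < n
  · exact h2 i hi
  · rw [act_of_le C p (not_lt.1 hi), act_of_le D p (not_lt.1 hi)]

theorem act_eq_of_cls_eq {C D : Circuit n} (h : cls C = cls D) (p : PauliString) :
    C.act p = D.act p :=
  act_eq_of_operator_eq (operator_eq_of_cls_eq h) p

theorem Gate.act_act (g : Gate n) (p : PauliString) : g.act (g.act p) = p := by
  have := act_eq_of_cls_eq (C := FreeMonoid.of g * FreeMonoid.of g) (D := 1)
    (by rw [cls_mul, cls_of_mul_self, cls_one]) p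
  rwa [act_mul, act_one, act_of, act_of] at this

theorem act_injective (C : Circuit n) : Function.Injective C.act := by
  induction C using FreeMonoid.inductionOn' with
  | one => exact fun p q h => h
  | of_mul g C ih =>
    intro p q h
    rw [act_mul, act_mul, act_of, act_of] at h
    have := congrArg g.act (ih h)
    rwa [Gate.act_act, Gate.act_act] at this

theorem act_surjective (C : Circuit n) : Function.Surjective C.act := by
  induction C using FreeMonoid.inductionOn' with
  | one => exact fun p => ⟨p, rfl⟩
  | of_mul g C ih =>
    intro p
    obtain ⟨q, rfl⟩ := ih p
    exact ⟨g.act q, by rw [act_mul, act_of, Gate.act_act]⟩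

end Soundness

/-! ### The action of circuits on a block of wires -/

section Block

variable {m n : ℕ}

theorem Gate.act_place (k : ℕ) (h : k + m ≤ n) (g : Gate m) (p : PauliString) :
    (g.place k h).act p =
      ((g.act (p.1, fun i => p.2 (k + i))).1,
        fun i => if i < k then p.2 i else (g.act (p.1, fun i => p.2 (k + i))).2 (i - k)) := by
  have update_shift (f : ℕ → Bool × Bool) (j : ℕ) (a : Bool × Bool) :
      Function.update f (k + j) a = fun i =>
        if i < k then f i else Function.update (fun i => f (k + i)) j a (i - k) := by
    funext i
    simp only [Function.update_apply]
    split_ifs with h1 h2 h3 <;> first | omega | rfl | (congr 1; omega)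
  have eq_shift (f : ℕ → Bool × Bool) : f = fun i => if i < k then f i else f (k + (i - k)) := by
    funext i
    split_ifs <;> first | rfl | (congr 1; omega)
  cases g with
  | neg => exact Prod.ext rfl (eq_shift _)
  | H i => exact Prod.ext rfl (update_shift _ _ _)
  | Z i => exact Prod.ext rfl (eq_shift _)
  | CZ i hi =>
    refine Prod.ext rfl ?_
    simp only [Gate.place, Gate.act]
    rw [show k + i + 1 = k + (i + 1) by ring]
    funext j
    simp only [Function.update_apply]
    split_ifs <;> first | omega | rfl | exact congrArg p.2 (by omega)

theorem act_place_of (k : ℕ) (h : k + m ≤ n) (g : Gate m) (p : PauliString) :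
    (Circuit.place k h (FreeMonoid.of g)).act p = (g.place k h).act p :=
  rfl

theorem act_place (k : ℕ) (h : k + m ≤ n) (C : Circuit m) (p : PauliString) :
    (C.place k h).act p =
      ((C.act (p.1, fun i => p.2 (k + i))).1,
        fun i => if i < k then p.2 i else (C.act (p.1, fun i => p.2 (k + i))).2 (i - k)) := by
  induction C using FreeMonoid.inductionOn' generalizing p with
  | one =>
    refine Prod.ext rfl (funext fun i => ?_)
    simp only [map_one, act_one]
    split_ifs <;> first | rfl | exact congrArg p.2 (by omega)
  | of_mul g C ih =>
    rw [map_mul, act_mul, act_mul, act_of, ih, act_place_of, Gate.act_place]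
    dsimp only
    simp only [show ∀ i, ¬ (k + i < k) from fun i => by omega, if_false, Nat.add_sub_cancel_left]
    refine Prod.ext rfl (funext fun i => ?_)
    dsimp only
    split_ifs <;> rfl

/-- The action of a gate on one wire on a sign `s` and the letter `(x, z)`, standing for `XˣZᶻ`, of
that wire. -/
def Gate.actOne : Gate 1 → Bool × Bool × Bool → Bool × Bool × Bool
  | .H _, (s, x, z) => (xor s (x && z), z, x)
  | .Z _, (s, x, z) => (xor s x, x, z)
  | _, p => p

/-- The action of a circuit on one wire on a sign and the letter of that wire. -/
def Circuit.actOne (C : Circuit 1) (p : Bool × Bool × Bool) : Bool × Bool × Bool :=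
  C.toList.foldl (fun p g => g.actOne p) p

/-- The action of a gate on two wires on a sign and the letters of these wires. -/
def Gate.actTwo : Gate 2 → Bool × (Bool × Bool) × (Bool × Bool) →
    Bool × (Bool × Bool) × (Bool × Bool)
  | .neg, p => p
  | .H i, (s, a, b) => if i = 0 then (xor s (a.1 && a.2), (a.2, a.1), b)
      else (xor s (b.1 && b.2), a, (b.2, b.1))
  | .Z i, (s, a, b) => if i = 0 then (xor s a.1, a, b) else (xor s b.1, a, b)
  | .CZ _ _, (s, a, b) => (xor s (a.1 && b.1), (a.1, xor a.2 b.1), (b.1, xor b.2 a.1))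

/-- The action of a circuit on two wires on a sign and the letters of these wires. -/
def Circuit.actTwo (C : Circuit 2) (p : Bool × (Bool × Bool) × (Bool × Bool)) :
    Bool × (Bool × Bool) × (Bool × Bool) :=
  C.toList.foldl (fun p g => g.actTwo p) p

theorem Gate.act_place_one (k : ℕ) (h : k + 1 ≤ n) (g : Gate 1) (p : PauliString) :
    (g.place k h).act p =
      ((g.actOne (p.1, p.2 k)).1, Function.update p.2 k (g.actOne (p.1, p.2 k)).2) := by
  cases g with
  | neg => exact Prod.ext rfl (Function.update_eq_self _ _).symm
  | H i =>
    obtain rfl : i = 0 := Subsingleton.elim _ _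
    rfl
  | Z i =>
    obtain rfl : i = 0 := Subsingleton.elim _ _
    exact Prod.ext rfl (Function.update_eq_self _ _).symm
  | CZ i hi => omega

theorem act_place_one (k : ℕ) (h : k + 1 ≤ n) (C : Circuit 1) (p : PauliString) :
    (C.place k h).act p =
      ((C.actOne (p.1, p.2 k)).1, Function.update p.2 k (C.actOne (p.1, p.2 k)).2) := by
  induction C using FreeMonoid.inductionOn' generalizing p with
  | one => exact Prod.ext rfl (Function.update_eq_self _ _).symm
  | of_mul g C ih =>
    rw [map_mul, act_mul, ih, act_place_of, Gate.act_place_one]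
    simp only [Function.update_self, Function.update_idem]
    rfl

theorem update_eq_self_two (f : ℕ → Bool × Bool) (k : ℕ) :
    Function.update (Function.update f k (f k)) (k + 1) (f (k + 1)) = f := by
  rw [Function.update_eq_self, Function.update_eq_self]

theorem update_idem_two {f : ℕ → Bool × Bool} {k : ℕ} {a b a' b' : Bool × Bool} :
    Function.update (Function.update (Function.update (Function.update f k a) (k + 1) b) k a')
      (k + 1) b' = Function.update (Function.update f k a') (k + 1) b' := by
  funext i
  simp only [Function.update_apply]
  split_ifs <;> rfl

theorem Gate.act_place_two (k : ℕ) (h : k + 2 ≤ n) (g : Gate 2) (p : PauliString) :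
    (g.place k h).act p = ((g.actTwo (p.1, p.2 k, p.2 (k + 1))).1,
      Function.update (Function.update p.2 k (g.actTwo (p.1, p.2 k, p.2 (k + 1))).2.1)
        (k + 1) (g.actTwo (p.1, p.2 k, p.2 (k + 1))).2.2) := by
  cases g with
  | neg => exact Prod.ext rfl (update_eq_self_two _ _).symm
  | H i =>
    refine Fin.cases ?_ (fun i => ?_) i
    · exact Prod.ext rfl (by simp [Gate.place, Gate.act, Gate.actTwo])
    · obtain rfl : i = 0 := Subsingleton.elim _ _
      exact Prod.ext rfl (by simp [Gate.place, Gate.act, Gate.actTwo])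
  | Z i =>
    refine Fin.cases ?_ (fun i => ?_) i
    · exact Prod.ext rfl (update_eq_self_two _ _).symm
    · obtain rfl : i = 0 := Subsingleton.elim _ _
      exact Prod.ext rfl (update_eq_self_two _ _).symm
  | CZ i hi =>
    obtain rfl : i = 0 := by omega
    rfl

theorem act_place_two (k : ℕ) (h : k + 2 ≤ n) (C : Circuit 2) (p : PauliString) :
    (C.place k h).act p = ((C.actTwo (p.1, p.2 k, p.2 (k + 1))).1,
      Function.update (Function.update p.2 k (C.actTwo (p.1, p.2 k, p.2 (k + 1))).2.1)
        (k + 1) (C.actTwo (p.1, p.2 k, p.2 (k + 1))).2.2) := by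
  induction C using FreeMonoid.inductionOn' generalizing p with
  | one => exact Prod.ext rfl (update_eq_self_two _ _).symm
  | of_mul g C ih =>
    rw [map_mul, act_mul, ih, act_place_of, Gate.act_place_two]
    simp only [Function.update_self, Function.update_of_ne (show k ≠ k + 1 by omega),
      update_idem_two]
    rfl

end Block

/-! ### Reducing a Pauli string to one letter -/

/-- The letter carried by a wire of the given type when a `Z`-circuit is applied to the Pauli string
that it reduces to `Z₀`: `Z` on single wires, `XZ` on double wires. -/
def WireType.letter : WireType → Bool × Bool
  | .single => (false, true)
  | .double => (true, true)

theorem exists_AGate {a : Bool × Bool} (h : a ≠ (false, false)) :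
    ∃ (t : WireType) (g : AGate t), ∀ s, g.circuit.actOne (s, a) = (s, t.letter) := by
  obtain ⟨x, z⟩ := a
  cases x <;> cases z
  · exact absurd rfl h
  · exact ⟨.single, .A1, by decide⟩
  · exact ⟨.single, .A2, by decide⟩
  · exact ⟨.double, .A3, by decide⟩

theorem exists_BGate (t : WireType) (a : Bool × Bool) :
    ∃ (t' : WireType) (b : BGate t t'), ∀ s,
      b.circuit.actTwo (s, a, t.letter) = (s, t'.letter, (false, false)) := by
  obtain ⟨x, z⟩ := a
  cases t <;> cases x <;> cases z
  · exact ⟨_, .B1, by decide⟩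
  · exact ⟨_, .B3, by decide⟩
  · exact ⟨_, .B2, by decide⟩
  · exact ⟨_, .B4, by decide⟩
  · exact ⟨_, .B5, by decide⟩
  · exact ⟨_, .B7, by decide⟩
  · exact ⟨_, .B6, by decide⟩
  · exact ⟨_, .B8, by decide⟩

theorem exists_ladder {n k : ℕ} (hk : k < n) (t : WireType) (p : PauliString)
    (hp : p.2 k = t.letter) :
    ∃ (t' : WireType) (C : Circuit n),
      ((C.act p).1 = p.1 ∧ (C.act p).2 0 = t'.letter ∧
        (∀ i, 0 < i → i ≤ k → (C.act p).2 i = (false, false)) ∧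
        ∀ i, k < i → (C.act p).2 i = p.2 i) ∧
      (t' = .single → ∃ r : BLadder k t, r.circuit hk = C) := by
  induction k generalizing t p with
  | zero =>
    refine ⟨t, 1, ⟨rfl, hp, fun i h h' => by omega, fun i _ => rfl⟩, ?_⟩
    rintro rfl
    exact ⟨.nil, rfl⟩
  | succ k ih =>
    obtain ⟨t₁, b, hb⟩ := exists_BGate t (p.2 k)
    have e := act_place_two k (show k + 2 ≤ n from hk) b.circuit p
    rw [hp, hb] at e
    dsimp only at e
    obtain ⟨t', C, ⟨h1, h2, h3, h4⟩, h5⟩ := ih (by omega) t₁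
      ((Circuit.place k (show k + 2 ≤ n from hk) b.circuit).act p) (by rw [e]; simp)
    refine ⟨t', Circuit.place k (show k + 2 ≤ n from hk) b.circuit * C, ?_, ?_⟩
    · rw [act_mul]
      refine ⟨h1.trans (by rw [e]), h2, fun i hi hik => ?_, fun i hi => ?_⟩
      · by_cases hik' : i ≤ k
        · exact h3 i hi hik'
        · obtain rfl : i = k + 1 := by omega
          rw [h4 _ (by omega), e]
          simp
      · rw [h4 _ (by omega), e]
        dsimp only
        rw [Function.update_of_ne (by omega), Function.update_of_ne (by omega)]
    · intro ht
      obtain ⟨r, rfl⟩ := h5 ht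
      exact ⟨.cons b r, rfl⟩

theorem exists_CGate (s : Bool) (t : WireType) :
    ∃ c : CGate, c.circuit.actOne (s, t.letter) = (false, t.letter) := by
  cases s
  · exact ⟨.C1, by cases t <;> decide⟩
  · exact ⟨.C2, by cases t <;> decide⟩

theorem exists_last_nontrivial {n : ℕ} {f : ℕ → Bool × Bool} (hf : ∃ i < n, f i ≠ (false, false)) :
    ∃ k < n, f k ≠ (false, false) ∧ ∀ i, k < i → i < n → f i = (false, false) := by
  classical
  obtain ⟨i, hi, hi0⟩ := hf
  have hne : ((Finset.range n).filter fun i => f i ≠ (false, false)).Nonempty :=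
    ⟨i, by simp [hi, hi0]⟩
  obtain ⟨hk1, hk2⟩ := Finset.mem_filter.1 (Finset.max'_mem _ hne)
  refine ⟨_, Finset.mem_range.1 hk1, hk2, fun i h1 h2 => ?_⟩
  by_contra h3
  exact h1.not_ge (Finset.le_max' _ _ (Finset.mem_filter.2 ⟨Finset.mem_range.2 h2, h3⟩))

theorem exists_reduction {n : ℕ} (p : PauliString) (hp : ∃ i < n, p.2 i ≠ (false, false)) :
    ∃ (t : WireType) (C : Circuit n),
      ((C.act p).1 = false ∧ (C.act p).2 0 = t.letter ∧
        (∀ i, 0 < i → i < n → (C.act p).2 i = (false, false))) ∧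
      (t = .single → ∃ L : ZCircuit n, L.circuit = C) := by
  obtain ⟨k, hk, hk0, hmax⟩ := exists_last_nontrivial hp
  obtain ⟨t, a, ha⟩ := exists_AGate hk0
  have eA := act_place_one k (show k + 1 ≤ n from hk) a.circuit p
  rw [ha] at eA
  dsimp only at eA
  obtain ⟨t', C, ⟨h1, h2, h3, h4⟩, h5⟩ := exists_ladder hk t
    ((Circuit.place k (show k + 1 ≤ n from hk) a.circuit).act p) (by rw [eA]; simp)
  obtain ⟨c, hc⟩ := exists_CGate p.1 t'
  have h0 : 0 + 1 ≤ n := by omega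
  have e : (Circuit.place k (show k + 1 ≤ n from hk) a.circuit * C *
      Circuit.place 0 h0 c.circuit).act p = (false, Function.update
        (C.act ((Circuit.place k (show k + 1 ≤ n from hk) a.circuit).act p)).2 0 t'.letter) := by
    rw [act_mul, act_mul, act_place_one, h1, h2, eA]
    dsimp only
    rw [hc]
  refine ⟨t', _, ⟨by rw [e], by rw [e]; simp, fun i hi hin => ?_⟩, ?_⟩
  · rw [e]
    dsimp only
    rw [Function.update_of_ne (by omega)]
    by_cases hik : i ≤ k
    · exact h3 i hi hik
    · rw [h4 i (by omega), eA]
      dsimp only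
      rw [Function.update_of_ne (by omega), hmax i (by omega) hin]
  · intro ht
    obtain ⟨r, rfl⟩ := h5 ht
    exact ⟨⟨⟨k, hk⟩, t, a, r, c⟩, rfl⟩

/-! ### The action of the presented group on Pauli strings -/

section Action

variable {n : ℕ}

/-- The action of the presented group on signed Pauli strings. As circuits are read from left to
right, it is a right action. -/
noncomputable def pauliAct (x : CircuitGroup n) (p : PauliString) : PauliString :=
  Circuit.act (Function.surjInv PresentedMonoid.surjective_mk x) p

theorem pauliAct_cls (C : Circuit n) (p : PauliString) : pauliAct (cls C) p = C.act p :=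
  act_eq_of_cls_eq (Function.surjInv_eq PresentedMonoid.surjective_mk (cls C)) p

theorem exists_cls (x : CircuitGroup n) : ∃ C : Circuit n, cls C = x :=
  PresentedMonoid.surjective_mk x

theorem pauliAct_mul (x y : CircuitGroup n) (p : PauliString) :
    pauliAct (x * y) p = pauliAct y (pauliAct x p) := by
  obtain ⟨C, rfl⟩ := exists_cls x
  obtain ⟨D, rfl⟩ := exists_cls y
  rw [← cls_mul, pauliAct_cls, pauliAct_cls, pauliAct_cls, act_mul]

theorem pauliAct_one (p : PauliString) : pauliAct (1 : CircuitGroup n) p = p := by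
  rw [← cls_one, pauliAct_cls, act_one]

theorem pauliAct_injective (x : CircuitGroup n) : Function.Injective (pauliAct x) := by
  obtain ⟨C, rfl⟩ := exists_cls x
  intro p q h
  rw [pauliAct_cls, pauliAct_cls] at h
  exact act_injective C h

theorem pauliAct_genZ {i : ℕ} (hi : i < n) (p : PauliString) :
    pauliAct (genZ n i) p = (xor p.1 (p.2 i).1, p.2) := by
  rw [show genZ n i = cls (FreeMonoid.of (.Z ⟨i, hi⟩)) from (cls_of_Z ⟨i, hi⟩).symm, pauliAct_cls]
  rfl

theorem pauliAct_genH {i : ℕ} (hi : i < n) (p : PauliString) :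
    pauliAct (genH n i) p = (xor p.1 ((p.2 i).1 && (p.2 i).2),
      Function.update p.2 i ((p.2 i).2, (p.2 i).1)) := by
  rw [show genH n i = cls (FreeMonoid.of (.H ⟨i, hi⟩)) from (cls_of_H ⟨i, hi⟩).symm, pauliAct_cls]
  rfl

theorem pauliAct_genCZ {i : ℕ} (hi : i + 1 < n) (p : PauliString) :
    pauliAct (genCZ n i) p = (xor p.1 ((p.2 i).1 && (p.2 (i + 1)).1),
        Function.update (Function.update p.2 i ((p.2 i).1, xor (p.2 i).2 (p.2 (i + 1)).1))
          (i + 1) ((p.2 (i + 1)).1, xor (p.2 (i + 1)).2 (p.2 i).1)) := by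
  rw [← cls_of_CZ hi, pauliAct_cls]
  rfl

open Gate in
theorem pauliAct_swapGate {i : ℕ} (hi : i + 1 < n) (p : PauliString) :
    pauliAct (swapGate n i) p =
      (p.1, Function.update (Function.update p.2 i (p.2 (i + 1))) (i + 1) (p.2 i)) := by
  have e : swapGate n i = cls (Circuit.place i (show i + 2 ≤ n from hi)
      (circ [CZ 0, H 0, H 1, CZ 0, H 0, H 1, CZ 0, H 0, H 1])) := by
    rw [cls_place_circ]
    simp [Gate.place, cls_of_H, cls_of_CZ, swapGate, swapWord, mul_assoc]
  have key : ∀ s a b, Circuit.actTwo (circ [CZ 0, H 0, H 1, CZ 0, H 0, H 1, CZ 0, H 0, H 1])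
      (s, a, b) = (s, b, a) := by decide
  rw [e, pauliAct_cls, act_place_two, key]

theorem pauliAct_farCZ {i j : ℕ} (h : i + j + 1 < n) (p : PauliString) :
    (pauliAct (farCZ n i j) p).2 =
      Function.update (Function.update p.2 i ((p.2 i).1, xor (p.2 i).2 (p.2 (i + j + 1)).1))
        (i + j + 1) ((p.2 (i + j + 1)).1, xor (p.2 (i + j + 1)).2 (p.2 i).1) := by
  induction j generalizing i p with
  | zero => rw [farCZ, pauliAct_genCZ h]
  | succ j ih =>
    rw [farCZ, pauliAct_mul, pauliAct_mul, pauliAct_swapGate (by omega), ih (by omega),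
      pauliAct_swapGate (by omega)]
    funext l
    have e : i + (j + 1) + 1 = i + 1 + j + 1 := by ring
    simp only [Function.update_apply, e, if_true, if_false, show i ≠ i + 1 by omega,
      show i ≠ i + 1 + j + 1 by omega, show i + 1 + j + 1 ≠ i by omega,
      show i + 1 ≠ i + 1 + j + 1 by omega, show i + 1 + j + 1 ≠ i + 1 by omega]
    split_ifs <;> first | rfl | omega | simp_all

theorem pauliAct_bpow_farCZ {j : ℕ} (h : j + 1 < n) (b : Bool) (p : PauliString)
    (hp : (p.2 0).1 = true) :
    ((pauliAct (bpow (farCZ n 0 j) b) p).2 0).1 = true ∧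
      (pauliAct (bpow (farCZ n 0 j) b) p).2 (j + 1) = ((p.2 (j + 1)).1, xor (p.2 (j + 1)).2 b) ∧
      ∀ l, l ≠ 0 → l ≠ j + 1 → (pauliAct (bpow (farCZ n 0 j) b) p).2 l = p.2 l := by
  cases b
  · simp [pauliAct_one, hp]
  · rw [bpow_true, pauliAct_farCZ (by omega)]
    simp only [zero_add]
    refine ⟨?_, ?_, fun l h0 hl => ?_⟩
    · rw [Function.update_of_ne (by omega), Function.update_self, hp]
    · rw [Function.update_self, hp]
    · rw [Function.update_of_ne hl, Function.update_of_ne h0]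

theorem pauliAct_bpow_farCX {j : ℕ} (h : j + 1 < n) (b : Bool) (p : PauliString)
    (hp : (p.2 0).1 = true) :
    ((pauliAct (bpow (farCX n 0 j) b) p).2 0).1 = true ∧
      (pauliAct (bpow (farCX n 0 j) b) p).2 (j + 1) = (xor (p.2 (j + 1)).1 b, (p.2 (j + 1)).2) ∧
      ∀ l, l ≠ 0 → l ≠ j + 1 → (pauliAct (bpow (farCX n 0 j) b) p).2 l = p.2 l := by
  cases b
  · simp [pauliAct_one, hp]
  · rw [bpow_true, farCX, pauliAct_mul, pauliAct_mul]
    simp only [zero_add]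
    obtain ⟨h1, h2, h3⟩ := pauliAct_bpow_farCZ h true (pauliAct (genH n (j + 1)) p) (by
      rw [pauliAct_genH h]; dsimp only; rw [Function.update_of_ne (by omega), hp])
    rw [bpow_true] at h1 h2 h3
    rw [pauliAct_genH h]
    dsimp only
    refine ⟨?_, ?_, fun l h0 hl => ?_⟩
    · rw [Function.update_of_ne (by omega), h1]
    · rw [Function.update_self, h2, pauliAct_genH h]
      simp
    · rw [Function.update_of_ne hl, h3 l h0 hl, pauliAct_genH h]
      exact Function.update_of_ne hl _ _

theorem pauliAct_ctlLetter {j : ℕ} (h : j + 1 < n) (a : Bool × Bool) (p : PauliString)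
    (hp : (p.2 0).1 = true) :
    ((pauliAct (ctlLetter n 0 j a) p).2 0).1 = true ∧
      (pauliAct (ctlLetter n 0 j a) p).2 (j + 1) =
        (xor (p.2 (j + 1)).1 a.1, xor (p.2 (j + 1)).2 a.2) ∧
      ∀ l, l ≠ 0 → l ≠ j + 1 → (pauliAct (ctlLetter n 0 j a) p).2 l = p.2 l := by
  obtain ⟨h1, h2, h3⟩ := pauliAct_bpow_farCZ h a.2 p hp
  obtain ⟨g1, g2, g3⟩ := pauliAct_bpow_farCX h a.1 _ h1
  rw [ctlLetter, pauliAct_mul]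
  exact ⟨g1, by rw [g2, h2], fun l h0 hl => by rw [g3 l h0 hl, h3 l h0 hl]⟩

theorem pauliAct_siteProd {m : ℕ} (h : m < n) (f : ℕ → Bool × Bool) (p : PauliString)
    (hp : (p.2 0).1 = true) :
    ((pauliAct (siteProd (ctlLetter n 0) m f) p).2 0).1 = true ∧
      (∀ j < m, (pauliAct (siteProd (ctlLetter n 0) m f) p).2 (j + 1) =
        (xor (p.2 (j + 1)).1 (f j).1, xor (p.2 (j + 1)).2 (f j).2)) ∧
      ∀ l, m < l → (pauliAct (siteProd (ctlLetter n 0) m f) p).2 l = p.2 l := by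
  induction m with
  | zero =>
    rw [siteProd, pauliAct_one]
    exact ⟨hp, fun j hj => by omega, fun l _ => rfl⟩
  | succ m ih =>
    obtain ⟨h1, h2, h3⟩ := ih (by omega)
    obtain ⟨g1, g2, g3⟩ := pauliAct_ctlLetter h (f m) _ h1
    rw [siteProd, pauliAct_mul]
    refine ⟨g1, fun j hj => ?_, fun l hl => ?_⟩
    · by_cases e : j = m
      · subst e
        rw [g2, h3 _ (by omega)]
      · rw [g3 _ (by omega) (by omega), h2 j (by omega)]
    · rw [g3 l (by omega) (by omega), h3 l (by omega)]

/-- The Pauli string with the letter `a` on wire `i`. -/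
def letterAt (i : ℕ) (a : Bool × Bool) : PauliString :=
  (false, Function.update (fun _ => (false, false)) i a)

theorem act_trivial (C : Circuit n) :
    C.act (false, fun _ => (false, false)) = (false, fun _ => (false, false)) := by
  induction C using FreeMonoid.inductionOn' with
  | one => rfl
  | of_mul g C ih =>
    rw [act_mul, act_of]
    have : g.act (false, fun _ => (false, false)) = (false, fun _ => (false, false)) := by
      cases g <;> simp [Gate.act]
    rw [this, ih]

theorem act_place_letterAt (C : Circuit n) (a : Bool × Bool) :
    (C.place 1 (show 1 + n ≤ n + 1 by omega)).act (letterAt 0 a) = letterAt 0 a := by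
  have e : (fun i => (letterAt 0 a).2 (1 + i)) = fun _ => (false, false) := by
    funext i
    simp [letterAt]
  rw [act_place, e, show (letterAt 0 a).1 = false from rfl, act_trivial]
  refine Prod.ext rfl (funext fun i => ?_)
  by_cases hi : i = 0
  · subst hi; simp
  · simp [letterAt, hi]

end Action

/-! ### Double cosets of the stabilizer of `Z` on the top wire -/

section Cells

variable {n : ℕ}

/-- The class of a circuit on `n` wires, placed on `n + 1` wires below the top wire. -/
abbrev below (C : Circuit n) : CircuitGroup (n + 1) :=
  cls (C.place 1 (show 1 + n ≤ n + 1 by omega))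

theorem below_mul (C D : Circuit n) : below (C * D) = below C * below D := by
  rw [below, map_mul, cls_mul]

theorem below_one : below (1 : Circuit n) = 1 := by
  rw [below, map_one, cls_one]

/-- The submonoid generated by the gates that fix `Z` on the top wire; it turns out to be the whole
stabilizer of that Pauli string. -/
def topStab (n : ℕ) : Submonoid (CircuitGroup (n + 1)) :=
  Submonoid.closure ({genZ (n + 1) 0, genCZ (n + 1) 0} ∪ Set.range (below (n := n)))

theorem genZ_zero_mem_topStab : genZ (n + 1) 0 ∈ topStab n := Submonoid.subset_closure (by simp)

theorem genCZ_zero_mem_topStab : genCZ (n + 1) 0 ∈ topStab n := Submonoid.subset_closure (by simp)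

theorem below_mem_topStab (C : Circuit n) : below C ∈ topStab n :=
  Submonoid.subset_closure (.inr ⟨C, rfl⟩)

theorem genH_succ_eq_below {i : ℕ} (hi : i < n) :
    genH (n + 1) (i + 1) = below (FreeMonoid.of (.H ⟨i, hi⟩)) := by
  rw [show below (FreeMonoid.of (.H ⟨i, hi⟩)) =
    cls (FreeMonoid.of (Gate.place 1 (show 1 + n ≤ n + 1 by omega) (.H ⟨i, hi⟩))) from rfl,
    Gate.place, cls_of_H]
  exact congrArg _ (add_comm _ _)

theorem genZ_succ_eq_below {i : ℕ} (hi : i < n) :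
    genZ (n + 1) (i + 1) = below (FreeMonoid.of (.Z ⟨i, hi⟩)) := by
  rw [show below (FreeMonoid.of (.Z ⟨i, hi⟩)) =
    cls (FreeMonoid.of (Gate.place 1 (show 1 + n ≤ n + 1 by omega) (.Z ⟨i, hi⟩))) from rfl,
    Gate.place, cls_of_Z]
  exact congrArg _ (add_comm _ _)

theorem genCZ_succ_eq_below {i : ℕ} (hi : i + 1 < n) :
    genCZ (n + 1) (i + 1) = below (FreeMonoid.of (.CZ i hi)) := by
  rw [show below (FreeMonoid.of (.CZ i hi)) =
    cls (FreeMonoid.of (Gate.place 1 (show 1 + n ≤ n + 1 by omega) (.CZ i hi))) from rfl,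
    Gate.place, cls_of_CZ]
  exact congrArg _ (add_comm _ _)

theorem genNeg_eq_below : genNeg (n + 1) = below (FreeMonoid.of .neg) := rfl

theorem genH_succ_mem_topStab (i : ℕ) : genH (n + 1) (i + 1) ∈ topStab n := by
  by_cases hi : i < n
  · rw [genH_succ_eq_below hi]
    exact below_mem_topStab _
  · rw [genH, dif_neg (by omega)]
    exact one_mem _

theorem genZ_mem_topStab (i : ℕ) : genZ (n + 1) i ∈ topStab n := by
  match i with
  | 0 => exact genZ_zero_mem_topStab
  | i + 1 =>
    by_cases hi : i < n
    · rw [genZ_succ_eq_below hi]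
      exact below_mem_topStab _
    · rw [genZ, dif_neg (by omega)]
      exact one_mem _

theorem genCZ_mem_topStab (i : ℕ) : genCZ (n + 1) i ∈ topStab n := by
  match i with
  | 0 => exact genCZ_zero_mem_topStab
  | i + 1 =>
    by_cases hi : i + 1 < n
    · rw [genCZ_succ_eq_below hi]
      exact below_mem_topStab _
    · rw [genCZ, dif_neg (by omega)]
      exact one_mem _

theorem swapGate_succ_mem_topStab (i : ℕ) : swapGate (n + 1) (i + 1) ∈ topStab n := by
  have h := genH_succ_mem_topStab (n := n) i
  have h' := genH_succ_mem_topStab (n := n) (i + 1)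
  have k := genCZ_mem_topStab (n := n) (i + 1)
  unfold swapGate swapWord
  exact mul_mem (mul_mem (mul_mem (mul_mem (mul_mem (mul_mem (mul_mem (mul_mem k h) h') k) h) h') k)
    h) h'

theorem farCZ_succ_mem_topStab (i j : ℕ) : farCZ (n + 1) (i + 1) j ∈ topStab n := by
  induction j generalizing i with
  | zero => exact genCZ_mem_topStab _
  | succ j ih =>
    exact mul_mem (mul_mem (swapGate_succ_mem_topStab _) (ih _)) (swapGate_succ_mem_topStab _)

theorem bpow_mem_topStab {x : CircuitGroup (n + 1)} (h : x ∈ topStab n) (b : Bool) :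
    bpow x b ∈ topStab n := by
  cases b
  · exact one_mem _
  · exact h

theorem ctlLetter_one_mem_topStab (j : ℕ) (a : Bool × Bool) :
    ctlLetter (n + 1) 1 j a ∈ topStab n := by
  have e : 1 + j + 1 = (j + 1) + 1 := by ring
  refine mul_mem (bpow_mem_topStab (farCZ_succ_mem_topStab 0 j) _) (bpow_mem_topStab ?_ _)
  rw [farCX, e]
  exact mul_mem (mul_mem (genH_succ_mem_topStab _) (farCZ_succ_mem_topStab 0 j))
    (genH_succ_mem_topStab _)

theorem siteProd_ctlLetter_eq_one {m : ℕ} {f : ℕ → Bool × Bool}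
    (h : ∀ j < m, f j = (false, false)) : siteProd (ctlLetter n 0) m f = 1 := by
  induction m with
  | zero => rfl
  | succ m ih =>
    rw [siteProd, ih fun j hj => h j (by omega), h m (by omega)]
    simp [ctlLetter]

theorem mul_siteProd_zero {G : Type*} [Group G] {blk : ℕ → Bool × Bool → G} {m : ℕ}
    {f : ℕ → Bool × Bool} {g : G} {a : Bool × Bool} (h : g * blk 0 (f 0) = blk 0 a) :
    g * siteProd blk (m + 1) f = siteProd blk (m + 1) (Function.update f 0 a) := by
  induction m with
  | zero => simp [siteProd, h]
  | succ m ih =>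
    rw [siteProd, ← mul_assoc, ih, siteProd.eq_def _ (m + 1 + 1)]
    dsimp only
    rw [Function.update_of_ne (by omega)]

theorem ctlPauli_mul_genZ {m : ℕ} (hm : m ≤ n) (p : PauliString) :
    ctlPauli (n + 1) m p * genZ (n + 1) 0 = ctlPauli (n + 1) m (!p.1, p.2) := by
  have c : Commute (siteProd (ctlLetter (n + 1) 0) m p.2) (genZ (n + 1) 0) :=
    commute_siteProd fun j hj => commute_ctlLetter_genZ (by omega) (by omega) _
  rw [ctlPauli, mul_assoc, c.eq, ← mul_assoc, ctlPauli]
  congr 1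
  have := bpow_mul_bpow (genZ_mul_self (n := n + 1) 0) p.1 true
  rwa [Bool.xor_true, bpow_true] at this

theorem ctlLetter_zero_mul_genCZ (hn : 1 < n) (a : Bool × Bool) :
    ctlLetter n 0 0 a * genCZ n 0 = genCZ n 0 * (bpow (genZ n 0) a.1 * ctlLetter n 0 0 a) := by
  have hx := (twoWire (n := n) (i := 0) (by omega)).cx_mul_k
  have hzx := (twoWire (n := n) (i := 0) (by omega)).z₀_mul_cx
  have hzk := (twoWire (n := n) (i := 0) (by omega)).z₀k
  obtain ⟨a, b⟩ := a
  simp only [ctlLetter, farCX, farCZ]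
  simp only [zero_add] at hx hzx hzk ⊢
  generalize genH n 1 * genCZ n 0 * genH n 1 = c at *
  cases a <;> cases b <;> simp only [bpow_true, bpow_false, mul_one, one_mul, hx, hzx,
    mul_assoc, mul_left_extend hzk]

theorem genCZ_mul_ctlLetter_zero (a : Bool × Bool) :
    genCZ n 0 * ctlLetter n 0 0 a = ctlLetter n 0 0 (a.1, !a.2) := by
  rw [ctlLetter, ← mul_assoc, ctlLetter]
  congr 1
  have h := bpow_mul_bpow (genCZ_mul_self (n := n) 0) true a.2
  rwa [Bool.true_xor, bpow_true] at h

theorem exists_ctlPauli_mul_genCZ (p : PauliString) :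
    ∃ q, ctlPauli (n + 1) n p * genCZ (n + 1) 0 = ctlPauli (n + 1) n q := by
  match n with
  | 0 => exact ⟨p, by rw [genCZ, dif_neg (by omega), mul_one]⟩
  | n + 1 =>
    have hz (b : Bool) (j : ℕ) (hj : j < n + 1) (a : Bool × Bool) :
        Commute (ctlLetter (n + 1 + 1) 0 j a) (bpow (genZ (n + 1 + 1) 0) b) :=
      (commute_bpow (commute_ctlLetter_genZ (by omega) (by omega) a).symm b).symm
    have siteProd_mul_genCZ := siteProd_mul_of_one (blk := ctlLetter (n + 1 + 1) 0) (m := n + 1)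
      (i := 0) (f := p.2) (a' := p.2 0) (by omega) (hz (p.2 0).1)
      (fun j hj hj0 a => commute_ctlLetter
        (commute_farCZ_farCZ (j := j) (l := 0) (by omega) (by omega))
        (commute_genCZ_genH (by omega) (by omega)).symm a)
      (ctlLetter_zero_mul_genCZ (by omega) _)
    rw [Function.update_eq_self, farCZ] at siteProd_mul_genCZ
    have ck := (commute_bpow (commute_genCZ_genZ (n := n + 1 + 1) 0 0).symm (p.2 0).1).eq
    refine ⟨(xor p.1 (p.2 0).1, Function.update p.2 0 ((p.2 0).1, !(p.2 0).2)), ?_⟩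
    rw [ctlPauli, mul_assoc, siteProd_mul_genCZ, ← mul_assoc (genCZ _ _), ← ck, mul_assoc,
      mul_siteProd_zero (genCZ_mul_ctlLetter_zero _), ← mul_assoc,
      bpow_mul_bpow (genZ_mul_self _), ctlPauli]

theorem exists_below_mul_ctlPauli {x : CircuitGroup (n + 1)} (hx : x ∈ topStab n) :
    ∃ C p, x = below C * ctlPauli (n + 1) n p := by
  induction hx using Submonoid.closure_induction_right with
  | one =>
    refine ⟨1, (false, fun _ => (false, false)), ?_⟩
    rw [below_one, ctlPauli, siteProd_ctlLetter_eq_one fun _ _ => rfl]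
    simp
  | mul_right x hx y hy ih =>
    obtain ⟨C, p, rfl⟩ := ih
    rcases hy with (rfl | rfl) | ⟨D, rfl⟩
    · exact ⟨C, _, by rw [mul_assoc, ctlPauli_mul_genZ le_rfl]⟩
    · obtain ⟨q, hq⟩ := exists_ctlPauli_mul_genCZ p
      exact ⟨C, q, by rw [mul_assoc, hq]⟩
    · exact ⟨C * D, _, by rw [mul_assoc, ctlPauli_mul_place, ← mul_assoc, ← below_mul]⟩

theorem exists_ctlPauli_mul_below {x : CircuitGroup (n + 1)} (hx : x ∈ topStab n) :
    ∃ C p, x = ctlPauli (n + 1) n p * below C := by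
  obtain ⟨C, p, rfl⟩ := exists_below_mul_ctlPauli hx
  obtain ⟨q, rfl⟩ := act_surjective C p
  exact ⟨C, q, (ctlPauli_mul_place C q).symm⟩

theorem exists_below_mul_below_eq_one (C : Circuit n) : ∃ D : Circuit n, below C * below D = 1 := by
  induction C using FreeMonoid.inductionOn' with
  | one => exact ⟨1, by rw [below_one, mul_one]⟩
  | of_mul g C ih =>
    obtain ⟨D, hD⟩ := ih
    refine ⟨D * FreeMonoid.of g, ?_⟩
    rw [below_mul, below_mul, mul_assoc, ← mul_assoc (below C), hD, one_mul]
    exact cls_of_mul_self _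

theorem commute_genH_zero_below (C : Circuit n) : Commute (genH (n + 1) 0) (below C) := by
  induction C using FreeMonoid.inductionOn' with
  | one => rw [below_one]; exact Commute.one_right _
  | of_mul g C ih =>
    rw [below_mul]
    refine Commute.mul_right ?_ ih
    cases g with
    | neg => exact (commute_genNeg _).symm
    | H i => rw [← genH_succ_eq_below i.isLt]; exact commute_genH_genH (by omega)
    | Z i => rw [← genZ_succ_eq_below i.isLt]; exact (commute_genZ_genH (by omega)).symm
    | CZ i hi => rw [← genCZ_succ_eq_below hi]; exact
      (commute_genCZ_genH (by omega) (by omega)).symm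

theorem commute_genZ_zero_below (C : Circuit n) : Commute (genZ (n + 1) 0) (below C) := by
  induction C using FreeMonoid.inductionOn' with
  | one => rw [below_one]; exact Commute.one_right _
  | of_mul g C ih =>
    rw [below_mul]
    refine Commute.mul_right ?_ ih
    cases g with
    | neg => exact (commute_genNeg _).symm
    | H i => rw [← genH_succ_eq_below i.isLt]; exact commute_genZ_genH (by omega)
    | Z i => rw [← genZ_succ_eq_below i.isLt]; exact commute_genZ_genZ _ _
    | CZ i hi => rw [← genCZ_succ_eq_below hi]; exact (commute_genCZ_genZ _ _).symm

/-- The representatives `1`, `X₀`, `H₀` and the swap of the top two wires of the double cosets of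
`topStab n`. -/
inductive IsCellRep (n : ℕ) : CircuitGroup (n + 1) → Prop
  | one : IsCellRep n 1
  | x : IsCellRep n (genH (n + 1) 0 * genZ (n + 1) 0 * genH (n + 1) 0)
  | h : IsCellRep n (genH (n + 1) 0)
  | swap (hn : 0 < n) : IsCellRep n (swapGate (n + 1) 0)

/-- Membership in one of the double cosets of `topStab n` of the elements of `IsCellRep n`. -/
def InCells (x : CircuitGroup (n + 1)) : Prop :=
  ∃ t, IsCellRep n t ∧ ∃ q ∈ topStab n, ∃ q' ∈ topStab n, x = q * t * q'

theorem InCells.mul_left {x q : CircuitGroup (n + 1)} (hx : InCells x) (hq : q ∈ topStab n) :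
    InCells (q * x) := by
  obtain ⟨t, ht, q₁, h₁, q₂, h₂, rfl⟩ := hx
  exact ⟨t, ht, _, mul_mem hq h₁, q₂, h₂, by simp only [mul_assoc]⟩

theorem InCells.mul_right {x q : CircuitGroup (n + 1)} (hx : InCells x) (hq : q ∈ topStab n) :
    InCells (x * q) := by
  obtain ⟨t, ht, q₁, h₁, q₂, h₂, rfl⟩ := hx
  exact ⟨t, ht, q₁, h₁, _, mul_mem h₂ hq, by simp only [mul_assoc]⟩

theorem IsCellRep.inCells {t : CircuitGroup (n + 1)} (ht : IsCellRep n t) : InCells t :=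
  ⟨t, ht, 1, one_mem _, 1, one_mem _, by simp⟩

theorem inCells_of_mem {q : CircuitGroup (n + 1)} (hq : q ∈ topStab n) : InCells q := by
  simpa using IsCellRep.one.inCells.mul_left hq

theorem farCX_zero_mem_topStab : farCX (n + 1) 0 0 ∈ topStab n := by
  rw [farCX]
  exact mul_mem (mul_mem (genH_succ_mem_topStab _) genCZ_zero_mem_topStab) (genH_succ_mem_topStab _)

theorem ctlPauli_of_topLetter {p : PauliString} (hn : 0 < n) (h0 : p.1 = false)
    (h1 : ∀ i, 0 < i → i < n → p.2 i = (false, false)) :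
    ctlPauli (n + 1) n p = ctlLetter (n + 1) 0 0 (p.2 0) := by
  obtain ⟨n, rfl⟩ : ∃ k, n = k + 1 := ⟨n - 1, by omega⟩
  have := mul_siteProd_zero (blk := ctlLetter (n + 2) 0) (m := n)
    (f := fun _ => (false, false)) (g := ctlLetter (n + 2) 0 0 (p.2 0)) (a := p.2 0)
    (by simp [ctlLetter])
  rw [siteProd_ctlLetter_eq_one fun _ _ => rfl, mul_one] at this
  rw [ctlPauli, h0, bpow_false, one_mul, this]
  refine siteProd_congr fun j hj => ?_
  by_cases hj0 : j = 0
  · rw [hj0, Function.update_self]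
  · rw [Function.update_of_ne hj0, h1 j (by omega) hj]

theorem inCells_genH_mul_genCZ_mul_genH :
    InCells (genH (n + 2) 0 * genCZ (n + 2) 0 * genH (n + 2) 0) := by
  have cx_sq := farCX_mul_self (n := n + 2) (i := 0) (j := 0) (by omega)
  have swap_eq : swapGate (n + 2) 0 = farCX (n + 2) 0 0 *
      (genH (n + 2) 0 * genCZ (n + 2) 0 * genH (n + 2) 0) * farCX (n + 2) 0 0 :=
    (twoWire (n := n + 2) (i := 0) (by omega)).swap_eq_cx_mul_xc_mul_cx
  have conj_eq : genH (n + 2) 0 * genCZ (n + 2) 0 * genH (n + 2) 0 =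
      farCX (n + 2) 0 0 * swapGate (n + 2) 0 * farCX (n + 2) 0 0 := by
    rw [swap_eq]
    simp only [mul_assoc, mul_self_cancel_left cx_sq, cx_sq, mul_one]
  rw [conj_eq]
  exact ((IsCellRep.swap (by omega)).inCells.mul_left farCX_zero_mem_topStab).mul_right
    farCX_zero_mem_topStab

theorem inCells_conj_genZ_mul_genCZ_mul_genH :
    InCells (genH (n + 2) 0 * genZ (n + 2) 0 * genH (n + 2) 0 * genCZ (n + 2) 0 *
      genH (n + 2) 0) := by
  have T := twoWire (n := n + 2) (i := 0) (by omega)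
  rw [T.x₀k, mul_assoc, T.h₀_mul_self, mul_one, mul_assoc]
  exact (IsCellRep.h.inCells.mul_left genCZ_zero_mem_topStab).mul_right
    (mul_mem (genZ_mem_topStab 0) (genZ_mem_topStab 1))

theorem inCells_genH_mul_cy_mul_genH :
    InCells (genH (n + 2) 0 * (genCZ (n + 2) 0 * farCX (n + 2) 0 0) * genH (n + 2) 0) := by
  have h : genH (n + 2) 0 * (genCZ (n + 2) 0 * farCX (n + 2) 0 0) * genH (n + 2) 0 =
      genCZ (n + 2) 0 * farCX (n + 2) 0 0 * genZ (n + 2) 0 * genH (n + 2) 0 *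
        (genH (n + 2) 1 * genCZ (n + 2) 0 * (genH (n + 2) 1 * genZ (n + 2) 1 * genH (n + 2) 1) *
          farCX (n + 2) 0 0) :=
    (twoWire (n := n + 2) (i := 0) (by omega)).conj_h₀_cy
  have genH_one_mem := genH_succ_mem_topStab (n := n + 1) 0
  rw [h]
  exact (IsCellRep.h.inCells.mul_left
    (mul_mem (mul_mem genCZ_zero_mem_topStab farCX_zero_mem_topStab)
      (genZ_mem_topStab 0))).mul_right
      (mul_mem (mul_mem (mul_mem genH_one_mem genCZ_zero_mem_topStab)
        (mul_mem (mul_mem genH_one_mem (genZ_mem_topStab 1)) genH_one_mem)) farCX_zero_mem_topStab)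

theorem inCells_conj_genZ_mul_cy_mul_genH :
    InCells (genH (n + 2) 0 * genZ (n + 2) 0 * genH (n + 2) 0 *
      (genCZ (n + 2) 0 * farCX (n + 2) 0 0) * genH (n + 2) 0) := by
  have h : genH (n + 2) 0 * genZ (n + 2) 0 * genH (n + 2) 0 *
      (genCZ (n + 2) 0 * farCX (n + 2) 0 0) * genH (n + 2) 0 =
      genCZ (n + 2) 0 * genZ (n + 2) 1 * genH (n + 2) 1 * genCZ (n + 2) 0 * genH (n + 2) 0 *
        (genZ (n + 2) 0 * genZ (n + 2) 1 * genH (n + 2) 1) :=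
    (twoWire (n := n + 2) (i := 0) (by omega)).x₀_mul_cy_mul_h₀
  have genH_one_mem := genH_succ_mem_topStab (n := n + 1) 0
  rw [h]
  exact (IsCellRep.h.inCells.mul_left
    (mul_mem (mul_mem (mul_mem genCZ_zero_mem_topStab (genZ_mem_topStab 1)) genH_one_mem)
      genCZ_zero_mem_topStab)).mul_right
      (mul_mem (mul_mem (genZ_mem_topStab 0) (genZ_mem_topStab 1)) genH_one_mem)

theorem inCells_genH_mul_ctlLetter_mul_genH (t : WireType) :
    InCells (genH (n + 2) 0 * ctlLetter (n + 2) 0 0 t.letter * genH (n + 2) 0) := by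
  cases t
  · simpa only [ctlLetter, WireType.letter, bpow_true, bpow_false, mul_one, farCZ] using
      inCells_genH_mul_genCZ_mul_genH
  · exact inCells_genH_mul_cy_mul_genH

theorem inCells_conj_genZ_mul_ctlLetter_mul_genH (t : WireType) :
    InCells (genH (n + 2) 0 * genZ (n + 2) 0 * genH (n + 2) 0 * ctlLetter (n + 2) 0 0 t.letter *
      genH (n + 2) 0) := by
  cases t
  · simpa only [ctlLetter, WireType.letter, bpow_true, bpow_false, mul_one, farCZ] using
      inCells_conj_genZ_mul_genCZ_mul_genH
  · exact inCells_conj_genZ_mul_cy_mul_genH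

end Cells

section Closure

variable {n : ℕ}

theorem inCells_mul_ctlPauli_mul_genH {t : CircuitGroup (n + 1)}
    (comm : ∀ C : Circuit n, Commute t (below C))
    (hletter : 0 < n → ∀ a : WireType,
      InCells (t * ctlLetter (n + 1) 0 0 a.letter * genH (n + 1) 0))
    (htrivial : ∀ b, InCells (t * bpow (genZ (n + 1) 0) b * genH (n + 1) 0)) (p : PauliString) :
    InCells (t * ctlPauli (n + 1) n p * genH (n + 1) 0) := by
  by_cases hp : ∃ i < n, p.2 i ≠ (false, false)
  · obtain ⟨a, D, ⟨h1, h2, h3⟩, -⟩ := exists_reduction p hp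
    obtain ⟨D', hD'⟩ := exists_below_mul_below_eq_one D
    have hn : 0 < n := by obtain ⟨i, hi, -⟩ := hp; omega
    have eq_reduced : ctlPauli (n + 1) n p =
        below D * ctlLetter (n + 1) 0 0 a.letter * below D' := by
      rw [← h2, ← ctlPauli_of_topLetter hn h1 h3, ← ctlPauli_mul_place D p, mul_assoc, hD', mul_one]
    have e : t * ctlPauli (n + 1) n p * genH (n + 1) 0 =
        below D * (t * ctlLetter (n + 1) 0 0 a.letter * genH (n + 1) 0) * below D' := by
      rw [eq_reduced, mul_assoc _ _ (genH (n + 1) 0), mul_assoc _ _ (genH (n + 1) 0),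
        ← (commute_genH_zero_below D').eq]
      simp only [mul_assoc, mul_left_extend (comm D).eq]
    rw [e]
    exact ((hletter hn a).mul_left (below_mem_topStab _)).mul_right (below_mem_topStab _)
  · push Not at hp
    rw [ctlPauli, siteProd_ctlLetter_eq_one hp, mul_one]
    exact htrivial p.1

theorem inCells_genH_mul_bpow_genZ_mul_genH (b : Bool) :
    InCells (genH (n + 1) 0 * bpow (genZ (n + 1) 0) b * genH (n + 1) 0) := by
  cases b
  · rw [bpow_false, mul_one, genH_mul_self]
    exact inCells_of_mem (one_mem _)
  · exact IsCellRep.x.inCells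

theorem inCells_conj_genZ_mul_bpow_genZ_mul_genH (b : Bool) :
    InCells (genH (n + 1) 0 * genZ (n + 1) 0 * genH (n + 1) 0 * bpow (genZ (n + 1) 0) b *
      genH (n + 1) 0) := by
  cases b
  · rw [bpow_false, mul_one, mul_assoc, genH_mul_self, mul_one]
    exact IsCellRep.h.inCells.mul_right genZ_zero_mem_topStab
  · have anticommute : genH (n + 1) 0 * genZ (n + 1) 0 * genH (n + 1) 0 * genZ (n + 1) 0 *
        genH (n + 1) 0 = genNeg (n + 1) * genZ (n + 1) 0 * genH (n + 1) 0 * genZ (n + 1) 0 := by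
      have := congrArg (fun x => genNeg (n + 1) * x * genH (n + 1) 0)
        (genZ_mul_conj_genZ (n := n + 1) (i := 0) (by omega))
      simp only [mul_assoc, mul_self_cancel_left (genNeg_mul_self (n := n + 1)), genH_mul_self,
        mul_one] at this ⊢
      exact this.symm
    rw [bpow_true, anticommute]
    exact (IsCellRep.h.inCells.mul_left (mul_mem (genNeg_eq_below (n := n) ▸ below_mem_topStab _)
      genZ_zero_mem_topStab)).mul_right genZ_zero_mem_topStab

theorem inCells_genH_mul_ctlPauli_mul_genH (p : PauliString) :
    InCells (genH (n + 1) 0 * ctlPauli (n + 1) n p * genH (n + 1) 0) := by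
  refine inCells_mul_ctlPauli_mul_genH commute_genH_zero_below (fun hn => ?_)
    inCells_genH_mul_bpow_genZ_mul_genH p
  obtain ⟨n, rfl⟩ : ∃ k, n = k + 1 := ⟨n - 1, by omega⟩
  exact inCells_genH_mul_ctlLetter_mul_genH

theorem commute_conj_genZ_zero_below (C : Circuit n) :
    Commute (genH (n + 1) 0 * genZ (n + 1) 0 * genH (n + 1) 0) (below C) :=
  ((commute_genH_zero_below C).mul_left (commute_genZ_zero_below C)).mul_left
    (commute_genH_zero_below C)

theorem inCells_conj_genZ_mul_ctlPauli_mul_genH (p : PauliString) :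
    InCells (genH (n + 1) 0 * genZ (n + 1) 0 * genH (n + 1) 0 * ctlPauli (n + 1) n p *
      genH (n + 1) 0) := by
  refine inCells_mul_ctlPauli_mul_genH commute_conj_genZ_zero_below (fun hn => ?_)
    inCells_conj_genZ_mul_bpow_genZ_mul_genH p
  obtain ⟨n, rfl⟩ : ∃ k, n = k + 1 := ⟨n - 1, by omega⟩
  exact inCells_conj_genZ_mul_ctlLetter_mul_genH

theorem commute_ctlLetter_ctlLetter {j l : ℕ} (hj : j + 1 < n) (hl : l + 1 < n) (h : j ≠ l)
    (a b : Bool × Bool) : Commute (ctlLetter n 0 j a) (ctlLetter n 0 l b) := by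
  have h1 : Commute (farCZ n 0 j) (ctlLetter n 0 l b) :=
    (commute_ctlLetter (commute_farCZ_farCZ (by omega) (by omega))
      (commute_farCZ_genH (by omega) (by omega) (by omega)).symm b).symm
  exact commute_ctlLetter h1 (commute_ctlLetter_genH (by omega) (by omega) (by omega) b).symm a

theorem swapGate_mul_ctlLetter {j : ℕ} (hj : j + 2 < n) (a : Bool × Bool) :
    swapGate n 0 * ctlLetter n 0 (j + 1) a = ctlLetter n 1 j a * swapGate n 0 := by
  have e : MulAut.conj (swapGate n 0) (ctlLetter n 1 j a) = ctlLetter n 0 (j + 1) a := by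
    have e1 := conj_swapGate_farCZ (n := n) (i := 0) (by omega) j
    have e2 := conj_swapGate_farCX (n := n) (i := 0) (j := j) (by omega)
    obtain ⟨a, b⟩ := a
    rw [zero_add] at e1 e2
    cases a <;> cases b <;> simp [ctlLetter, e1, e2, -MulAut.conj_apply]
  rw [← e, MulAut.conj_apply, swapGate_inv (by omega), ← mul_assoc, ← mul_assoc,
    swapGate_mul_self (by omega),
    one_mul]

theorem exists_swapGate_mul_siteProd {m : ℕ} (hm : m < n) (f : ℕ → Bool × Bool) :
    ∃ r r', r' ∈ topStab n ∧ siteProd (ctlLetter (n + 1) 0) (m + 1) f =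
      r * ctlLetter (n + 1) 0 0 (f 0) ∧ swapGate (n + 1) 0 * r = r' * swapGate (n + 1) 0 := by
  induction m with
  | zero => exact ⟨1, 1, one_mem _, by simp [siteProd], by simp⟩
  | succ m ih =>
    obtain ⟨r, r', h1, h2, h3⟩ := ih (by omega)
    refine ⟨r * ctlLetter (n + 1) 0 (m + 1) (f (m + 1)), r' * ctlLetter (n + 1) 1 m (f (m + 1)),
      mul_mem h1 (ctlLetter_one_mem_topStab _ _), ?_, ?_⟩
    · rw [siteProd, h2, mul_assoc, mul_assoc,
        (commute_ctlLetter_ctlLetter (by omega) (by omega) (by omega) _ _).eq]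
    · rw [← mul_assoc, h3, mul_assoc, swapGate_mul_ctlLetter (by omega), mul_assoc]

theorem inCells_swapGate_mul_bpow_farCX_mul_genH (b : Bool) :
    InCells (swapGate (n + 2) 0 * bpow (farCX (n + 2) 0 0) b * genH (n + 2) 0) := by
  have T := twoWire (n := n + 2) (i := 0) (by omega)
  cases b
  · have swap_mul_genH : swapGate (n + 2) 0 * genH (n + 2) 0 =
        genH (n + 2) (0 + 1) * swapGate (n + 2) 0 := T.swap_mul_h₀
    rw [bpow_false, mul_one, swap_mul_genH]
    exact (IsCellRep.swap (by omega)).inCells.mul_left (genH_succ_mem_topStab _)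
  · have swap_eq : swapGate (n + 2) 0 = farCX (n + 2) 0 0 *
        (genH (n + 2) 0 * genCZ (n + 2) 0 * genH (n + 2) 0) * farCX (n + 2) 0 0 :=
      T.swap_eq_cx_mul_xc_mul_cx
    have swap_mul_cx_mul_genH : swapGate (n + 2) 0 * farCX (n + 2) 0 0 * genH (n + 2) 0 =
        farCX (n + 2) 0 0 * genH (n + 2) 0 * genCZ (n + 2) 0 := by
      rw [swap_eq]
      simp only [mul_assoc, genH_mul_self, mul_one,
        mul_self_cancel_left (farCX_mul_self (n := n + 2) (i := 0) (j := 0) (by omega))]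
    rw [bpow_true, swap_mul_cx_mul_genH]
    exact (IsCellRep.h.inCells.mul_left farCX_zero_mem_topStab).mul_right genCZ_zero_mem_topStab

theorem inCells_swapGate_mul_ctlPauli_mul_genH (hn : 0 < n) (p : PauliString) :
    InCells (swapGate (n + 1) 0 * ctlPauli (n + 1) n p * genH (n + 1) 0) := by
  obtain ⟨m, rfl⟩ : ∃ m, n = m + 1 := ⟨n - 1, by omega⟩
  have T := twoWire (n := m + 2) (i := 0) (by omega)
  obtain ⟨r, r', h1, h2, h3⟩ := exists_swapGate_mul_siteProd (n := m + 1) (m := m) (by omega) p.2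
  have swap_genZ (b : Bool) : swapGate (m + 2) 0 * bpow (genZ (m + 2) 0) b =
      bpow (genZ (m + 2) 1) b * swapGate (m + 2) 0 :=
        (bpow_mul_eq_mul_bpow T.swap_mul_z₀.symm b).symm
  have swap_genCZ (b : Bool) : swapGate (m + 2) 0 * bpow (genCZ (m + 2) 0) b =
      bpow (genCZ (m + 2) 0) b * swapGate (m + 2) 0 :=
        (bpow_mul_eq_mul_bpow T.swap_mul_k.symm b).symm
  have e : swapGate (m + 2) 0 * ctlPauli (m + 2) (m + 1) p * genH (m + 2) 0 =
      (bpow (genZ (m + 2) 1) p.1 * r' * bpow (genCZ (m + 2) 0) (p.2 0).2) *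
        (swapGate (m + 2) 0 * bpow (farCX (m + 2) 0 0) (p.2 0).1 * genH (m + 2) 0) := by
    rw [ctlPauli, h2, ctlLetter, farCZ]
    simp only [mul_assoc, mul_left_extend (swap_genZ _), mul_left_extend h3,
      mul_left_extend (swap_genCZ _)]
  rw [e]
  exact (inCells_swapGate_mul_bpow_farCX_mul_genH _).mul_left
    (mul_mem (mul_mem (bpow_mem_topStab (genZ_mem_topStab 1) _) h1)
      (bpow_mem_topStab genCZ_zero_mem_topStab _))

theorem InCells.mul_genH {x : CircuitGroup (n + 1)} (hx : InCells x) :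
    InCells (x * genH (n + 1) 0) := by
  obtain ⟨t, ht, q, hq, q', hq', rfl⟩ := hx
  rw [mul_assoc, mul_assoc]
  refine InCells.mul_left ?_ hq
  have of_commute {t : CircuitGroup (n + 1)} (comm : ∀ C : Circuit n, Commute t (below C))
      (h : ∀ p, InCells (t * ctlPauli (n + 1) n p * genH (n + 1) 0)) :
      InCells (t * (q' * genH (n + 1) 0)) := by
    obtain ⟨C, p, rfl⟩ := exists_below_mul_ctlPauli hq'
    have := (h p).mul_left (below_mem_topStab C)
    simpa only [mul_assoc, mul_left_extend (comm C).eq] using this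
  cases ht with
  | one =>
    rw [one_mul]
    exact IsCellRep.h.inCells.mul_left hq'
  | x => exact of_commute commute_conj_genZ_zero_below inCells_conj_genZ_mul_ctlPauli_mul_genH
  | h => exact of_commute commute_genH_zero_below inCells_genH_mul_ctlPauli_mul_genH
  | swap hn =>
    obtain ⟨C, p, rfl⟩ := exists_ctlPauli_mul_below hq'
    have := (inCells_swapGate_mul_ctlPauli_mul_genH hn p).mul_right (below_mem_topStab C)
    rw [mul_assoc _ (below C), ← (commute_genH_zero_below C).eq]
    simpa only [mul_assoc] using this

theorem inCells (x : CircuitGroup (n + 1)) : InCells x := by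
  obtain ⟨C, rfl⟩ := exists_cls x
  suffices H : ∀ l : List (Gate (n + 1)), InCells (cls (circ l)) from H C.toList
  intro l
  induction l using List.reverseRecOn with
  | nil =>
    rw [show circ ([] : List (Gate (n + 1))) = 1 from rfl, cls_one]
    exact inCells_of_mem (one_mem _)
  | append_singleton l g ih =>
    rw [show circ (l ++ [g]) = circ l * FreeMonoid.of g from rfl, cls_mul]
    cases g with
    | neg => exact ih.mul_right (below_mem_topStab (FreeMonoid.of .neg))
    | H i =>
      rw [cls_of_H]
      refine Fin.cases ?_ (fun i => ?_) i
      · exact ih.mul_genH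
      · exact ih.mul_right (genH_succ_mem_topStab _)
    | Z i => rw [cls_of_Z]; exact ih.mul_right (genZ_mem_topStab _)
    | CZ i hi => rw [cls_of_CZ]; exact ih.mul_right (genCZ_mem_topStab _)

end Closure

/-! ### Circuits that act trivially -/

section Faithful

variable {n : ℕ}

theorem Gate.place_place {a b c : ℕ} (k l : ℕ) (h : k + a ≤ b) (h' : l + b ≤ c) (g : Gate a) :
    (g.place k h).place l h' = g.place (l + k) (by omega) := by
  cases g <;> simp [Gate.place, add_assoc]

theorem place_place {a b c : ℕ} (k l : ℕ) (h : k + a ≤ b) (h' : l + b ≤ c) (C : Circuit a) :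
    (C.place k h).place l h' = C.place (l + k) (by omega) := by
  induction C using FreeMonoid.inductionOn' with
  | one => simp
  | of_mul g C ih =>
    rw [map_mul, map_mul, map_mul, ih]
    congr 1
    exact congrArg FreeMonoid.of (Gate.place_place k l h h' g)

theorem Gate.wires_place {m : ℕ} (k : ℕ) (h : k + m ≤ n) (g : Gate m) :
    (g.place k h).wires = (k + ·) '' g.wires := by
  cases g <;> simp [Gate.place, Gate.wires, Set.image_pair, add_assoc]

theorem CircuitRel.place {m : ℕ} (k : ℕ) (h : k + m ≤ n) {C D : Circuit m}
    (hCD : CircuitRel m C D) : CircuitRel n (C.place k h) (D.place k h) := by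
  cases hCD with
  | reduced huv l hl =>
    rw [place_place, place_place]
    exact .reduced huv _ _
  | slide g g' hd =>
    refine .slide (g.place k h) (g'.place k h) ?_
    rw [Gate.wires_place, Gate.wires_place]
    exact (Set.disjoint_image_iff (add_right_injective k)).2 hd

theorem cls_place_eq {m : ℕ} (k : ℕ) (h : k + m ≤ n) {C D : Circuit m} (hCD : cls C = cls D) :
    cls (C.place k h) = cls (D.place k h) := by
  have hle : conGen (CircuitRel m) ≤
      Con.ker ((PresentedMonoid.mk (CircuitRel n)).comp (Circuit.place k h)) :=
    Con.conGen_le.2 fun C D h' => cls_eq_of_rel (CircuitRel.place k h h')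
  exact hle (cls_eq_iff.1 hCD)

theorem pauliAct_topStab {q : CircuitGroup (n + 1)} (hq : q ∈ topStab n) :
    pauliAct q (letterAt 0 (false, true)) = letterAt 0 (false, true) := by
  induction hq using Submonoid.closure_induction with
  | one => exact pauliAct_one _
  | mul x y _ _ hx hy => rw [pauliAct_mul, hx, hy]
  | mem x hx =>
    rcases hx with (rfl | rfl) | ⟨C, rfl⟩
    · rw [pauliAct_genZ (by omega)]
      rfl
    · by_cases h : 0 + 1 < n + 1
      · rw [pauliAct_genCZ h]
        refine Prod.ext rfl (funext fun i => ?_)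
        simp only [letterAt, Function.update_apply]
        split_ifs <;> simp_all
      · rw [genCZ, dif_neg h, pauliAct_one]
    · rw [pauliAct_cls, act_place_letterAt]

theorem pauliAct_cellRep {t : CircuitGroup (n + 1)} (ht : IsCellRep n t)
    (h : pauliAct t (letterAt 0 (false, true)) = letterAt 0 (false, true)) : t = 1 := by
  cases ht with
  | one => rfl
  | x =>
    rw [pauliAct_mul, pauliAct_mul, pauliAct_genH (by omega), pauliAct_genZ (by omega),
      pauliAct_genH (by omega)] at h
    have := congrArg Prod.fst h
    simp [letterAt] at this
  | h =>
    rw [pauliAct_genH (by omega)] at h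
    have := congrFun (congrArg Prod.snd h) 0
    simp [letterAt] at this
  | swap hn =>
    rw [pauliAct_swapGate (by omega)] at h
    have := congrFun (congrArg Prod.snd h) 0
    simp [letterAt] at this

theorem mem_topStab_of_pauliAct {x : CircuitGroup (n + 1)}
    (h : pauliAct x (letterAt 0 (false, true)) = letterAt 0 (false, true)) : x ∈ topStab n := by
  obtain ⟨t, ht, q, hq, q', hq', rfl⟩ := inCells x
  rw [pauliAct_mul, pauliAct_mul, pauliAct_topStab hq] at h
  have := pauliAct_injective q' (h.trans (pauliAct_topStab hq').symm)
  rw [pauliAct_cellRep ht this, mul_one]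
  exact mul_mem hq hq'

theorem ctlPauli_eq_one {p : PauliString}
    (h : pauliAct (ctlPauli (n + 1) n p) (letterAt 0 (true, false)) = letterAt 0 (true, false)) :
    ctlPauli (n + 1) n p = 1 := by
  have hb : (pauliAct (bpow (genZ (n + 1) 0) p.1) (letterAt 0 (true, false))) =
      (p.1, (letterAt 0 (true, false)).2) := by
    cases p.1
    · exact pauliAct_one _
    · rw [bpow_true, pauliAct_genZ (by omega)]
      simp [letterAt]
  rw [ctlPauli, pauliAct_mul, hb] at h
  obtain ⟨-, h2, -⟩ := pauliAct_siteProd (n := n + 1) (m := n) (by omega) p.2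
    (p.1, (letterAt 0 (true, false)).2) (by simp [letterAt])
  rw [h] at h2
  have h3 : ∀ j < n, p.2 j = (false, false) := by
    intro j hj
    have := h2 j hj
    rw [show (letterAt 0 (true, false)).2 (j + 1) = (false, false) by simp [letterAt],
      Bool.false_xor, Bool.false_xor] at this
    exact this.symm
  rw [siteProd_ctlLetter_eq_one h3, pauliAct_one] at h
  have h4 : p.1 = false := congrArg Prod.fst h
  rw [ctlPauli, siteProd_ctlLetter_eq_one h3, h4, bpow_false, one_mul]

theorem cls_eq_one_or_genNeg_of_zero (C : Circuit 0) : cls C = 1 ∨ cls C = genNeg 0 := by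
  induction C using FreeMonoid.inductionOn' with
  | one => exact .inl cls_one
  | of_mul g C ih =>
    rw [cls_mul]
    cases g with
    | neg =>
      rw [cls_of_neg]
      rcases ih with ih | ih <;> rw [ih]
      · exact .inr (mul_one _)
      · exact .inl genNeg_mul_self
    | H i => exact i.elim0
    | Z i => exact i.elim0
    | CZ i hi => omega

theorem act_eq_self_of_act_place_one {D : Circuit n}
    (h : ∀ p, (D.place 1 (show 1 + n ≤ n + 1 by omega)).act p = p) (q : PauliString) :
    D.act q = q := by
  have := h (q.1, fun i => q.2 (i - 1))
  rw [act_place] at this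
  simp only [Nat.add_sub_cancel_left] at this
  refine Prod.ext (congrArg (fun p => p.1) this) (funext fun i => ?_)
  simpa using congrFun (congrArg Prod.snd this) (1 + i)

theorem cls_eq_one_or_genNeg (C : Circuit n) (h : ∀ p, C.act p = p) :
    cls C = 1 ∨ cls C = genNeg n := by
  induction n with
  | zero => exact cls_eq_one_or_genNeg_of_zero C
  | succ n ih =>
    have mem_topStab : cls C ∈ topStab n := mem_topStab_of_pauliAct (by rw [pauliAct_cls, h])
    obtain ⟨D, p, hD⟩ := exists_below_mul_ctlPauli mem_topStab
    have ctlPauli_eq : ctlPauli (n + 1) n p = 1 := by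
      refine ctlPauli_eq_one ?_
      have := h (letterAt 0 (true, false))
      rwa [← pauliAct_cls, hD, pauliAct_mul, pauliAct_cls, act_place_letterAt] at this
    rw [ctlPauli_eq, mul_one] at hD
    rw [hD]
    refine (ih D <| act_eq_self_of_act_place_one fun q => ?_).imp (fun e => ?_) fun e => ?_
    · rw [← act_eq_of_cls_eq hD, h]
    · have := cls_place_eq 1 (show 1 + n ≤ n + 1 by omega) (C := D) (D := 1) (e.trans cls_one.symm)
      rwa [map_one, cls_one] at this
    · exact cls_place_eq 1 (show 1 + n ≤ n + 1 by omega) (C := D) (D := FreeMonoid.of .neg)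
        (e.trans cls_of_neg.symm)

theorem cls_eq_of_operator_eq {C D : Circuit n} (h : C.operator = D.operator) :
    cls C = cls D := by
  obtain ⟨E, hE⟩ := exists_cls (cls D)⁻¹
  have hDE : cls (D * E) = 1 := by rw [cls_mul, hE, mul_inv_cancel]
  have op1 : (C * E).operator = 1 := by
    rw [operator_mul, h, ← operator_mul, operator_eq_of_cls_eq (hDE.trans cls_one.symm),
      operator_one]
  have hact : ∀ p, (C * E).act p = p := by
    intro p
    rw [act_mul, act_eq_of_operator_eq h, ← act_mul, act_eq_of_cls_eq (hDE.trans cls_one.symm),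
      act_one]
  rcases cls_eq_one_or_genNeg (C * E) hact with e | e
  · rw [cls_mul, hE] at e
    exact mul_inv_eq_one.1 e
  · exfalso
    have := operator_eq_of_cls_eq (e.trans cls_of_neg.symm)
    rw [op1, operator_of] at this
    have h00 : (1 : ℝ) = -1 := by simpa [Gate.operator] using congrFun (congrFun this 0) 0
    norm_num at h00

end Faithful

/-! ### Uniqueness of normal forms -/

section XCircuits

variable {n : ℕ}

theorem letterAt_shift (n : ℕ) (a : Bool × Bool) :
    ((letterAt (n + 1) a).1, fun i => (letterAt (n + 1) a).2 (1 + i)) = letterAt n a := by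
  refine Prod.ext rfl (funext fun i => ?_)
  simp [letterAt, Function.update_apply, add_comm]

theorem XCircuit.circuit_succ (M : XCircuit (n + 1)) :
    M.circuit = Circuit.place 0 (show 0 + 2 ≤ n + 1 + 1 by omega) (M.d 0).circuit *
      Circuit.place 1 (show 1 + (n + 1) ≤ n + 1 + 1 by omega)
        (XCircuit.circuit ⟨fun i => M.d i.succ, M.e⟩) := by
  rw [XCircuit.circuit, XCircuit.circuit, List.ofFn_succ, List.prod_cons, map_mul, map_list_prod,
    List.map_ofFn, mul_assoc]
  congr 1
  congr 1
  · congr 2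
    funext i
    simp only [Function.comp_apply, place_place, Fin.val_succ]
    congr 2
    omega
  · rw [place_place]
    congr 2
    omega

theorem DGate.actTwo_Z (d : DGate) :
    d.circuit.actTwo (false, (false, true), (false, false)) =
      (false, (false, false), (false, true)) := by
  cases d <;> rfl

/-- The letter on the lower wire that determines a gate of kind `D`. -/
def DGate.label : DGate → Bool × Bool
  | .D1 => (false, false)
  | .D2 => (true, false)
  | .D3 => (false, true)
  | .D4 => (true, true)

theorem DGate.label_injective : Function.Injective DGate.label := by
  intro d d' h
  cases d <;> cases d' <;> first | rfl | exact absurd h (by decide)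

theorem exists_DGate (s : Bool) (a b : Bool × Bool) (ha : a.1 = true) :
    ∃ (d : DGate) (z : Bool), d.circuit.actTwo (s, a, b) = (s, (false, false), (true, z)) := by
  obtain ⟨x, z⟩ := a
  obtain rfl : x = true := ha
  obtain ⟨x, w⟩ := b
  cases x <;> cases w
  · exact ⟨.D1, z, by revert s z; decide⟩
  · exact ⟨.D3, z, by revert s z; decide⟩
  · exact ⟨.D2, z, by revert s z; decide⟩
  · exact ⟨.D4, !z, by revert s z; decide⟩

theorem DGate.eq_label (d : DGate) (s : Bool) (a b : Bool × Bool)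
    (h1 : (d.circuit.actTwo (s, a, b)).2.1 = (false, false))
    (h2 : (d.circuit.actTwo (s, a, b)).2.2.1 = true) : a.1 = true ∧ b = d.label := by
  revert s a b
  cases d <;> decide

theorem exists_EGate (s : Bool) {a : Bool × Bool} (ha : a.1 = true) :
    ∃ e : EGate, e.circuit.actOne (s, a) = (false, a) := by
  obtain ⟨x, z⟩ := a
  obtain rfl : x = true := ha
  cases s
  · exact ⟨.E1, by cases z <;> rfl⟩
  · exact ⟨.E2, by cases z <;> rfl⟩

theorem EGate.fst_eq_true {e : EGate} {s z : Bool} {a : Bool × Bool}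
    (h : (e.circuit.actOne (s, a)).2 = (true, z)) : a.1 = true := by
  revert s a z
  cases e <;> decide

theorem EGate.eq_of_actOne {e e' : EGate} {s : Bool} {a : Bool × Bool} (ha : a.1 = true)
    (h : (e.circuit.actOne (s, a)).1 = (e'.circuit.actOne (s, a)).1) : e = e' := by
  cases e <;> cases e' <;> first | rfl | (exfalso; revert s a; decide)

theorem XCircuit.act_Z (M : XCircuit n) :
    M.circuit.act (letterAt 0 (false, true)) = letterAt n (false, true) := by
  induction n with
  | zero =>
    obtain ⟨d, e⟩ := M
    simp only [XCircuit.circuit, List.ofFn_zero, List.prod_nil, one_mul, act_place_one]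
    cases e <;> simp [letterAt, EGate.circuit, Circuit.actOne, Gate.actOne]
  | succ n ih =>
    rw [M.circuit_succ, act_mul, act_place_two]
    have e : ((letterAt 0 (false, true)).1, (letterAt 0 (false, true)).2 0,
        (letterAt 0 (false, true)).2 (0 + 1)) = (false, (false, true), (false, false)) := by
      simp [letterAt]
    rw [e, DGate.actTwo_Z]
    have e' : ((false, Function.update (Function.update (letterAt 0 (false, true)).2 0
        (false, false)) (0 + 1) (false, true)) : PauliString) = letterAt 1 (false, true) := by
      refine Prod.ext rfl (funext fun i => ?_)
      simp only [letterAt, Function.update_apply]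
      split_ifs <;> simp_all
    dsimp only
    rw [e', act_place, letterAt_shift, ih, ← letterAt_shift]
    refine Prod.ext rfl (funext fun i => ?_)
    dsimp only
    split_ifs with h
    · simp [letterAt, show i = 0 by omega]
    · exact congrArg _ (by omega)

theorem exists_XCircuit (q : PauliString) (hq : (q.2 0).1 = true)
    (hq' : ∀ i, n < i → q.2 i = (false, false)) :
    ∃ (M : XCircuit n) (z : Bool), M.circuit.act q = letterAt n (true, z) := by
  induction n generalizing q with
  | zero =>
    obtain ⟨e, he⟩ := exists_EGate q.1 hq
    refine ⟨⟨fun _ => .D1, e⟩, (q.2 0).2, ?_⟩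
    simp only [XCircuit.circuit, List.ofFn_zero, List.prod_nil, one_mul, act_place_one, he]
    refine Prod.ext rfl (funext fun i => ?_)
    by_cases hi : i = 0
    · subst hi
      simp [letterAt, ← hq]
    · simp [letterAt, hi, hq' i (by omega)]
  | succ n ih =>
    obtain ⟨d, z₁, hd⟩ := exists_DGate q.1 (q.2 0) (q.2 1) hq
    obtain ⟨M, z, hM⟩ := ih (q.1, fun i => Function.update (Function.update q.2 0 (false, false)) 1
      (true, z₁) (1 + i)) (by simp) (fun i hi => by
        dsimp only
        rw [Function.update_of_ne (by omega), Function.update_of_ne (by omega), hq' _ (by omega)])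
    refine ⟨⟨Fin.cons d M.d, M.e⟩, z, ?_⟩
    rw [XCircuit.circuit_succ, act_mul, act_place_two]
    simp only [Fin.cons_zero, Fin.cons_succ, zero_add, hd]
    rw [act_place]
    dsimp only
    rw [hM, ← letterAt_shift]
    refine Prod.ext rfl (funext fun i => ?_)
    dsimp only
    split_ifs with h
    · simp [letterAt, show i = 0 by omega]
    · exact congrArg _ (by omega)

theorem XCircuit.act_succ {M : XCircuit (n + 1)} {q : PauliString} {a : Bool × Bool}
    (h : M.circuit.act q = letterAt (n + 1) a) :
    ((M.d 0).circuit.actTwo (q.1, q.2 0, q.2 1)).2.1 = (false, false) ∧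
      (XCircuit.circuit ⟨fun i => M.d i.succ, M.e⟩).act
        (((M.d 0).circuit.actTwo (q.1, q.2 0, q.2 1)).1,
          fun i => if i = 0 then ((M.d 0).circuit.actTwo (q.1, q.2 0, q.2 1)).2.2
            else q.2 (1 + i)) = letterAt n a := by
  rw [XCircuit.circuit_succ, act_mul, act_place_two, act_place] at h
  simp only [zero_add] at h
  have e : (fun i => Function.update (Function.update q.2 0
      ((M.d 0).circuit.actTwo (q.1, q.2 0, q.2 1)).2.1) 1
        ((M.d 0).circuit.actTwo (q.1, q.2 0, q.2 1)).2.2 (1 + i)) =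
      fun i => if i = 0 then ((M.d 0).circuit.actTwo (q.1, q.2 0, q.2 1)).2.2
            else q.2 (1 + i) := by
    funext i
    simp only [Function.update_apply]
    split_ifs <;> first | rfl | omega
  rw [e] at h
  refine ⟨?_, ?_⟩
  · have := congrFun (congrArg Prod.snd h) 0
    simpa [letterAt] using this
  · rw [← letterAt_shift, ← h]
    refine Prod.ext rfl (funext fun i => ?_)
    dsimp only
    rw [if_neg (by omega), Nat.add_sub_cancel_left]

theorem XCircuit.fst_eq_true {M : XCircuit n} {q : PauliString} {z : Bool}
    (h : M.circuit.act q = letterAt n (true, z)) : (q.2 0).1 = true := by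
  induction n generalizing q with
  | zero =>
    simp only [XCircuit.circuit, List.ofFn_zero, List.prod_nil, one_mul, act_place_one] at h
    have hletter := congrFun (congrArg Prod.snd h) 0
    simp only [letterAt, Function.update_self] at hletter
    exact EGate.fst_eq_true hletter
  | succ n ih =>
    obtain ⟨h1, h2⟩ := XCircuit.act_succ h
    exact ((M.d 0).eq_label _ _ _ h1 (by simpa using ih h2)).1

theorem XCircuit.eq_of_act {M M' : XCircuit n} {q : PauliString} {z : Bool}
    (h : M.circuit.act q = letterAt n (true, z)) (h' : M'.circuit.act q = letterAt n (true, z)) :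
    M = M' := by
  induction n generalizing q with
  | zero =>
    obtain ⟨d, e⟩ := M
    obtain ⟨d', e'⟩ := M'
    have hx := XCircuit.fst_eq_true h
    obtain rfl : d = d' := Subsingleton.elim _ _
    simp only [XCircuit.circuit, List.ofFn_zero, List.prod_nil, one_mul, act_place_one] at h h'
    rw [EGate.eq_of_actOne hx (congrArg (fun p => p.1) (h.trans h'.symm))]
  | succ n ih =>
    obtain ⟨h1, h2⟩ := XCircuit.act_succ h
    obtain ⟨h1', h2'⟩ := XCircuit.act_succ h'
    have hd : M.d 0 = M'.d 0 := DGate.label_injective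
      (((M.d 0).eq_label _ _ _ h1 (by simpa using XCircuit.fst_eq_true h2)).2.symm.trans
        ((M'.d 0).eq_label _ _ _ h1' (by simpa using XCircuit.fst_eq_true h2')).2)
    rw [← hd] at h2'
    have tail_eq := ih h2 h2'
    obtain ⟨d, e⟩ := M
    obtain ⟨d', e'⟩ := M'
    simp only [XCircuit.mk.injEq] at tail_eq ⊢
    exact ⟨funext (Fin.cases hd fun i => congrFun tail_eq.1 i), tail_eq.2⟩

end XCircuits

section ZCircuits

variable {n : ℕ}

/-- The letter on the upper wire that determines a gate of kind `B` with given input type. -/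
def BGate.label {s t : WireType} : BGate s t → Bool × Bool
  | .B1 | .B5 => (false, false)
  | .B2 | .B6 => (true, false)
  | .B3 | .B7 => (false, true)
  | .B4 | .B8 => (true, true)

theorem BGate.eq_label {u t : WireType} (b : BGate u t) (s : Bool) (a c : Bool × Bool)
    (h : (b.circuit.actTwo (s, a, c)).2 = (t.letter, (false, false))) :
    (b.circuit.actTwo (s, a, c)).1 = s ∧ a = b.label ∧ c = u.letter := by
  revert s a c
  cases b <;> decide

theorem BGate.eq_of_label_eq {s t t' : WireType} {b : BGate s t} {b' : BGate s t'}
    (h : b.label = b'.label) : ∃ e : t' = t, e ▸ b' = b := by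
  cases b <;> cases b' <;> first | exact ⟨rfl, rfl⟩ | exact absurd h (by decide)

theorem AGate.eq_letter {t : WireType} (g : AGate t) (s : Bool) (a : Bool × Bool)
    (h : (g.circuit.actOne (s, a)).2 = t.letter) :
    (g.circuit.actOne (s, a)).1 = s ∧ a ≠ (false, false) := by
  revert s a
  cases g <;> decide

theorem AGate.eq_of_actOne {t t' : WireType} {g : AGate t} {g' : AGate t'} {s : Bool}
    {a : Bool × Bool} (h : (g.circuit.actOne (s, a)).2 = t.letter)
    (h' : (g'.circuit.actOne (s, a)).2 = t'.letter) : ∃ e : t' = t, e ▸ g' = g := by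
  cases g <;> cases g' <;> first | exact ⟨rfl, rfl⟩ | (exfalso; revert s a; decide)

theorem CGate.eq_Z {c : CGate} {s : Bool} {a : Bool × Bool}
    (h : c.circuit.actOne (s, a) = (false, (false, true))) : a = (false, true) := by
  revert s a
  cases c <;> decide

theorem CGate.eq_of_actOne {c c' : CGate} {s : Bool}
    (h : c.circuit.actOne (s, (false, true)) = (false, (false, true)))
    (h' : c'.circuit.actOne (s, (false, true)) = (false, (false, true))) : c = c' := by
  cases c <;> cases c' <;> first | rfl | (exfalso; revert s; decide)

theorem BLadder.act_eq {k : ℕ} {t : WireType} (r : BLadder k t) (hk : k < n) {q : PauliString}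
    (h0 : ((r.circuit hk).act q).2 0 = (false, true))
    (h1 : ∀ i, 0 < i → i ≤ k → ((r.circuit hk).act q).2 i = (false, false)) :
    q.2 k = t.letter ∧ ((r.circuit hk).act q).1 = q.1 ∧
      ∀ i, k < i → ((r.circuit hk).act q).2 i = q.2 i := by
  induction r generalizing q with
  | nil => exact ⟨h0, rfl, fun _ _ => rfl⟩
  | @cons k s t b r ih =>
    rw [BLadder.circuit, act_mul] at h0 h1 ⊢
    obtain ⟨e1, e2, e3⟩ := ih (by omega) h0 (fun i hi hik => h1 i hi (by omega))
    have e4 := e3 (k + 1) (by omega)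
    rw [h1 (k + 1) (by omega) le_rfl] at e4
    rw [act_place_two] at e1 e4
    simp only [Function.update_self, Function.update_of_ne (show k ≠ k + 1 by omega)] at e1 e4
    obtain ⟨l1, -, l3⟩ := b.eq_label _ _ _ (Prod.ext e1 e4.symm)
    refine ⟨l3, ?_, fun i hi => ?_⟩
    · rw [e2, act_place_two, l1]
    · rw [e3 i (by omega), act_place_two]
      dsimp only
      rw [Function.update_of_ne (by omega), Function.update_of_ne (by omega)]

theorem BLadder.eq_label {k : ℕ} {s t : WireType} {b : BGate s t} {r : BLadder k t}
    {hk : k + 1 < n} {q : PauliString} (h0 : (((r.cons b).circuit hk).act q).2 0 = (false, true))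
    (h1 : ∀ i, 0 < i → i ≤ k + 1 → (((r.cons b).circuit hk).act q).2 i = (false, false)) :
    q.2 k = b.label := by
  rw [BLadder.circuit, act_mul] at h0 h1
  obtain ⟨e1, -, e3⟩ := r.act_eq (by omega) h0 (fun i hi hik => h1 i hi (by omega))
  have e4 := e3 (k + 1) (by omega)
  rw [h1 (k + 1) (by omega) le_rfl] at e4
  rw [act_place_two] at e1 e4
  simp only [Function.update_self, Function.update_of_ne (show k ≠ k + 1 by omega)] at e1 e4
  exact (b.eq_label _ _ _ (Prod.ext e1 e4.symm)).2.1

theorem BLadder.eq_of_act {k : ℕ} {t : WireType} (r r' : BLadder k t) (hk : k < n)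
    {q : PauliString}
    (h0 : ((r.circuit hk).act q).2 0 = (false, true))
    (h1 : ∀ i, 0 < i → i ≤ k → ((r.circuit hk).act q).2 i = (false, false))
    (h0' : ((r'.circuit hk).act q).2 0 = (false, true))
    (h1' : ∀ i, 0 < i → i ≤ k → ((r'.circuit hk).act q).2 i = (false, false)) : r = r' := by
  induction r generalizing q with
  | nil =>
    cases r'
    rfl
  | @cons k s t b r ih =>
    cases r' with
    | @cons _ _ t' b' r' =>
    have hl : b.label = b'.label := (BLadder.eq_label h0 h1).symm.trans (BLadder.eq_label h0' h1')
    obtain ⟨rfl, rfl⟩ := BGate.eq_of_label_eq hl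
    rw [BLadder.circuit, act_mul] at h0 h1 h0' h1'
    rw [ih r' (by omega) h0 (fun i hi hik => h1 i hi (by omega)) h0'
      (fun i hi hik => h1' i hi (by omega))]

theorem ZCircuit.act_eq {L : ZCircuit n} {p : PauliString}
    (h : L.circuit.act p = letterAt 0 (false, true)) :
    let q := (Circuit.place (L.k : ℕ) (show (L.k : ℕ) + 1 ≤ n from L.k.isLt) L.a.circuit).act p
    (((L.b.circuit L.k.isLt).act q).2 0 = (false, true) ∧
      ∀ i, 0 < i → i ≤ (L.k : ℕ) → ((L.b.circuit L.k.isLt).act q).2 i = (false, false)) ∧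
    (L.a.circuit.actOne (p.1, p.2 L.k)).2 = L.t.letter ∧
    (∀ i, (L.k : ℕ) < i → p.2 i = (false, false)) ∧
    L.c.circuit.actOne (p.1, (false, true)) = (false, (false, true)) := by
  intro q
  rw [ZCircuit.circuit, act_mul, act_mul] at h
  change (Circuit.place 0 _ L.c.circuit).act ((L.b.circuit L.k.isLt).act q) = _ at h
  rw [act_place_one] at h
  have c1 := congrArg Prod.fst h
  have c2 := congrArg Prod.snd h
  dsimp only at c1 c2
  have c3 := congrFun c2 0
  rw [Function.update_self] at c3
  have c4 := Prod.ext (x := L.c.circuit.actOne _) (y := (false, (false, true))) c1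
    (by simpa [letterAt] using c3)
  have h0 := CGate.eq_Z c4
  have hi : ∀ i, 0 < i → ((L.b.circuit L.k.isLt).act q).2 i = (false, false) := by
    intro i hi
    have := congrFun c2 i
    simpa [letterAt, Function.update_of_ne hi.ne'] using this
  obtain ⟨e1, e2, e3⟩ := L.b.act_eq L.k.isLt h0 (fun i h _ => hi i h)
  have hq : q = _ := act_place_one (L.k : ℕ) (show (L.k : ℕ) + 1 ≤ n from L.k.isLt) L.a.circuit p
  have ea : (L.a.circuit.actOne (p.1, p.2 L.k)).2 = L.t.letter := by
    rw [hq] at e1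
    simpa using e1
  refine ⟨⟨h0, fun i h _ => hi i h⟩, ea, fun i hik => ?_, ?_⟩
  · have := e3 i hik
    rw [hi i (by omega), hq] at this
    dsimp only at this
    rw [Function.update_of_ne (by omega)] at this
    exact this.symm
  · rw [h0, e2, hq] at c4
    dsimp only at c4
    rwa [(L.a.eq_letter _ _ ea).1] at c4

theorem ZCircuit.eq_of_act {L L' : ZCircuit n} {p : PauliString}
    (h : L.circuit.act p = letterAt 0 (false, true))
    (h' : L'.circuit.act p = letterAt 0 (false, true)) : L = L' := by
  obtain ⟨⟨b1, b2⟩, a1, k1, c1⟩ := ZCircuit.act_eq h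
  obtain ⟨⟨b1', b2'⟩, a1', k1', c1'⟩ := ZCircuit.act_eq h'
  clear h h'
  obtain ⟨k, t, a, b, c⟩ := L
  obtain ⟨k', t', a', b', c'⟩ := L'
  dsimp only at *
  have hk : k = k' := by
    rcases lt_trichotomy k k' with h | h | h
    · exact absurd (k1 _ h) (a'.eq_letter _ _ a1').2
    · exact h
    · exact absurd (k1' _ h) (a.eq_letter _ _ a1).2
  subst hk
  obtain ⟨rfl, rfl⟩ := AGate.eq_of_actOne a1 a1'
  rw [b.eq_of_act b' k.isLt b1 b2 b1' b2', CGate.eq_of_actOne c1 c1']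

end ZCircuits

section Uniqueness

variable {n : ℕ}

theorem act_place_top (C : Circuit n) (p : PauliString) :
    (C.place 0 (show 0 + n ≤ n + 1 by omega)).act p = C.act p := by
  rw [act_place]
  simp

theorem Gate.act_eq_self {g : Gate n} {p : PauliString} (hp : ∀ i < n, p.2 i = (false, false)) :
    g.act p = p := by
  have update_self : ∀ {i}, i < n → Function.update p.2 i (false, false) = p.2 := fun hi =>
    Function.update_eq_self_iff.2 (hp _ hi).symm
  cases g with
  | neg => rfl
  | H i => simp [Gate.act, hp i i.isLt, update_self]
  | Z i => simp [Gate.act, hp i i.isLt]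
  | CZ i hi => simp [Gate.act, hp i (by omega), hp (i + 1) hi, update_self hi,
      update_self (show i < n by omega)]

theorem act_eq_self_of_forall_lt (C : Circuit n) {p : PauliString}
    (hp : ∀ i < n, p.2 i = (false, false)) : C.act p = p := by
  induction C using FreeMonoid.inductionOn' with
  | one => rfl
  | of_mul g C ih => rw [act_mul, act_of, Gate.act_eq_self hp, ih]

theorem act_letterAt_self (C : Circuit n) (a : Bool × Bool) :
    C.act (letterAt n a) = letterAt n a :=
  act_eq_self_of_forall_lt C fun i hi => by simp [letterAt, hi.ne]

theorem NormalCircuit.act_eq_of_cons {L : ZCircuit (n + 1)} {M : XCircuit n} {N : NormalCircuit n}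
    {p : PauliString} {a : Bool × Bool}
    (h : (NormalCircuit.cons L M N).circuit.act p = letterAt n a) :
    M.circuit.act (L.circuit.act p) = letterAt n a := by
  rw [NormalCircuit.circuit, act_mul, act_mul, act_place_top] at h
  exact act_injective N.circuit (h.trans (act_letterAt_self _ _).symm)

theorem NormalCircuit.eq_of_operator_eq {N N' : NormalCircuit n}
    (h : N.circuit.operator = N'.circuit.operator) : N = N' := by
  induction N with
  | scalar b =>
    cases N' with
    | scalar b' =>
      have h1 : (circ ([] : List (Gate 0))).operator = 1 := operator_one
      have h2 : (circ [(Gate.neg : Gate 0)]).operator = -1 := operator_of _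
      have h3 : (1 : Operator 0) ≠ -1 := by
        intro h
        have h00 : (1 : ℝ) = -1 := by simpa using congrFun (congrFun h 0) 0
        norm_num at h00
      cases b <;> cases b' <;> simp only [NormalCircuit.circuit, h1, h2] at h ⊢
      · exact absurd h h3
      · exact absurd h.symm h3
  | @cons n L M N ih =>
    cases N' with
    | cons L' M' N' =>
    have hact := act_eq_of_operator_eq h
    obtain ⟨p, hp⟩ := act_surjective (NormalCircuit.cons L M N).circuit (letterAt n (false, true))
    have hL := act_injective _ ((NormalCircuit.act_eq_of_cons hp).trans M.act_Z.symm)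
    have hL' := act_injective _
      ((NormalCircuit.act_eq_of_cons ((hact p).symm.trans hp)).trans M'.act_Z.symm)
    have e := ZCircuit.eq_of_act hL hL'
    subst e
    obtain ⟨q, hq⟩ := act_surjective (NormalCircuit.cons L M N).circuit (letterAt n (true, false))
    have e :=
      XCircuit.eq_of_act (NormalCircuit.act_eq_of_cons hq)
        (NormalCircuit.act_eq_of_cons ((hact q).symm.trans hq))
    subst e
    rw [NormalCircuit.circuit, NormalCircuit.circuit, operator_mul,
      operator_mul (L.circuit * M.circuit), operator_place, operator_place] at h
    rw [ih (embed_injective _ _ ((isUnit_operator _).mul_right_cancel h))]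

end Uniqueness

/-! ### Existence of normal forms -/

section Semiconj

theorem commute_iff_of_semiconjBy {M : Type*} [Monoid M] {u a a' b b' : M} (hu : IsUnit u)
    (ha : SemiconjBy u a a') (hb : SemiconjBy u b b') : Commute a b ↔ Commute a' b' := by
  rw [commute_iff_eq, commute_iff_eq, ← hu.mul_right_inj, (ha.mul_right hb).eq,
    (hb.mul_right ha).eq, hu.mul_left_inj]

theorem mul_self_eq_one_iff_of_semiconjBy {M : Type*} [Monoid M] {u a a' : M} (hu : IsUnit u)
    (ha : SemiconjBy u a a') : a * a = 1 ↔ a' * a' = 1 := by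
  rw [← hu.mul_right_inj, (ha.mul_right ha).eq, mul_one, hu.mul_eq_right]

end Semiconj

section Clifford

variable {n : ℕ}

/-- The operator `U` conjugates Pauli operators to Pauli operators. It is phrased without an
inverse of `U`. -/
def NormalizesPaulis (U : Operator n) : Prop :=
  ∀ p, ∃ q, SemiconjBy U (pauliOp n p) (pauliOp n q)

theorem NormalizesPaulis.mul {U V : Operator n} (hU : NormalizesPaulis U)
    (hV : NormalizesPaulis V) : NormalizesPaulis (U * V) := by
  intro p
  obtain ⟨q, hq⟩ := hV p
  obtain ⟨r, hr⟩ := hU q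
  exact ⟨r, hr.mul_left hq⟩

theorem normalizesPaulis_operator (C : Circuit n) : NormalizesPaulis C.operator :=
  fun p => ⟨C.act p, operator_mul_pauliOp C p⟩

theorem normalizesPaulis_transpose (C : Circuit n) : NormalizesPaulis C.operator.transpose := by
  intro p
  obtain ⟨q, rfl⟩ := act_surjective C p
  refine ⟨q, (isUnit_operator C).mul_left_cancel ((isUnit_operator C).mul_right_cancel ?_)⟩
  rw [mul_assoc, mul_assoc, mul_assoc, mul_assoc, transpose_mul_operator, mul_one,
    ← mul_assoc, operator_mul_transpose, one_mul, operator_mul_pauliOp]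

/-- Elements of the real Clifford group, as matrices: `U` is orthogonal, and conjugation by `U` and
by its inverse maps Pauli operators to Pauli operators. -/
structure IsClifford (U : Operator n) : Prop where
  mul_transpose : U * U.transpose = 1
  normalizes : NormalizesPaulis U
  normalizes_transpose : NormalizesPaulis U.transpose

theorem isClifford_operator (C : Circuit n) : IsClifford C.operator :=
  ⟨operator_mul_transpose C, normalizesPaulis_operator C, normalizesPaulis_transpose C⟩

theorem IsClifford.transpose_mul {U : Operator n} (hU : IsClifford U) : U.transpose * U = 1 :=
  mul_eq_one_comm.1 hU.mul_transpose

theorem IsClifford.isUnit {U : Operator n} (hU : IsClifford U) : IsUnit U :=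
  .of_mul_eq_one _ hU.mul_transpose

theorem IsClifford.mul {U V : Operator n} (hU : IsClifford U) (hV : IsClifford V) :
    IsClifford (U * V) := by
  refine ⟨?_, hU.normalizes.mul hV.normalizes, ?_⟩
  · rw [Matrix.transpose_mul, mul_assoc, ← mul_assoc V, hV.mul_transpose, one_mul,
      hU.mul_transpose]
  · rw [Matrix.transpose_mul]
    exact hV.normalizes_transpose.mul hU.normalizes_transpose

theorem IsClifford.transpose {U : Operator n} (hU : IsClifford U) : IsClifford U.transpose :=
  ⟨by rw [Matrix.transpose_transpose, hU.transpose_mul], hU.normalizes_transpose,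
    by rw [Matrix.transpose_transpose]; exact hU.normalizes⟩

theorem pauliOp_congr {p q : PauliString} (h1 : p.1 = q.1) (h2 : ∀ i < n, p.2 i = q.2 i) :
    pauliOp n p = pauliOp n q := by
  rw [pauliOp, pauliOp, h1]
  congr 2
  funext i
  rw [h2 i i.isLt]

theorem IsClifford.exists_preimage {U : Operator n} (hU : IsClifford U) (p : PauliString) :
    ∃ q, (∀ i, n ≤ i → q.2 i = (false, false)) ∧
      SemiconjBy U (pauliOp n q) (pauliOp n p) := by
  obtain ⟨q, hq⟩ := hU.normalizes_transpose p
  have hq' : SemiconjBy U (pauliOp n q) (pauliOp n p) := by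
    have := congrArg (fun A => U * A * U) hq.eq
    simp only [← mul_assoc, hU.mul_transpose, one_mul] at this
    rw [SemiconjBy, this, mul_assoc, mul_assoc, hU.transpose_mul, mul_one]
  refine ⟨(q.1, fun i => if i < n then q.2 i else (false, false)), fun i hi => if_neg (by omega),
    ?_⟩
  have restrict : pauliOp n (q.1, fun i => if i < n then q.2 i else (false, false)) =
      pauliOp n q := pauliOp_congr rfl fun i hi => if_pos hi
  rwa [restrict]

end Clifford

section Commutation

variable {n : ℕ}

theorem pauliOp_letterAt (i : Fin n) (a : Bool × Bool) :
    pauliOp n (letterAt i a) = onQubit i (pauliLetter a) := by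
  rw [pauliOp, onQubit]
  simp only [letterAt, boolSign, cond_false, Int.cast_one, one_smul]
  congr 1
  funext j
  simp only [Function.update_apply, Fin.val_inj]
  split_ifs
  · rfl
  · exact pauliLetter_one

theorem pauliOp_of_forall_eq {p : PauliString} (hp : ∀ i < n, p.2 i = (false, false)) :
    pauliOp n p = (boolSign p.1 : ℝ) • 1 := by
  rw [pauliOp]
  simp only [hp _ (Fin.isLt _), pauliLetter_one, tensor_one]

theorem pauliX_mul_pauliLetter (a : Bool × Bool) :
    pauliX * pauliLetter a = (boolSign a.2 : ℝ) • (pauliLetter a * pauliX) := by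
  obtain ⟨a, b⟩ := a
  ext i j
  cases a <;> cases b <;> fin_cases i <;> fin_cases j <;>
    simp [pauliLetter, pauliEntry, pauliX, boolSign, Matrix.mul_apply, Fin.sum_univ_two]

theorem commute_onQubit_pauliOp_iff {i : Fin n} {M : Matrix (Fin 2) (Fin 2) ℝ} {p : PauliString}
    {s : Bool} (hM : IsUnit (onQubit i M))
    (h : M * pauliLetter (p.2 i) = (boolSign s : ℝ) • (pauliLetter (p.2 i) * M)) :
    Commute (onQubit i M) (pauliOp n p) ↔ s = false := by
  rw [commute_iff_eq, onQubit_mul_pauliOp h, Function.update_eq_self, hM.mul_left_inj]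
  refine ⟨fun h => ?_, fun h => by simp [h]⟩
  exact Bool.xor_right_inj.1 ((pauliOp_injective h).1.trans p.1.xor_false.symm)

theorem commute_pauliZ_pauliOp_iff {i : Fin n} {p : PauliString} :
    Commute (onQubit i pauliZ) (pauliOp n p) ↔ (p.2 i).1 = false :=
  commute_onQubit_pauliOp_iff
    (.of_mul_eq_one _ (by rw [onQubit_mul_onQubit, pauliZ_mul_self, onQubit_one]))
    (pauliZ_mul_pauliLetter _)

theorem commute_pauliX_pauliOp_iff {i : Fin n} {p : PauliString} :
    Commute (onQubit i pauliX) (pauliOp n p) ↔ (p.2 i).2 = false :=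
  commute_onQubit_pauliOp_iff
    (.of_mul_eq_one _ (by rw [onQubit_mul_onQubit, pauliX_mul_self, onQubit_one]))
    (pauliX_mul_pauliLetter _)

theorem letterAt_Z_mul_self (i : Fin n) :
    pauliOp n (letterAt i (false, true)) * pauliOp n (letterAt i (false, true)) = 1 := by
  rw [pauliOp_letterAt, onQubit_mul_onQubit, pauliLetter_Z, pauliZ_mul_self, onQubit_one]

theorem letterAt_X_mul_self (i : Fin n) :
    pauliOp n (letterAt i (true, false)) * pauliOp n (letterAt i (true, false)) = 1 := by
  rw [pauliOp_letterAt, onQubit_mul_onQubit, pauliLetter_X, pauliX_mul_self, onQubit_one]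

theorem letterAt_Y_mul_self_ne_one (i : Fin n) :
    pauliOp n (letterAt i (true, true)) * pauliOp n (letterAt i (true, true)) ≠ 1 := by
  intro h
  have h00 := congrFun (congrFun h 0) 0
  rw [pauliOp_letterAt, onQubit_mul_onQubit, onQubit_apply, if_pos fun _ _ => rfl,
    Matrix.one_apply_eq] at h00
  have : (-1 : ℝ) = 1 := by
    simpa [pauliLetter, pauliEntry, Matrix.mul_apply, Fin.sum_univ_two] using h00
  norm_num at this

theorem not_commute_letterAt_Z_X (i : Fin n) :
    ¬ Commute (pauliOp n (letterAt i (false, true))) (pauliOp n (letterAt i (true, false))) := by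
  rw [pauliOp_letterAt _ (false, true), pauliLetter_Z, commute_pauliZ_pauliOp_iff]
  simp [letterAt]

end Commutation

section Block

variable {n : ℕ}

/-- The `2 × 2` block of `W` on qubit `i`, where the other bits of the row index are those of `x`
and the other bits of the column index are those of `y`. -/
def block (i : Fin n) (W : Operator n) (x y : Fin n → Fin 2) : Matrix (Fin 2) (Fin 2) ℝ :=
  Matrix.of fun a b => W (Function.update x i a) (Function.update y i b)

theorem onQubit_mul_apply (i : Fin n) (M : Matrix (Fin 2) (Fin 2) ℝ) (W : Operator n)
    (x y : Fin n → Fin 2) :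
    (onQubit i M * W) x y = ∑ u, M (x i) u * W (Function.update x i u) y := by
  rw [Matrix.mul_apply]
  symm
  refine Finset.sum_of_injOn (Function.update x i) (Function.update_injective x i).injOn
    (fun _ _ => Finset.mem_coe.2 (Finset.mem_univ _)) (fun z _ hz => ?_) fun u _ => ?_
  · rw [onQubit_apply, if_neg fun h => hz ⟨z i, by simp, ?_⟩, zero_mul]
    funext l
    by_cases hl : l = i
    · subst hl
      simp
    · rw [Function.update_of_ne hl, h l hl]
  · rw [onQubit_apply, if_pos fun l hl => (Function.update_of_ne hl _ _).symm,
      Function.update_self]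

theorem block_onQubit_mul (i : Fin n) (M : Matrix (Fin 2) (Fin 2) ℝ) (W : Operator n)
    (x y : Fin n → Fin 2) : block i (onQubit i M * W) x y = M * block i W x y := by
  ext a b
  rw [block, Matrix.of_apply, onQubit_mul_apply, Matrix.mul_apply]
  simp only [block, Matrix.of_apply, Function.update_self, Function.update_idem]

theorem block_transpose (i : Fin n) (W : Operator n) (x y : Fin n → Fin 2) :
    block i W.transpose x y = (block i W y x).transpose :=
  rfl

theorem block_mul_onQubit (i : Fin n) (M : Matrix (Fin 2) (Fin 2) ℝ) (W : Operator n)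
    (x y : Fin n → Fin 2) : block i (W * onQubit i M) x y = block i W x y * M := by
  rw [← Matrix.transpose_transpose (W * _), block_transpose, Matrix.transpose_mul,
    onQubit_transpose, block_onQubit_mul, Matrix.transpose_mul, Matrix.transpose_transpose,
    block_transpose, Matrix.transpose_transpose]

theorem commute_block {i : Fin n} {M : Matrix (Fin 2) (Fin 2) ℝ} {W : Operator n}
    (h : Commute (onQubit i M) W) (x y : Fin n → Fin 2) : Commute M (block i W x y) := by
  rw [commute_iff_eq, ← block_onQubit_mul, h.eq, block_mul_onQubit]

theorem eq_smul_one_of_commute {w : Matrix (Fin 2) (Fin 2) ℝ} (hZ : Commute pauliZ w)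
    (hX : Commute pauliX w) : w = w 0 0 • 1 := by
  have z01 := congrFun (congrFun hZ.eq 0) 1
  have z10 := congrFun (congrFun hZ.eq 1) 0
  have x01 := congrFun (congrFun hX.eq 0) 1
  simp only [pauliZ, pauliX, Matrix.mul_apply, Fin.sum_univ_two, Matrix.of_apply,
    Matrix.cons_val_zero, Matrix.cons_val_one, Matrix.cons_val'] at z01 z10 x01
  ext a b
  fin_cases a <;> fin_cases b <;> simp <;> linarith

end Block

section Embed

variable {n : ℕ}

theorem exists_embed {W : Operator (n + 1)} (hZ : Commute (onQubit (Fin.last n) pauliZ) W)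
    (hX : Commute (onQubit (Fin.last n) pauliX) W) :
    ∃ V : Operator n, W = embed 0 (show 0 + n ≤ n + 1 by omega) V := by
  refine ⟨Matrix.of fun u v => W (Fin.snoc u 0) (Fin.snoc v 0), ?_⟩
  have snoc_init : ∀ x : Fin (n + 1) → Fin 2, Fin.snoc (fun i : Fin n => x ⟨0 + i, by omega⟩) 0 =
      (Function.update x (Fin.last n) 0 : Fin (n + 1) → Fin 2) := by
    intro x
    funext i
    refine Fin.lastCases ?_ (fun i => ?_) i
    · simp
    · rw [Fin.snoc_castSucc, Function.update_of_ne (Fin.castSucc_lt_last i).ne]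
      exact congrArg x (Fin.ext (by simp))
  have W_eq_block : ∀ x y, W x y = block (Fin.last n) W x y (x (Fin.last n)) (y (Fin.last n)) := by
    simp [block]
  have outside_iff : ∀ x y : Fin (n + 1) → Fin 2,
      (∀ i : Fin (n + 1), ¬ (0 ≤ (i : ℕ) ∧ (i : ℕ) < 0 + n) → x i = y i) ↔
        x (Fin.last n) = y (Fin.last n) := by
    refine fun x y => ⟨fun h => h _ (by simp), fun h i hi => ?_⟩
    obtain rfl : i = Fin.last n := Fin.ext (by rw [Fin.val_last]; omega)
    exact h
  ext x y
  rw [embed_apply, Matrix.of_apply, snoc_init, snoc_init, W_eq_block,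
    eq_smul_one_of_commute (commute_block hZ x y) (commute_block hX x y)]
  simp only [outside_iff, Matrix.smul_apply, Matrix.one_apply, smul_eq_mul, mul_ite, mul_one,
    mul_zero]
  rfl

theorem embed_pauliOp (p : PauliString) (hp : p.2 n = (false, false)) :
    embed 0 (show 0 + n ≤ n + 1 by omega) (pauliOp n p) = pauliOp (n + 1) p := by
  ext x y
  rw [embed_apply, pauliOp_apply, pauliOp_apply, Fin.prod_univ_castSucc]
  simp only [zero_add, Fin.val_castSucc, Fin.val_last, hp]
  have last_factor : (pauliEntry (false, false) (x (Fin.last n)) (y (Fin.last n)) : ℝ) =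
      if x (Fin.last n) = y (Fin.last n) then 1 else 0 := by
    simp [pauliEntry]
  rw [last_factor]
  split_ifs with h1 h2 h2
  · rw [mul_one]; rfl
  · exact absurd (h1 (Fin.last n) (by simp)) h2
  · refine absurd (fun i hi => ?_) h1
    obtain rfl : i = Fin.last n := Fin.ext (by rw [Fin.val_last]; omega)
    exact h2
  · simp

theorem normalizesPaulis_of_embed {V : Operator n}
    (hW : IsClifford (embed 0 (show 0 + n ≤ n + 1 by omega) V))
    (hZ : Commute (onQubit (Fin.last n) pauliZ) (embed 0 (show 0 + n ≤ n + 1 by omega) V))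
    (hX : Commute (onQubit (Fin.last n) pauliX) (embed 0 (show 0 + n ≤ n + 1 by omega) V)) :
    NormalizesPaulis V := by
  intro p
  obtain ⟨q, hq⟩ := hW.normalizes (p.1, Function.update p.2 n (false, false))
  have q1 : (q.2 n).1 = false := (commute_pauliZ_pauliOp_iff (i := Fin.last n)).1
    ((commute_iff_of_semiconjBy hW.isUnit hZ.symm hq).1 (commute_pauliZ_pauliOp_iff.2 (by simp)))
  have q2 : (q.2 n).2 = false := (commute_pauliX_pauliOp_iff (i := Fin.last n)).1
    ((commute_iff_of_semiconjBy hW.isUnit hX.symm hq).1 (commute_pauliX_pauliOp_iff.2 (by simp)))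
  have hp : pauliOp n (p.1, Function.update p.2 n (false, false)) = pauliOp n p :=
    pauliOp_congr rfl fun i hi => Function.update_of_ne (by omega) _ _
  rw [← embed_pauliOp _ (Function.update_self _ _ _), hp,
    ← embed_pauliOp q (Prod.ext q1 q2), SemiconjBy, ← embed_mul, ← embed_mul] at hq
  exact ⟨q, embed_injective _ _ hq⟩

theorem commute_onQubit_embed_transpose {m k : ℕ} {h : k + m ≤ n} {i : Fin n}
    {M : Matrix (Fin 2) (Fin 2) ℝ} {V : Operator m} (hM : M.transpose = M)
    (comm : Commute (onQubit i M) (embed k h V)) :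
    Commute (onQubit i M) (embed k h V.transpose) := by
  have := congrArg Matrix.transpose comm.eq
  rw [Matrix.transpose_mul, Matrix.transpose_mul, onQubit_transpose, hM, embed_transpose] at this
  exact this.symm

theorem pauliX_transpose : pauliX.transpose = pauliX := by
  ext i j
  fin_cases i <;> fin_cases j <;> simp [pauliX]

theorem isClifford_of_embed {V : Operator n}
    (hW : IsClifford (embed 0 (show 0 + n ≤ n + 1 by omega) V))
    (hZ : Commute (onQubit (Fin.last n) pauliZ) (embed 0 (show 0 + n ≤ n + 1 by omega) V))
    (hX : Commute (onQubit (Fin.last n) pauliX) (embed 0 (show 0 + n ≤ n + 1 by omega) V)) :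
    IsClifford V := by
  refine ⟨embed_injective 0 (show 0 + n ≤ n + 1 by omega) ?_, normalizesPaulis_of_embed hW hZ hX,
    normalizesPaulis_of_embed ?_ (commute_onQubit_embed_transpose pauliZ_transpose hZ)
      (commute_onQubit_embed_transpose pauliX_transpose hX)⟩
  · rw [embed_mul, ← embed_transpose, hW.mul_transpose, embed_one]
  · rw [← embed_transpose]
    exact hW.transpose

end Embed

section Existence

variable {n : ℕ}

theorem exists_ZCircuit {p : PauliString} (hp : ∃ i < n + 1, p.2 i ≠ (false, false))
    (hp' : ∀ i, n + 1 ≤ i → p.2 i = (false, false))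
    (mul_self : pauliOp (n + 1) p * pauliOp (n + 1) p = 1) :
    ∃ L : ZCircuit (n + 1), L.circuit.act p = letterAt 0 (false, true) := by
  obtain ⟨t, C, ⟨h1, h2, h3⟩, h4⟩ := exists_reduction p hp
  have hC : C.act p = letterAt ((0 : Fin (n + 1)) : ℕ) t.letter := by
    refine Prod.ext h1 (funext fun i => ?_)
    rcases Nat.eq_zero_or_pos i with rfl | hi
    · simpa [letterAt] using h2
    · rw [show (letterAt ((0 : Fin (n + 1)) : ℕ) t.letter).2 i = (false, false) by
        simp [letterAt, hi.ne']]
      by_cases hin : i < n + 1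
      · exact h3 i hi hin
      · rw [act_of_le C p (by omega), hp' i (by omega)]
  have image_mul_self := (mul_self_eq_one_iff_of_semiconjBy (isUnit_operator C)
    (operator_mul_pauliOp C p)).1 mul_self
  cases t with
  | single =>
    obtain ⟨L, rfl⟩ := h4 rfl
    exact ⟨L, hC⟩
  | double =>
    rw [hC] at image_mul_self
    exact absurd image_mul_self (letterAt_Y_mul_self_ne_one 0)

theorem exists_XCircuit_of_not_commute {q : PauliString}
    (hq : ∀ i, n < i → q.2 i = (false, false))
    (not_comm : ¬ Commute (onQubit 0 pauliZ) (pauliOp (n + 1) q))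
    (mul_self : pauliOp (n + 1) q * pauliOp (n + 1) q = 1) :
    ∃ M : XCircuit n, M.circuit.act q = letterAt n (true, false) := by
  obtain ⟨M, z, hM⟩ := exists_XCircuit q
    (by simpa using mt commute_pauliZ_pauliOp_iff.2 not_comm) hq
  have image_mul_self := (mul_self_eq_one_iff_of_semiconjBy (isUnit_operator M.circuit)
    (operator_mul_pauliOp M.circuit q)).1 mul_self
  cases z with
  | false => exact ⟨M, hM⟩
  | true =>
    rw [hM] at image_mul_self
    exact absurd image_mul_self (letterAt_Y_mul_self_ne_one (Fin.last n))

theorem exists_ZCircuit_XCircuit {p q : PauliString}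
    (hp : ∀ i, n + 1 ≤ i → p.2 i = (false, false)) (hq : ∀ i, n + 1 ≤ i → q.2 i = (false, false))
    (hpp : pauliOp (n + 1) p * pauliOp (n + 1) p = 1)
    (hqq : pauliOp (n + 1) q * pauliOp (n + 1) q = 1)
    (not_comm : ¬ Commute (pauliOp (n + 1) p) (pauliOp (n + 1) q)) :
    ∃ (L : ZCircuit (n + 1)) (M : XCircuit n),
      (L.circuit * M.circuit).act p = letterAt n (false, true) ∧
        (L.circuit * M.circuit).act q = letterAt n (true, false) := by
  have nontrivial : ∃ i < n + 1, p.2 i ≠ (false, false) := by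
    by_contra! h
    refine not_comm ?_
    rw [pauliOp_of_forall_eq h]
    exact (Commute.one_left _).smul_left _
  obtain ⟨L, hL⟩ := exists_ZCircuit nontrivial hp hpp
  have semiconj_p := operator_mul_pauliOp L.circuit p
  have semiconj_q := operator_mul_pauliOp L.circuit q
  rw [hL, show letterAt 0 (false, true) = letterAt ((0 : Fin (n + 1)) : ℕ) (false, true) from rfl,
    pauliOp_letterAt, pauliLetter_Z] at semiconj_p
  obtain ⟨M, hM⟩ := exists_XCircuit_of_not_commute (q := L.circuit.act q)
    (fun i hi => by rw [act_of_le _ _ (by omega), hq i (by omega)])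
    (mt (commute_iff_of_semiconjBy (isUnit_operator L.circuit) semiconj_p semiconj_q).2 not_comm)
    ((mul_self_eq_one_iff_of_semiconjBy (isUnit_operator L.circuit) semiconj_q).1 hqq)
  exact ⟨L, M, by rw [act_mul, hL, M.act_Z], by rw [act_mul, hM]⟩

theorem IsClifford.exists_ZCircuit_XCircuit {U : Operator (n + 1)} (hU : IsClifford U) :
    ∃ (L : ZCircuit (n + 1)) (M : XCircuit n),
      Commute (onQubit (Fin.last n) pauliZ) (U * (L.circuit * M.circuit).operator.transpose) ∧
      Commute (onQubit (Fin.last n) pauliX) (U * (L.circuit * M.circuit).operator.transpose) := by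
  obtain ⟨p, hp, semiconj_p⟩ := hU.exists_preimage (letterAt (Fin.last n : ℕ) (false, true))
  obtain ⟨q, hq, semiconj_q⟩ := hU.exists_preimage (letterAt (Fin.last n : ℕ) (true, false))
  obtain ⟨L, M, hKp, hKq⟩ := RealStabilizer.exists_ZCircuit_XCircuit hp hq
    ((mul_self_eq_one_iff_of_semiconjBy hU.isUnit semiconj_p).2 (letterAt_Z_mul_self _))
    ((mul_self_eq_one_iff_of_semiconjBy hU.isUnit semiconj_q).2 (letterAt_X_mul_self _))
    (mt (commute_iff_of_semiconjBy hU.isUnit semiconj_p semiconj_q).1 (not_commute_letterAt_Z_X _))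
  have comm {r : PauliString} {a : Bool × Bool}
      (hr : SemiconjBy U (pauliOp (n + 1) r) (pauliOp (n + 1) (letterAt (Fin.last n : ℕ) a)))
      (hKr : (L.circuit * M.circuit).act r = letterAt n a) :
      Commute (onQubit (Fin.last n) (pauliLetter a))
        (U * (L.circuit * M.circuit).operator.transpose) := by
    refine (isUnit_operator (L.circuit * M.circuit)).mul_right_cancel ?_
    have hK := operator_mul_pauliOp (L.circuit * M.circuit) r
    rw [hKr, show letterAt n a = letterAt (Fin.last n : ℕ) a from rfl, pauliOp_letterAt] at hK
    rw [SemiconjBy, pauliOp_letterAt] at hr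
    rw [mul_assoc, mul_assoc U, transpose_mul_operator, mul_one, ← hr, mul_assoc _ (onQubit _ _),
      ← hK, ← mul_assoc, mul_assoc U, transpose_mul_operator, mul_one]
  exact ⟨L, M, pauliLetter_Z ▸ comm semiconj_p hKp, pauliLetter_X ▸ comm semiconj_q hKq⟩

theorem exists_scalar_of_orthogonal {U : Operator 0} (hU : U * U.transpose = 1) :
    ∃ b, (NormalCircuit.scalar b).circuit.operator = U := by
  have entry_mul_self : U 0 0 * U 0 0 = 1 := by
    have := congrFun (congrFun hU 0) 0
    rwa [Matrix.mul_apply, Fintype.sum_subsingleton _ (0 : Fin 0 → Fin 2), Matrix.transpose_apply,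
      Matrix.one_apply_eq] at this
  rcases mul_self_eq_one_iff.1 entry_mul_self with h | h
  · refine ⟨false, ?_⟩
    rw [show (NormalCircuit.scalar false).circuit = 1 from rfl, operator_one]
    ext x y
    rw [Subsingleton.elim x 0, Subsingleton.elim y 0, h, Matrix.one_apply_eq]
  · refine ⟨true, ?_⟩
    rw [show (NormalCircuit.scalar true).circuit = FreeMonoid.of .neg from rfl, operator_of]
    ext x y
    rw [Subsingleton.elim x 0, Subsingleton.elim y 0, h, Gate.operator, Matrix.neg_apply,
      Matrix.one_apply_eq]

theorem IsClifford.exists_normalCircuit {U : Operator n} (hU : IsClifford U) :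
    ∃ N : NormalCircuit n, N.circuit.operator = U := by
  induction n with
  | zero =>
    obtain ⟨b, hb⟩ := exists_scalar_of_orthogonal hU.mul_transpose
    exact ⟨.scalar b, hb⟩
  | succ n ih =>
    obtain ⟨L, M, hZ, hX⟩ := hU.exists_ZCircuit_XCircuit
    have hW := hU.mul (isClifford_operator (L.circuit * M.circuit)).transpose
    obtain ⟨V, hV⟩ := exists_embed hZ hX
    rw [hV] at hW hZ hX
    obtain ⟨N, hN⟩ := ih (isClifford_of_embed hW hZ hX)
    refine ⟨.cons L M N, ?_⟩
    rw [NormalCircuit.circuit, operator_mul, operator_place, hN, ← hV, mul_assoc,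
      transpose_mul_operator, mul_one]

end Existence

/-! ### The real Clifford group -/

section CliffordGroup

variable {n : ℕ}

theorem pauliOp_mul_transpose (p : PauliString) :
    pauliOp n p * (pauliOp n p).transpose = 1 := by
  have h : ∀ a, pauliLetter a * (pauliLetter a).transpose = 1 := by
    rintro ⟨x, z⟩
    ext i j
    cases x <;> cases z <;> fin_cases i <;> fin_cases j <;>
      simp [pauliLetter, pauliEntry, Matrix.mul_apply, Fin.sum_univ_two]
  have h2 : (boolSign p.1 : ℝ) * boolSign p.1 = 1 := by
    cases p.1 <;> simp [boolSign]
  rw [pauliOp, Matrix.transpose_smul, tensor_transpose, Matrix.smul_mul, Matrix.mul_smul,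
    tensor_mul, smul_smul, h2, one_smul]
  simp only [h, tensor_one]

theorem pauliLetter_eq (a : Bool × Bool) :
    pauliLetter a = 1 ∨ pauliLetter a = pauliX ∨ pauliLetter a = pauliZ ∨
      pauliLetter a = pauliX * pauliZ := by
  obtain ⟨_ | _, _ | _⟩ := a
  · exact .inl pauliLetter_one
  · exact .inr (.inr (.inl pauliLetter_Z))
  · exact .inr (.inl pauliLetter_X)
  · exact .inr (.inr (.inr pauliLetter_Y))

theorem exists_pauliLetter_eq {P : Matrix (Fin 2) (Fin 2) ℝ}
    (hP : P = 1 ∨ P = pauliX ∨ P = pauliZ ∨ P = pauliX * pauliZ) : ∃ a, pauliLetter a = P := by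
  rcases hP with rfl | rfl | rfl | rfl
  · exact ⟨_, pauliLetter_one⟩
  · exact ⟨_, pauliLetter_X⟩
  · exact ⟨_, pauliLetter_Z⟩
  · exact ⟨_, pauliLetter_Y⟩

theorem exists_pauliOp_eq (s : Bool) (a : Fin n → Bool × Bool) :
    ∃ p, pauliOp n p = (boolSign s : ℝ) • tensor fun i => pauliLetter (a i) :=
  ⟨(s, fun i => if h : i < n then a ⟨i, h⟩ else (false, false)), by simp [pauliOp]⟩

theorem mem_pauliGroup_iff {U : Matrix.orthogonalGroup (Fin n → Fin 2) ℝ} :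
    U ∈ pauliGroup n ↔ ∃ p, (U : Operator n) = pauliOp n p := by
  constructor
  · rintro ⟨P, hP, hU⟩
    choose a ha using fun i => exists_pauliLetter_eq (hP i)
    obtain rfl : (fun i => pauliLetter (a i)) = P := funext ha
    rcases hU with hU | hU
    · obtain ⟨p, hp⟩ := exists_pauliOp_eq false a
      exact ⟨p, by rw [hp, hU]; simp [boolSign]⟩
    · obtain ⟨p, hp⟩ := exists_pauliOp_eq true a
      exact ⟨p, by rw [hp, hU]; simp [boolSign]⟩
  · rintro ⟨p, hp⟩
    refine ⟨fun i => pauliLetter (p.2 i), fun i => pauliLetter_eq _, ?_⟩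
    rw [hp, pauliOp]
    cases p.1 <;> simp [boolSign]

theorem normalizesPaulis_of_mem_cliffordGroup {U : Matrix.orthogonalGroup (Fin n → Fin 2) ℝ}
    (hU : U ∈ cliffordGroup n) : NormalizesPaulis (U : Operator n) := by
  intro p
  let P : Matrix.orthogonalGroup (Fin n → Fin 2) ℝ :=
    ⟨pauliOp n p, (Matrix.mem_orthogonalGroup_iff _ _).2 (pauliOp_mul_transpose p)⟩
  have conj_mem : U * P * U⁻¹ ∈ pauliGroup n :=
    (Subgroup.mem_set_normalizer_iff.1 hU P).1 (mem_pauliGroup_iff.2 ⟨p, rfl⟩)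
  obtain ⟨q, hq⟩ := mem_pauliGroup_iff.1 conj_mem
  have conj_mul : U * P = U * P * U⁻¹ * U := (inv_mul_cancel_right _ _).symm
  exact ⟨q, by rw [← hq]; exact congrArg Subtype.val conj_mul⟩

theorem NormalizesPaulis.conj_mem_pauliGroup {U V : Matrix.orthogonalGroup (Fin n → Fin 2) ℝ}
    (hU : NormalizesPaulis (U : Operator n)) (hV : V ∈ pauliGroup n) :
    U * V * U⁻¹ ∈ pauliGroup n := by
  obtain ⟨p, hp⟩ := mem_pauliGroup_iff.1 hV
  obtain ⟨q, hq⟩ := hU p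
  refine mem_pauliGroup_iff.2 ⟨q, ?_⟩
  change (U : Operator n) * V * (U : Operator n).transpose = _
  rw [hp, hq.eq, mul_assoc, (Matrix.mem_orthogonalGroup_iff _ _).1 U.2, mul_one]

theorem mem_cliffordGroup_iff {U : Matrix.orthogonalGroup (Fin n → Fin 2) ℝ} :
    U ∈ cliffordGroup n ↔ IsClifford (U : Operator n) := by
  constructor
  · intro hU
    exact ⟨(Matrix.mem_orthogonalGroup_iff _ _).1 U.2, normalizesPaulis_of_mem_cliffordGroup hU,
      normalizesPaulis_of_mem_cliffordGroup (inv_mem hU)⟩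
  · intro hU
    refine Subgroup.mem_set_normalizer_iff.2 fun V =>
      ⟨hU.normalizes.conj_mem_pauliGroup, fun hV => ?_⟩
    have inv_conj_mem := NormalizesPaulis.conj_mem_pauliGroup (U := U⁻¹) hU.normalizes_transpose hV
    rwa [show U⁻¹ * (U * V * U⁻¹) * U⁻¹⁻¹ = V by group] at inv_conj_mem

/-- The operator of a gate as an element of the real Clifford group. -/
noncomputable def Gate.clifford (g : Gate n) : cliffordGroup n :=
  have h : IsClifford g.operator := operator_of g ▸ isClifford_operator (FreeMonoid.of g)
  ⟨⟨g.operator, (Matrix.mem_orthogonalGroup_iff _ _).2 h.mul_transpose⟩,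
    mem_cliffordGroup_iff.2 h⟩

theorem lift_clifford (C : Circuit n) :
    (((FreeMonoid.lift (fun g : Gate n => MulOpposite.op g.clifford) C).unop :
      Matrix.orthogonalGroup (Fin n → Fin 2) ℝ) : Operator n) = C.operator := by
  induction C using FreeMonoid.inductionOn' with
  | one => rw [map_one, operator_one]; rfl
  | of_mul g C ih =>
    rw [map_mul, operator_mul, ← ih, operator_of]
    rfl

/-- The homomorphism from the presented monoid to the real Clifford group. -/
noncomputable def toClifford (n : ℕ) : PresentedMonoid (CircuitRel n) →* (cliffordGroup n)ᵐᵒᵖ :=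
  PresentedMonoid.lift (fun g => MulOpposite.op g.clifford) fun C D h =>
    MulOpposite.unop_injective <| Subtype.ext <| Subtype.ext <| by
      rw [lift_clifford, lift_clifford, CircuitRel.operator_eq h]

theorem toClifford_mk (C : Circuit n) :
    (((toClifford n (PresentedMonoid.mk (CircuitRel n) C)).unop :
      Matrix.orthogonalGroup (Fin n → Fin 2) ℝ) : Operator n) = C.operator :=
  lift_clifford C

theorem toClifford_bijective (n : ℕ) : Function.Bijective (toClifford n) := by
  constructor
  · intro x y h
    obtain ⟨C, rfl⟩ := exists_cls x
    obtain ⟨D, rfl⟩ := exists_cls y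
    refine cls_eq_of_operator_eq ?_
    rw [← toClifford_mk, ← toClifford_mk, h]
  · intro U
    obtain ⟨N, hN⟩ := (mem_cliffordGroup_iff.1 U.unop.2).exists_normalCircuit
    refine ⟨cls N.circuit, MulOpposite.unop_injective (Subtype.ext (Subtype.ext ?_))⟩
    rw [toClifford_mk, hN]

end CliffordGroup

/-! ### Finiteness of the presentation -/

section Finiteness

variable {n : ℕ}

instance : Finite (Gate n) := by
  refine Finite.of_injective (β := Option (Fin n ⊕ Fin n ⊕ Fin n)) (fun g => match g with
    | .neg => none
    | .H i => some (.inl i)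
    | .Z i => some (.inr (.inl i))
    | .CZ i hi => some (.inr (.inr ⟨i, by omega⟩))) ?_
  intro g g' h
  cases g <;> cases g' <;> simp_all

theorem CircuitRel.length_le {C D : Circuit n} (h : CircuitRel n C D) :
    C.toList.length ≤ 14 ∧ D.toList.length ≤ 14 := by
  cases h with
  | slide g g' hd => exact ⟨by simp, by simp⟩
  | reduced huv k h =>
    cases huv <;> simp [Circuit.place]

theorem circuitRel_finite (n : ℕ) :
    {r : Circuit n × Circuit n | CircuitRel n r.1 r.2}.Finite := by
  have h : {C : Circuit n | C.toList.length ≤ 14}.Finite := List.finite_length_le (Gate n) 14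
  exact (h.prod h).subset fun _ hr => hr.length_le

end Finiteness

end RealStabilizer

/-- Every real Clifford circuit `C` has a unique normal form (the normal circuit with the same
operator) and can be rewritten into it with the reduced relations. Moreover the finitely many gates
and relations on `n` wires present the real stabilizer group, by sending a circuit to its operator
(the opposite group appears because circuits are read from left to right). -/
theorem mainTheorem4 (n : ℕ) :
    (∀ C : RealStabilizer.Circuit n, ∃ N : RealStabilizer.NormalCircuit n,
      N.circuit.operator = C.operator ∧
      (∀ N' : RealStabilizer.NormalCircuit n, N'.circuit.operator = C.operator → N' = N) ∧
      RealStabilizer.Rewrites C N.circuit) ∧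
    Finite (RealStabilizer.Gate n) ∧
    {r : RealStabilizer.Circuit n × RealStabilizer.Circuit n |
      RealStabilizer.CircuitRel n r.1 r.2}.Finite ∧
    ∃ e : PresentedMonoid (RealStabilizer.CircuitRel n) ≃*
        (RealStabilizer.cliffordGroup n)ᵐᵒᵖ,
      ∀ C : RealStabilizer.Circuit n,
        (((e (PresentedMonoid.mk (RealStabilizer.CircuitRel n) C)).unop :
          Matrix.orthogonalGroup (Fin n → Fin 2) ℝ) : RealStabilizer.Operator n) = C.operator := by
  refine ⟨fun C => ?_, inferInstance, RealStabilizer.circuitRel_finite n,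
    MulEquiv.ofBijective _ (RealStabilizer.toClifford_bijective n), RealStabilizer.toClifford_mk⟩
  obtain ⟨N, hN⟩ := (RealStabilizer.isClifford_operator C).exists_normalCircuit
  exact ⟨N, hN, fun N' h => RealStabilizer.NormalCircuit.eq_of_operator_eq (h.trans hN.symm),
    RealStabilizer.cls_eq_iff.1 (RealStabilizer.cls_eq_of_operator_eq hN.symm)⟩
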